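/- **Setting.** Let $d\ge 1$, let $\mathbb S^d\subset\mathbb R^{d+1}$ be the unit sphere with surface measure $\nu$ (of total mass the area of $\mathbb S^d$), and let $\mu$ be the normalized Haar measure on $SO(d+1)$. For $l\ge 0$ let $\mathfrak B^l$ be the space of complex spherical harmonics of degree $l$ (restrictions to $\mathbb S^d$ of homogeneous harmonic polynomials of degree $l$ in $d+1$ variables), let $N(d,l)$ be its dimension, and let $\{B^l_q\}_{1\le q\le N(d,l)}$ be any orthonormal basis of $\mathfrak B^l$ in $L^2(\nu)$. The Fourier–Laplace series of $f:\mathbb S^d\to\mathbb R$ is $\sum_{l\ge0}\big(\sum_{q}\phi^l_q(f)B^l_q\big)$ with $\phi^l_q(f)=\int f\,\overline{B^l_q}\,d\nu$; it converges absolutely on $\mathbb S^d$ if $\sum_l\big|\sum_q\phi^l_q(f)B^l_q(x)\big|<\infty$ for every $x\in\mathbb S^d$. For $g:SO(d+1)\to\mathbb R$ let $\tilde\phi^l(g)$ be the $N(d,l)\times N(d,l)$ matrix with entries $\tilde\phi^l_{qr}(g)=\int g(u)\int_{\mathbb S^d}\overline{B^l_q(ux)}B^l_r(x)\,d\nu(x)\,d\mu(u)$.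 Let $X$ be a random element of $\mathbb S^d$ with density $f_X$ with respect to $\nu$, let $Y=m(X)+\epsilon$ with $\epsilon$ integrable, $E(\epsilon|X)=0$, and $Z=UX$, where $U$ is a random element of $SO(d+1)$, independent of $(X,\epsilon)$, with known square-integrable density $f_U\ge 0$ with respect to $\mu$ such that all the matrices $\tilde\phi^l(f_U)$ are invertible. Let $(Y_1,Z_1),(Y_2,Z_2),\dots$ be i.i.d. copies of $(Y,Z)$. For truncation levels $T_n$ define $$K_{T}(x,z)=\sum_{l=0}^{\lfloor T\rfloor}\sum_{q}\Big(\sum_{r}\big(\tilde\phi^l(f_U)\big)^{-1}_{qr}\overline{B^l_r(z)}\Big)B^l_q(x),\qquad \hat f_X(x)=\frac1n\sum_{i=1}^n\mathrm{Re}\,K_{T_n}(x,Z_i),$$ $$\hat m(x)=\frac{1}{\hat f_X(x)}\,\frac1n\sum_{i=1}^n\mathrm{Re}(K_{T_n}(x,Z_i))\,Y_i,$$ $$\hat s_2^2(x)=\frac1{\hat f_X(x)^{2}}\Big(\frac1n\sum_{i=1}^n\big(\mathrm{Re}(K_{T_n}(x,Z_i))(Y_i-\hat m(x))\big)^2-\Big(\frac1n\sum_{i=1}^n\mathrm{Re}(K_{T_n}(x,Z_i))(Y_i-\hat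 m(x))\Big)^2\Big).$$ **Theorem.** Let $\beta\ge0$ and $k\in\mathbb N$ with $k>d/4$. Assume: - (S1)-(i): there is $c_1>0$ with $\|(\tilde\phi^l(f_U))^{-1}\|_{\rm op}\le c_1 l^\beta$ for all $l\ge1$; - (A1): $f_X,m\in C^{2k}(\mathbb S^d)$; (A2)-(i): $\inf_{\mathbb S^d} f_X>0$; - (T1′): $T_n\asymp n^{1/(4k+2\beta+d)}$; - (B4): for some $\delta>0$, $E|Y|^{2+\delta}<\infty$ and $E(|Y|^{2+\delta}|X)$ is (essentially) bounded, and $E(\epsilon^2|X)$ is (essentially) bounded away from zero; - (B1) with $q=d$: for each $x\in\mathbb S^d$ there is $c>0$ with $E\big((\mathrm{Re}\,K_{T_n}(x,Z))^2\big)\ge c\,T_n^{2\beta+d}$ for all $n\ge 1$; - the Fourier–Laplace series of $\Delta^k_{\mathbb S^d}f_X$ and of $\Delta^k_{\mathbb S^d}(m f_X)$ converge absolutely on $\mathbb S^d$, where $\Delta_{\mathbb S^d}$ is the Laplace–Beltrami operator. Then for every $x\in\mathbb S^d$ $$\sqrt n\,\frac{\hat m(x)-m(x)}{\hat s_2(x)}\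 \overset{d}{\longrightarrow}\ N(0,1),$$ and hence, for every $\alpha\in(0,1)$, with $z_{\alpha/2}$ the upper $\alpha/2$-quantile of $N(0,1)$, $$P\Big(\hat m(x)-z_{\alpha/2}\tfrac{\hat s_2(x)}{\sqrt n}<m(x)<\hat m(x)+z_{\alpha/2}\tfrac{\hat s_2(x)}{\sqrt n}\Big)\longrightarrow 1-\alpha .$$ -/

import Mathlib

open MeasureTheory ProbabilityTheory Filter Topology
open scoped Manifold ComplexConjugate

namespace SphereDeconv

/-! ### The unit sphere, its surface measure, and the rotation group -/

/-- The unit sphere of `ℝ^(d+1)`. -/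
abbrev Sph (d : ℕ) : Type := Metric.sphere (0 : EuclideanSpace ℝ (Fin (d + 1))) 1

/-- The surface measure on the sphere: `(d + 1)` times the Lebesgue measure of the cone
over a set. Its total mass is the surface area of the sphere. -/
noncomputable def surf (d : ℕ) : Measure (Sph d) :=
  (volume : Measure (EuclideanSpace ℝ (Fin (d + 1)))).toSphere

/-- The special orthogonal group `SO(d+1)`, with the topology induced from matrices. -/
abbrev SO (d : ℕ) : Type := Matrix.specialOrthogonalGroup (Fin (d + 1)) ℝ

/-- The Borel sigma-algebra of `SO(d+1)`. -/
instance instMeasurableSpaceSO (d : ℕ) : MeasurableSpace (SO d) := borel _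

instance instBorelSpaceSO (d : ℕ) : BorelSpace (SO d) := ⟨rfl⟩

theorem SO.mul_transpose {d : ℕ} (u : SO d) : u.1 * u.1.transpose = 1 :=
  (Matrix.mem_orthogonalGroup_iff (Fin (d + 1)) ℝ).1
    (Matrix.mem_specialOrthogonalGroup_iff.1 u.2).1

theorem SO.transpose_mul {d : ℕ} (u : SO d) : u.1.transpose * u.1 = 1 :=
  (Matrix.mem_orthogonalGroup_iff' (Fin (d + 1)) ℝ).1
    (Matrix.mem_specialOrthogonalGroup_iff.1 u.2).1

theorem SO.coe_inv {d : ℕ} (u : SO d) : (u⁻¹).1 = u.1.transpose := by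
  have h : (u⁻¹).1 * u.1 = 1 := congrArg Subtype.val (inv_mul_cancel u)
  calc (u⁻¹).1 = (u⁻¹).1 * (u.1 * u.1.transpose) := by rw [SO.mul_transpose, mul_one]
    _ = u.1.transpose := by rw [← mul_assoc, h, one_mul]

instance instIsTopologicalGroupSO (d : ℕ) : IsTopologicalGroup (SO d) where
  continuous_inv := by
    refine continuous_induced_rng.2 ?_
    have h : (Subtype.val ∘ fun u : SO d => u⁻¹) = fun u : SO d => u.1.transpose :=
      funext fun u => SO.coe_inv u
    rw [h]
    exact continuous_subtype_val.matrix_transpose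

theorem mem_SO_iff {d : ℕ} (A : Matrix (Fin (d + 1)) (Fin (d + 1)) ℝ) :
    A ∈ Matrix.specialOrthogonalGroup (Fin (d + 1)) ℝ ↔ A * A.transpose = 1 ∧ A.det = 1 := by
  rw [Matrix.mem_specialOrthogonalGroup_iff, Matrix.mem_orthogonalGroup_iff]

instance instCompactSpaceSO (d : ℕ) : CompactSpace (SO d) := by
  refine isCompact_iff_compactSpace.1 ?_
  have hK : IsCompact (Set.pi Set.univ fun _ : Fin (d + 1) =>
      Set.pi Set.univ fun _ : Fin (d + 1) => Set.Icc (-1 : ℝ) 1) :=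
    isCompact_univ_pi fun _ => isCompact_univ_pi fun _ => isCompact_Icc
  refine IsCompact.of_isClosed_subset hK ?_ ?_
  · have h : ((Matrix.specialOrthogonalGroup (Fin (d + 1)) ℝ : Submonoid _) :
        Set (Matrix (Fin (d + 1)) (Fin (d + 1)) ℝ)) =
        {A | A * A.transpose = 1} ∩ {A | A.det = 1} := by
      ext A
      exact mem_SO_iff A
    rw [h]
    refine IsClosed.inter (isClosed_eq ?_ continuous_const) (isClosed_eq ?_ continuous_const)
    · exact continuous_id.matrix_mul continuous_id.matrix_transpose
    · exact continuous_id.matrix_det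
  · intro A hA i _ j _
    have h1 := congrFun (congrFun ((mem_SO_iff A).1 hA).1 i) i
    simp only [Matrix.mul_apply, Matrix.transpose_apply, Matrix.one_apply_eq] at h1
    have h2 : A i j * A i j ≤ ∑ k, A i k * A i k :=
      Finset.single_le_sum (f := fun k => A i k * A i k)
        (fun k _ => mul_self_nonneg _) (Finset.mem_univ j)
    exact abs_le.1 (abs_le_one_iff_mul_self_le_one.2 (by linarith))

/-- The normalized Haar measure on `SO(d+1)`. -/
noncomputable def haarSO (d : ℕ) : Measure (SO d) :=
  Measure.haarMeasure (⊤ : TopologicalSpace.PositiveCompacts (SO d))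

/-- The matrix-vector product `u x`, as a point of the sphere. -/
noncomputable def rot {d : ℕ} (u : SO d) (x : Sph d) : Sph d :=
  ⟨WithLp.toLp 2 (u.1.mulVec (WithLp.ofLp x.1)), by
    have hx : ‖x.1‖ = 1 := by simp
    rw [mem_sphere_zero_iff_norm]
    have h : ‖(WithLp.toLp 2 (u.1.mulVec (WithLp.ofLp x.1)) :
        EuclideanSpace ℝ (Fin (d + 1)))‖ ^ 2 = ‖x.1‖ ^ 2 := by
      rw [EuclideanSpace.real_norm_sq_eq, EuclideanSpace.real_norm_sq_eq]
      have e : ∀ v : Fin (d + 1) → ℝ, ∑ i, v i ^ 2 = v ⬝ᵥ v := fun v => by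
        simp [dotProduct, sq]
      rw [e, e, Matrix.dotProduct_mulVec, Matrix.vecMul_mulVec, SO.transpose_mul,
        Matrix.vecMul_one]
    rw [hx] at h
    exact (pow_eq_one_iff_of_nonneg (norm_nonneg _) two_ne_zero).1 (by simpa using h)⟩

/-! ### Spherical harmonics and Fourier transforms -/

/-- The space of complex spherical harmonics of degree `l` on the unit sphere of `ℝ^(d+1)`:
restrictions to the sphere of homogeneous harmonic polynomials of degree `l`. -/
noncomputable def sphHarm (d l : ℕ) : Submodule ℂ (Sph d → ℂ) where
  carrier := {f | ∃ p : MvPolynomial (Fin (d + 1)) ℂ, p.IsHomogeneous l ∧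
    ∑ i, MvPolynomial.pderiv i (MvPolynomial.pderiv i p) = 0 ∧
    ∀ x : Sph d, f x = MvPolynomial.eval (fun i => ((x.1 i : ℝ) : ℂ)) p}
  add_mem' := by
    rintro f g ⟨p, hp, hp', hpf⟩ ⟨r, hr, hr', hrg⟩
    refine ⟨p + r, hp.add hr, ?_, fun x => ?_⟩
    · simp only [map_add, Finset.sum_add_distrib, hp', hr', add_zero]
    · simp [hpf x, hrg x]
  zero_mem' := ⟨0, MvPolynomial.isHomogeneous_zero _ _ _, by simp, fun x => by simp⟩
  smul_mem' := by
    rintro c f ⟨p, hp, hp', hpf⟩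
    refine ⟨MvPolynomial.C c * p, by simpa using (MvPolynomial.isHomogeneous_C _ c).mul hp, ?_,
      fun x => by simp [hpf x]⟩
    have h : ∀ i, MvPolynomial.pderiv i (MvPolynomial.pderiv i (MvPolynomial.C c * p)) =
        MvPolynomial.C c * MvPolynomial.pderiv i (MvPolynomial.pderiv i p) := fun i => by
      rw [MvPolynomial.pderiv_C_mul, MvPolynomial.pderiv_C_mul]
    simp only [h, ← Finset.mul_sum, hp', mul_zero]

/-- `N(d,l)`, the dimension of the space of spherical harmonics of degree `l`. -/
noncomputable def N (d l : ℕ) : ℕ := Module.finrank ℂ (sphHarm d l)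

/-- A choice, for every degree `l`, of functions `B l q`, `q = 1, …, N(d,l)`, on the sphere. -/
abbrev HarmFamily (d : ℕ) : Type := (l : ℕ) → Fin (N d l) → Sph d → ℂ

/-- For each degree `l`, `(B l q)_q` is an orthonormal basis of the space of spherical harmonics
of degree `l`, for the inner product of `L²(surf)`. -/
def IsHarmONB {d : ℕ} (B : HarmFamily d) : Prop :=
  ∀ l, (∀ q r, ∫ x, B l q x * conj (B l r x) ∂(surf d) = if q = r then 1 else 0) ∧
    Submodule.span ℂ (Set.range (B l)) = sphHarm d l

/-- The hyperspherical Fourier coefficient of `f` at degree `l` and order `q`. -/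
noncomputable def fourierCoeff {d : ℕ} (B : HarmFamily d) (f : Sph d → ℝ) (l : ℕ)
    (q : Fin (N d l)) : ℂ :=
  ∫ x, (f x : ℂ) * conj (B l q x) ∂(surf d)

/-- The degree-`l` term of the Fourier-Laplace series of `f`, evaluated at `x`. -/
noncomputable def fourierLaplaceTerm {d : ℕ} (B : HarmFamily d) (f : Sph d → ℝ) (l : ℕ)
    (x : Sph d) : ℂ :=
  ∑ q, fourierCoeff B f l q * B l q x

/-- Absolute convergence of the Fourier-Laplace series of `f` at every point of the sphere. -/
def FourierLaplaceAbsConv {d : ℕ} (B : HarmFamily d) (f : Sph d → ℝ) : Prop :=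
  ∀ x, Summable fun l => ‖fourierLaplaceTerm B f l x‖

/-- The function `D^l_{qr}` on `SO(d+1)`. -/
noncomputable def rotCoeff {d : ℕ} (B : HarmFamily d) (l : ℕ) (q r : Fin (N d l)) (u : SO d) : ℂ :=
  ∫ x, conj (B l q (rot u x)) * B l r x ∂(surf d)

/-- The rotational Fourier transform at degree `l` of a function on `SO(d+1)`. -/
noncomputable def rotFourier {d : ℕ} (B : HarmFamily d) (g : SO d → ℝ) (l : ℕ) :
    Matrix (Fin (N d l)) (Fin (N d l)) ℂ :=
  Matrix.of fun q r => ∫ u, (g u : ℂ) * rotCoeff B l q r u ∂(haarSO d)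

/-- The operator norm of a complex matrix for the standard norm on `ℂ^n`. -/
noncomputable def opNorm {n : ℕ} (A : Matrix (Fin n) (Fin n) ℂ) : ℝ :=
  ‖Matrix.toEuclideanCLM (𝕜 := ℂ) A‖

/-! ### The Laplace-Beltrami operator -/

/-- The extension of `f` to `ℝ^(d+1)`, homogeneous of degree `0` away from the origin. -/
noncomputable def radialExt {d : ℕ} (f : Sph d → ℝ) (y : EuclideanSpace ℝ (Fin (d + 1))) : ℝ :=
  open Classical in
  if h : y = 0 then 0 else f ⟨‖y‖⁻¹ • y, by simp [norm_smul, h]⟩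

/-- The Laplace-Beltrami operator of the sphere: the restriction to the sphere of the Euclidean
Laplacian of the extension of `f` that is constant along rays. -/
noncomputable def sphLaplacian {d : ℕ} (f : Sph d → ℝ) : Sph d → ℝ :=
  fun x => Laplacian.laplacian (radialExt f) x.1

/-- `s`-times continuously differentiable real functions on the sphere. -/
def IsCs {d : ℕ} (s : ℕ) (f : Sph d → ℝ) : Prop :=
  ContMDiff (𝓡 d) 𝓘(ℝ, ℝ) (s : WithTop ℕ∞) f

/-! ### Estimators -/

/-- The deconvolution kernel `K_T(x,z)` with truncation level `T`; `fU` is the (known) density of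
the measurement error. -/
noncomputable def kernel {d : ℕ} (B : HarmFamily d) (fU : SO d → ℝ) (T : ℝ) (x z : Sph d) : ℂ :=
  ∑ l ∈ Finset.range (⌊T⌋₊ + 1), ∑ q,
    (∑ r, (rotFourier B fU l)⁻¹ q r * conj (B l r z)) * B l q x

/-- The density estimator at `x`, from the observations `z 0, …, z (n-1)`. -/
noncomputable def fHat {d : ℕ} (B : HarmFamily d) (fU : SO d → ℝ) (T : ℝ) (n : ℕ)
    (z : ℕ → Sph d) (x : Sph d) : ℝ :=
  (n : ℝ)⁻¹ * ∑ i ∈ Finset.range n, (kernel B fU T x (z i)).re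

/-- The regression estimator at `x`, from the observations `(y i, z i)`, `i < n`. -/
noncomputable def mHat {d : ℕ} (B : HarmFamily d) (fU : SO d → ℝ) (T : ℝ) (n : ℕ)
    (y : ℕ → ℝ) (z : ℕ → Sph d) (x : Sph d) : ℝ :=
  (fHat B fU T n z x)⁻¹ * ((n : ℝ)⁻¹ * ∑ i ∈ Finset.range n, (kernel B fU T x (z i)).re * y i)

/-- The estimator `ŝ₂²(x)` of the asymptotic variance of the regression estimator. -/
noncomputable def sHatSq {d : ℕ} (B : HarmFamily d) (fU : SO d → ℝ) (T : ℝ) (n : ℕ)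
    (y : ℕ → ℝ) (z : ℕ → Sph d) (x : Sph d) : ℝ :=
  ((fHat B fU T n z x) ^ 2)⁻¹ *
    ((n : ℝ)⁻¹ * ∑ i ∈ Finset.range n,
        ((kernel B fU T x (z i)).re * (y i - mHat B fU T n y z x)) ^ 2
      - ((n : ℝ)⁻¹ * ∑ i ∈ Finset.range n,
        (kernel B fU T x (z i)).re * (y i - mHat B fU T n y z x)) ^ 2)

/-- `ŝ₂(x)`. -/
noncomputable def sHat {d : ℕ} (B : HarmFamily d) (fU : SO d → ℝ) (T : ℝ) (n : ℕ)
    (y : ℕ → ℝ) (z : ℕ → Sph d) (x : Sph d) : ℝ :=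
  Real.sqrt (sHatSq B fU T n y z x)

/-- The upper `a`-quantile `z_a` of the standard normal distribution: the `(1 - a)`-quantile. -/
noncomputable def normalUpperQuantile (a : ℝ) : ℝ :=
  sInf {t : ℝ | 1 - a ≤ cdf (gaussianReal 0 1) t}

end SphereDeconv

/-! Put `w_i = Re K_{T_n}(x, Z_i)`, `a = m(x)`, `v_n = E w²` and `s_n² = E (w (Y - a))²`. The
estimator is a ratio of averages, so `m̂ - a` is the average of `w_i (Y_i - a)` divided by the
average of the weights. The weighted residuals around `m̂` average to zero, hence the average weight
cancels in the studentized statistic (`ratio_stat_eq`). What remains is `√n · avg(w (Y - a)) / s_n`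
times the inverse square root of `avg((w (Y - m̂))²) / s_n²`. The first factor is asymptotically
normal by a Lyapunov central limit theorem for triangular arrays (`LyapunovArray.clt`), the second
tends to one in probability (`RatioArray.tendsto_var`), and Slutsky's theorem gives
`RatioArray.clt`. Coverage follows from the normal limit and the vanishing probability that the
estimated standard deviation is zero (`tendsto_coverage`).

The moment conditions of `RatioArray` come from harmonic analysis. Multiplication by the inverse
matrices undoes the random rotation, so the mean of the kernel, and of the kernel times `Y`, is a
partial Fourier-Laplace sum of `f_X`, respectively of `m f_X` (`integral_kernel_mul`). The bias is
thus a truncation error. Since `Δ^k` multiplies the degree `l` term by `(-l(l+d-1))^k`, absolute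
convergence of the series of `Δ^k f` makes this error `o(T^(-2k))`
(`tendsto_pow_mul_truncation_error`). With `v_n ≥ c T^(2β+d)` the normalized bias is at most a
constant times `√n T^(-2k-β-d/2) o(1)`, and the rate of `T_n` keeps `√n T^(-2k-β-d/2)` bounded; the
little-o replaces undersmoothing. The kernel is at most of order `T^(β+d)` (`norm_kernel_le`), so
the Lyapunov ratio is controlled by `T^d / n`, and `v_n / n` by `T^(2β+2d) / n`, which tends to zero
because `d < 4k`.

That the series of a `C^(2k)` function sums to the function (`hasSum_fourierLaplaceTerm`) rests on
Green's identity (`integral_laplacian_mul_harm`), Bessel's inequality, the constancy of the sum of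
squares of a basis (`IsHarmONB.sqSum_eq`), and completeness (`eq_zero_of_orthogonal`). Completeness
combines Stone-Weierstrass with the decomposition of polynomials into harmonic ones times powers of
the squared norm (`mem_harmonicSpan`). -/

namespace SphereDeconv

/-! ### Harmonic polynomials -/

section HarmonicPolynomials

open MvPolynomial

variable {σ : Type*} [Fintype σ]

/-- The Laplacian of a polynomial. -/
noncomputable def polyLaplacian : MvPolynomial σ ℂ →ₗ[ℂ] MvPolynomial σ ℂ :=
  ∑ i, (pderiv i).toLinearMap ∘ₗ (pderiv i).toLinearMap

theorem polyLaplacian_apply (p : MvPolynomial σ ℂ) :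
    polyLaplacian p = ∑ i, pderiv i (pderiv i p) := by
  simp [polyLaplacian]

/-- The sum of the squares of the variables. -/
noncomputable def sumSq (σ : Type*) [Fintype σ] : MvPolynomial σ ℂ := ∑ i, X i ^ 2

theorem isHomogeneous_sumSq : (sumSq σ).IsHomogeneous 2 :=
  IsHomogeneous.sum _ _ _ fun i _ => by simpa using (isHomogeneous_X ℂ i).pow 2

theorem pderiv_sumSq (i : σ) : pderiv i (sumSq σ) = 2 * X i := by
  classical
  simp only [sumSq, map_sum, pderiv_pow, pderiv_X]
  rw [Finset.sum_eq_single i]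
  · simp
  · intro j _ hj
    simp [Pi.single_eq_of_ne hj]
  · simp

/-- Product rule: the cross term is `4 ∑ xᵢ ∂ᵢ q`, which Euler's identity turns into `4 m q`. -/
theorem polyLaplacian_sumSq_mul {q : MvPolynomial σ ℂ} {m : ℕ} (hq : q.IsHomogeneous m) :
    polyLaplacian (sumSq σ * q) =
      ((2 * Fintype.card σ + 4 * m : ℕ) : MvPolynomial σ ℂ) * q + sumSq σ * polyLaplacian q := by
  have h : ∀ i, pderiv i (pderiv i (sumSq σ * q)) =
      2 * q + 4 * (X i * pderiv i q) + sumSq σ * pderiv i (pderiv i q) := fun i => by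
    have h2 : pderiv i (2 * X i * q) = 2 * q + 2 * X i * pderiv i q := by
      have : (2 : MvPolynomial σ ℂ) = C 2 := (map_ofNat C 2).symm
      rw [this, mul_assoc, pderiv_C_mul, pderiv_mul, pderiv_X_self]
      ring
    rw [pderiv_mul, pderiv_sumSq, map_add, h2, pderiv_mul, pderiv_sumSq]
    ring
  rw [polyLaplacian_apply, polyLaplacian_apply, Finset.sum_congr rfl fun i _ => h i,
    Finset.sum_add_distrib, Finset.sum_add_distrib, ← Finset.mul_sum, ← Finset.mul_sum,
    ← Finset.mul_sum, hq.sum_X_mul_pderiv]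
  simp only [Finset.sum_const, Finset.card_univ, nsmul_eq_mul]
  push_cast
  ring

/-- The explicit factor is a nonzero integer when there is at least one variable, so dividing by it
inverts the Laplacian on products of this shape. -/
theorem polyLaplacian_sumSq_pow_mul {h : MvPolynomial σ ℂ} {m : ℕ} (hh : h.IsHomogeneous m)
    (h0 : polyLaplacian h = 0) (j : ℕ) :
    polyLaplacian (sumSq σ ^ (j + 1) * h) =
      ((2 * (j + 1) * (2 * m + Fintype.card σ + 2 * j) : ℕ) : MvPolynomial σ ℂ) *
        (sumSq σ ^ j * h) := by
  induction j with
  | zero =>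
    simp only [zero_add, pow_one, pow_zero, one_mul]
    rw [polyLaplacian_sumSq_mul hh, h0]
    push_cast
    ring
  | succ j ih =>
    have hd : (sumSq σ ^ (j + 1) * h).IsHomogeneous (2 * (j + 1) + m) :=
      (isHomogeneous_sumSq.pow _).mul hh
    rw [pow_succ' _ (j + 1), mul_assoc, polyLaplacian_sumSq_mul hd, ih]
    push_cast
    ring

theorem IsHomogeneous.polyLaplacian {p : MvPolynomial σ ℂ} {l : ℕ} (hp : p.IsHomogeneous l) :
    (polyLaplacian p).IsHomogeneous (l - 2) := by
  rw [polyLaplacian_apply]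
  exact IsHomogeneous.sum _ _ _ fun i _ => by simpa using! hp.pderiv.pderiv

/-- The span of the products of powers of `sumSq` with homogeneous harmonic polynomials, of total
degree `l`. -/
noncomputable def harmonicSpan (σ : Type*) [Fintype σ] (l : ℕ) : Submodule ℂ (MvPolynomial σ ℂ) :=
  Submodule.span ℂ {p | ∃ (j m : ℕ) (h : MvPolynomial σ ℂ), h.IsHomogeneous m ∧
    polyLaplacian h = 0 ∧ 2 * j + m = l ∧ p = sumSq σ ^ j * h}

/-- On a generator, multiply by `sumSq` and divide by the factor of `polyLaplacian_sumSq_pow_mul`;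
then extend linearly. `Nonempty σ` excludes a zero factor when `j = m = 0`. -/
theorem exists_polyLaplacian_eq [Nonempty σ] {l : ℕ} {q : MvPolynomial σ ℂ}
    (hq : q ∈ harmonicSpan σ l) :
    ∃ r ∈ harmonicSpan σ (l + 2), r.IsHomogeneous (l + 2) ∧ polyLaplacian r = q := by
  induction hq using Submodule.span_induction with
  | mem p hp =>
    obtain ⟨j, m, h, hh, h0, hl, rfl⟩ := hp
    have hc : ((2 * (j + 1) * (2 * m + Fintype.card σ + 2 * j) : ℕ) : ℂ) ≠ 0 := by
      have := Fintype.card_pos (α := σ)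
      exact Nat.cast_ne_zero.2 (by positivity)
    refine ⟨((2 * (j + 1) * (2 * m + Fintype.card σ + 2 * j) : ℕ) : ℂ)⁻¹ •
      (sumSq σ ^ (j + 1) * h), Submodule.smul_mem _ _ (Submodule.subset_span
        ⟨j + 1, m, h, hh, h0, by omega, rfl⟩), ?_, ?_⟩
    · have := ((isHomogeneous_sumSq (σ := σ)).pow (j + 1)).mul hh
      rw [show 2 * (j + 1) + m = l + 2 by omega] at this
      exact (homogeneousSubmodule σ ℂ (l + 2)).smul_mem _ this
    · rw [map_smul, polyLaplacian_sumSq_pow_mul hh h0, ← C_eq_coe_nat, ← smul_eq_C_mul, smul_smul,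
        inv_mul_cancel₀ hc, one_smul]
  | zero => exact ⟨0, Submodule.zero_mem _, isHomogeneous_zero _ _ _, map_zero _⟩
  | add p q _ _ hp hq =>
    obtain ⟨r, hr, hr', hr''⟩ := hp
    obtain ⟨s, hs, hs', hs''⟩ := hq
    exact ⟨r + s, Submodule.add_mem _ hr hs, hr'.add hs', by rw [map_add, hr'', hs'']⟩
  | smul c p _ hp =>
    obtain ⟨r, hr, hr', hr''⟩ := hp
    exact ⟨c • r, Submodule.smul_mem _ _ hr, (homogeneousSubmodule σ ℂ (l + 2)).smul_mem c hr',
      by rw [map_smul, hr'']⟩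

theorem pderiv_eq_zero_of_isHomogeneous_zero {τ : Type*} {p : MvPolynomial τ ℂ}
    (hp : p.IsHomogeneous 0) (i : τ) : pderiv i p = 0 := by
  rw [totalDegree_eq_zero_iff_eq_C.1 ((totalDegree_zero_iff_isHomogeneous _).2 hp)]
  exact pderiv_C

/-- Every homogeneous polynomial is a combination of harmonic polynomials times powers of
the sum of squares. -/
theorem mem_harmonicSpan [Nonempty σ] (l : ℕ) (p : MvPolynomial σ ℂ) (hp : p.IsHomogeneous l) :
    p ∈ harmonicSpan σ l := by
  induction l using Nat.strong_induction_on generalizing p with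
  | _ l ih =>
  have key : polyLaplacian p = 0 → p ∈ harmonicSpan σ l := fun h0 =>
    Submodule.subset_span ⟨0, l, p, hp, h0, by simp, by simp⟩
  by_cases hl : l < 2
  · refine key ?_
    rw [polyLaplacian_apply]
    refine Finset.sum_eq_zero fun i _ => pderiv_eq_zero_of_isHomogeneous_zero ?_ i
    have := hp.pderiv (i := i)
    -- Truncated subtraction covers `l = 0` as well as `l = 1`.
    rwa [show l - 1 = 0 by omega] at this
  · obtain ⟨k, rfl⟩ := Nat.exists_eq_add_of_le' (not_lt.1 hl)
    -- By induction the Laplacian of `p` lies in the span two degrees lower, so it has a preimage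
    -- `r` in the span; then `p - r` is harmonic and `p = (p - r) + r`.
    obtain ⟨r, hr, hr', hr''⟩ := exists_polyLaplacian_eq
      (ih k (by omega) _ (by simpa using IsHomogeneous.polyLaplacian hp))
    have h1 : p - r ∈ harmonicSpan σ (k + 2) :=
      Submodule.subset_span ⟨0, k + 2, p - r, hp.sub hr', by rw [map_sub, hr'', sub_self],
        by simp, by simp⟩
    simpa using Submodule.add_mem _ h1 hr

/-- Linear substitution in a polynomial. -/
noncomputable def linSubst (A : Matrix σ σ ℝ) : MvPolynomial σ ℂ →ₐ[ℂ] MvPolynomial σ ℂ :=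
  aeval fun i => ∑ j, C ((A i j : ℝ) : ℂ) * X j

theorem pderiv_linSubst (A : Matrix σ σ ℝ) (p : MvPolynomial σ ℂ) (j : σ) :
    pderiv j (linSubst A p) = ∑ i, C ((A i j : ℝ) : ℂ) * linSubst A (pderiv i p) := by
  classical
  induction p using MvPolynomial.induction_on with
  | C a => simp [linSubst, MvPolynomial.algebraMap_eq]
  | add p q hp hq => simp only [map_add, hp, hq, mul_add, Finset.sum_add_distrib]
  | mul_X p k hp =>
    have hX : pderiv j (linSubst A (X k)) = C ((A k j : ℝ) : ℂ) := by
      simp only [linSubst, aeval_X, map_sum, pderiv_C_mul, pderiv_X, Pi.single_apply]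
      simp
    have h1 : ∀ i, linSubst A (pderiv i (p * X k)) =
        linSubst A (pderiv i p) * linSubst A (X k) +
          if k = i then linSubst A p else 0 := fun i => by
      rw [pderiv_mul, map_add, map_mul, map_mul, pderiv_X, Pi.single_apply]
      split_ifs <;> simp
    rw [map_mul, pderiv_mul, hX, hp]
    simp only [h1, mul_add, Finset.sum_add_distrib, Finset.sum_mul, mul_ite, mul_zero,
      Finset.sum_ite_eq, Finset.mem_univ, if_true]
    congr 1
    · exact Finset.sum_congr rfl fun i _ => by ring
    · ring

/-- By the chain rule the second derivatives are weighted by the inner products of rows of `A`, and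
orthonormality leaves only the diagonal terms. This makes spherical harmonics invariant under
orthogonal maps. -/
theorem polyLaplacian_linSubst [DecidableEq σ] {A : Matrix σ σ ℝ} (hA : A * A.transpose = 1)
    (p : MvPolynomial σ ℂ) :
    polyLaplacian (linSubst A p) = linSubst A (polyLaplacian p) := by
  have h (i k : σ) : ∑ j, C ((A i j : ℝ) : ℂ) * C ((A k j : ℝ) : ℂ) =
      if i = k then (1 : MvPolynomial σ ℂ) else 0 := by
    have := congrFun (congrFun hA i) k
    simp only [Matrix.mul_apply, Matrix.transpose_apply, Matrix.one_apply] at this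
    simp only [← C_mul, ← Complex.ofReal_mul, ← map_sum, ← Complex.ofReal_sum, this]
    split_ifs <;> simp
  calc polyLaplacian (linSubst A p)
      = ∑ j, ∑ i, ∑ k, (C ((A i j : ℝ) : ℂ) * C ((A k j : ℝ) : ℂ)) *
          linSubst A (pderiv k (pderiv i p)) := by
        rw [polyLaplacian_apply]
        refine Finset.sum_congr rfl fun j _ => ?_
        rw [pderiv_linSubst, map_sum]
        refine Finset.sum_congr rfl fun i _ => ?_
        rw [pderiv_C_mul, pderiv_linSubst, Finset.mul_sum]
        exact Finset.sum_congr rfl fun k _ => by ring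
    _ = ∑ i, ∑ k, (∑ j, C ((A i j : ℝ) : ℂ) * C ((A k j : ℝ) : ℂ)) *
          linSubst A (pderiv k (pderiv i p)) := by
        rw [Finset.sum_comm]
        refine Finset.sum_congr rfl fun i _ => ?_
        rw [Finset.sum_comm]
        exact Finset.sum_congr rfl fun k _ => by rw [Finset.sum_mul]
    _ = linSubst A (polyLaplacian p) := by
        simp only [h, ite_mul, one_mul, zero_mul, Finset.sum_ite_eq, Finset.mem_univ, if_true,
          polyLaplacian_apply, map_sum]

theorem IsHomogeneous.linSubst (A : Matrix σ σ ℝ) {p : MvPolynomial σ ℂ} {l : ℕ}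
    (hp : p.IsHomogeneous l) : (linSubst A p).IsHomogeneous l := by
  have := IsHomogeneous.aeval hp (fun i => ∑ j, C ((A i j : ℝ) : ℂ) * X j) (n := 1)
    (fun i => IsHomogeneous.sum _ _ _ fun j _ => by
      simpa using (isHomogeneous_C σ ((A i j : ℝ) : ℂ)).mul (isHomogeneous_X ℂ j))
  simpa using! this

theorem eval_linSubst (A : Matrix σ σ ℝ) (p : MvPolynomial σ ℂ) (y : σ → ℝ) :
    eval (fun i => ((y i : ℝ) : ℂ)) (linSubst A p) =
      eval (fun i => ((A.mulVec y i : ℝ) : ℂ)) p := by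
  induction p using MvPolynomial.induction_on with
  | C a => simp [linSubst, MvPolynomial.algebraMap_eq]
  | add p q hp hq => simp only [map_add, hp, hq]
  | mul_X p k hp =>
    rw [map_mul, map_mul, map_mul, hp]
    simp [linSubst, Matrix.mulVec, dotProduct]

theorem coeff_polyLaplacian (p : MvPolynomial σ ℂ) (a : σ →₀ ℕ) :
    coeff a (polyLaplacian p) =
      ∑ i, coeff (a + Finsupp.single i 2) p * ((a i + 2) * (a i + 1) : ℕ) := by
  rw [polyLaplacian_apply, coeff_sum]
  refine Finset.sum_congr rfl fun i _ => ?_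
  rw [coeff_pderiv, coeff_pderiv, add_assoc, ← Finsupp.single_add]
  simp
  ring

/-- A harmonic polynomial is determined by its coefficients at the exponents whose `i₀`-th entry
is at most one. -/
theorem eq_zero_of_coeff_eq_zero {p : MvPolynomial σ ℂ} (h0 : polyLaplacian p = 0) (i₀ : σ)
    (h : ∀ a : σ →₀ ℕ, a i₀ < 2 → coeff a p = 0) : p = 0 := by
  classical
  have key : ∀ (k : ℕ) (a : σ →₀ ℕ), a i₀ = k → coeff a p = 0 := by
    intro k
    induction k using Nat.strong_induction_on with
    | _ k ih =>
    intro a ha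
    by_cases hk : k < 2
    · exact h a (ha ▸ hk)
    · have hle : Finsupp.single i₀ 2 ≤ a := by
        rw [Finsupp.single_le_iff]
        omega
      have hb : a - Finsupp.single i₀ 2 + Finsupp.single i₀ 2 = a := tsub_add_cancel_of_le hle
      set b := a - Finsupp.single i₀ 2 with hbdef
      have hbk : b i₀ + 2 = k := by
        rw [← ha, ← hb]
        simp
      -- The coefficient of the vanishing Laplacian at `b`: every term with `i ≠ i₀` has `i₀`-entry
      -- `k - 2` and is zero by induction, which isolates the coefficient at `a`.
      have hs := coeff_polyLaplacian p b
      rw [h0, coeff_zero, Finset.sum_eq_single i₀, hb] at hs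
      · have hne : (((b i₀ + 2) * (b i₀ + 1) : ℕ) : ℂ) ≠ 0 := Nat.cast_ne_zero.2 (by positivity)
        exact (mul_eq_zero.1 hs.symm).resolve_right hne
      · intro i _ hi
        rw [ih (b i₀) (by omega) _ (by simp [Finsupp.single_eq_of_ne hi.symm]), zero_mul]
      · simp
  ext a
  simpa using key _ a rfl

end HarmonicPolynomials

/-! ### Spherical harmonics as a space of functions -/

section SphHarm

open MvPolynomial

/-- The space of homogeneous harmonic polynomials of degree `l`. -/
noncomputable def harmPoly (d l : ℕ) : Submodule ℂ (MvPolynomial (Fin (d + 1)) ℂ) :=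
  homogeneousSubmodule (Fin (d + 1)) ℂ l ⊓ LinearMap.ker polyLaplacian

/-- Restriction of polynomials to the sphere. -/
noncomputable def polyRestrict (d : ℕ) : MvPolynomial (Fin (d + 1)) ℂ →ₗ[ℂ] (Sph d → ℂ) where
  toFun p x := eval (fun i => ((x.1 i : ℝ) : ℂ)) p
  map_add' p q := by ext; simp
  map_smul' c p := by ext; simp [smul_eval]

theorem map_polyRestrict_harmPoly (d l : ℕ) :
    (harmPoly d l).map (polyRestrict d) = sphHarm d l := by
  ext f
  constructor
  · rintro ⟨p, ⟨hp, hp'⟩, rfl⟩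
    exact ⟨p, hp, by simpa [polyLaplacian_apply] using hp', fun x => rfl⟩
  · rintro ⟨p, hp, hp', hf⟩
    exact ⟨p, ⟨hp, by simpa [polyLaplacian_apply] using hp'⟩, (funext hf).symm⟩

/-- Exponents of degree `l` in `e + 2` variables, parametrized by their first `e + 1` entries. -/
noncomputable def homExponent (e l : ℕ) (a : Fin 2 × (Fin e → Fin (l + 1))) : Fin (e + 2) →₀ ℕ :=
  Finsupp.equivFunOnFinite.symm
    (Fin.cons a.1 (Fin.snoc (α := fun _ => ℕ) (fun i => (a.2 i : ℕ)) (l - a.1 - ∑ i, (a.2 i : ℕ))))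

theorem exists_homExponent_eq {e l : ℕ} {a : Fin (e + 2) →₀ ℕ} (ha : a 0 < 2)
    (hl : a.degree = l) : ∃ b, homExponent e l b = a := by
  have hsum : a 0 + (∑ i : Fin e, a i.castSucc.succ + a (Fin.last e).succ) = l := by
    rw [← hl, Finsupp.degree_eq_sum, Fin.sum_univ_succ, Fin.sum_univ_castSucc]
  have hi : ∀ i : Fin e, a i.castSucc.succ < l + 1 := fun i => by
    have : a i.castSucc.succ ≤ ∑ i : Fin e, a i.castSucc.succ :=
      Finset.single_le_sum (f := fun i : Fin e => a i.castSucc.succ)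
        (fun _ _ => Nat.zero_le _) (Finset.mem_univ i)
    omega
  refine ⟨(⟨a 0, ha⟩, fun i => ⟨a i.castSucc.succ, hi i⟩), ?_⟩
  ext i
  refine Fin.cases ?_ (fun i => ?_) i
  · simp [homExponent]
  · refine Fin.lastCases ?_ (fun i => ?_) i
    · simp only [homExponent, Finsupp.equivFunOnFinite_symm_apply_apply, Fin.cons_succ,
        Fin.snoc_last]
      omega
    · simp [homExponent]

/-- A harmonic polynomial is determined by its coefficients at exponents with first entry `0` or
`1`. In degree `l` the last entry is forced by the others, leaving `2 (l + 1) ^ e` candidates. -/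
theorem finiteDimensional_and_finrank_harmPoly_le (e l : ℕ) :
    FiniteDimensional ℂ (harmPoly (e + 1) l) ∧
      Module.finrank ℂ (harmPoly (e + 1) l) ≤ 2 * (l + 1) ^ e := by
  let Φ : harmPoly (e + 1) l →ₗ[ℂ] (Fin 2 × (Fin e → Fin (l + 1)) → ℂ) :=
    { toFun := fun p a => coeff (homExponent e l a) p.1
      map_add' := fun p q => by ext; simp
      map_smul' := fun c p => by ext; simp }
  have hΦ : Function.Injective Φ := by
    rw [injective_iff_map_eq_zero]
    rintro ⟨p, hp, hp'⟩ h
    refine Subtype.ext (eq_zero_of_coeff_eq_zero (by simpa using hp') 0 fun a ha => ?_)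
    by_cases hl : a.degree = l
    · obtain ⟨b, rfl⟩ := exists_homExponent_eq ha hl
      exact congrFun h b
    · exact IsHomogeneous.coeff_eq_zero hp hl
  refine ⟨Module.Finite.of_injective Φ hΦ, ?_⟩
  refine (LinearMap.finrank_le_finrank_of_injective hΦ).trans (le_of_eq ?_)
  simp

theorem N_le {d : ℕ} (hd : 1 ≤ d) (l : ℕ) : N d l ≤ 2 * (l + 1) ^ (d - 1) := by
  obtain ⟨e, rfl⟩ := Nat.exists_eq_add_of_le' hd
  have := (finiteDimensional_and_finrank_harmPoly_le e l).1
  rw [N, ← map_polyRestrict_harmPoly]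
  exact (Submodule.finrank_map_le _ _).trans (finiteDimensional_and_finrank_harmPoly_le e l).2

theorem comp_mem_sphHarm {d l : ℕ} {h : Sph d → ℂ} (hh : h ∈ sphHarm d l)
    {A : Matrix (Fin (d + 1)) (Fin (d + 1)) ℝ} (hA : A * A.transpose = 1) {g : Sph d → Sph d}
    (hg : ∀ x i, (g x).1 i = A.mulVec (WithLp.ofLp x.1) i) : (fun x => h (g x)) ∈ sphHarm d l := by
  obtain ⟨p, hp, hp', hpf⟩ := hh
  refine ⟨linSubst A p, IsHomogeneous.linSubst A hp, ?_, fun x => ?_⟩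
  · rw [← polyLaplacian_apply, polyLaplacian_linSubst hA, polyLaplacian_apply, hp', map_zero]
  · change h (g x) = _
    rw [hpf, eval_linSubst]
    simp only [hg]

theorem continuous_polyRestrict {d : ℕ} (p : MvPolynomial (Fin (d + 1)) ℂ) :
    Continuous (polyRestrict d p) := by
  refine (MvPolynomial.continuous_eval p).comp ?_
  fun_prop

theorem continuous_of_mem_sphHarm {d l : ℕ} {h : Sph d → ℂ} (hh : h ∈ sphHarm d l) :
    Continuous h := by
  rw [← map_polyRestrict_harmPoly] at hh
  obtain ⟨p, -, rfl⟩ := hh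
  exact continuous_polyRestrict p

theorem star_mem_sphHarm {d l : ℕ} {h : Sph d → ℂ} (hh : h ∈ sphHarm d l) :
    (fun x => conj (h x)) ∈ sphHarm d l := by
  obtain ⟨p, hp, hp', hpf⟩ := hh
  refine ⟨MvPolynomial.map (starRingEnd ℂ) p, hp.map _, ?_, fun x => ?_⟩
  · simp only [pderiv_map, ← map_sum, hp', map_zero]
  · change conj (h x) = _
    rw [hpf, eval_map, ← eval₂_id, hom_eval₂]
    simp

end SphHarm

/-! ### Green's identity on the sphere -/

section Green

open Laplacian

/-- The Euclidean space containing the sphere. -/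
abbrev Euc (d : ℕ) : Type := EuclideanSpace ℝ (Fin (d + 1))

/-- The `i`-th standard basis vector. -/
noncomputable abbrev stdVec (d : ℕ) (i : Fin (d + 1)) : Euc d := EuclideanSpace.basisFun _ ℝ i

theorem fderiv_fderiv_apply {E F : Type*} [NormedAddCommGroup E] [NormedSpace ℝ E]
    [NormedAddCommGroup F] [NormedSpace ℝ F] {f : E → F} {x : E} (hf : ContDiffAt ℝ 2 f x)
    (v : E) : DifferentiableAt ℝ (fun y => fderiv ℝ f y v) x ∧
      fderiv ℝ (fun y => fderiv ℝ f y v) x v = iteratedFDeriv ℝ 2 f x ![v, v] := by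
  have h : DifferentiableAt ℝ (fderiv ℝ f) x :=
    (hf.fderiv_right (m := 1) (by norm_num)).differentiableAt (by simp)
  refine ⟨h.clm_apply (differentiableAt_const v), ?_⟩
  rw [iteratedFDeriv_two_apply, fderiv_clm_apply h (differentiableAt_const v)]
  simp

theorem laplacian_eq_sum_fderiv {d : ℕ} {F : Type*} [NormedAddCommGroup F] [NormedSpace ℝ F]
    {f : Euc d → F} {x : Euc d} (hf : ContDiffAt ℝ 2 f x) :
    Δ f x = ∑ i, fderiv ℝ (fun y => fderiv ℝ f y (stdVec d i)) x (stdVec d i) := by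
  rw [InnerProductSpace.laplacian_eq_iteratedFDeriv_orthonormalBasis f
    (EuclideanSpace.basisFun (Fin (d + 1)) ℝ)]
  exact Finset.sum_congr rfl fun i _ => (fderiv_fderiv_apply hf _).2.symm

theorem integrable_mul_of_tsupport_subset {d : ℕ} {f g : Euc d → ℂ} {U : Set (Euc d)}
    (hf : ContinuousOn f U) (hg : Continuous g) (hgc : HasCompactSupport g) (hU : tsupport g ⊆ U) :
    Integrable fun x => f x * g x := by
  rw [← integrableOn_iff_integrable_of_support_subset (s := tsupport g)]
  · exact ((hf.mono hU).mul hg.continuousOn).integrableOn_compact hgc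
  · exact (Function.support_mul_subset_right _ _).trans (subset_tsupport g)

/-- Two integrations by parts in each coordinate. `F` may be singular at the origin, since the
compact support of `G` avoids it. -/
theorem integral_laplacian_mul {d : ℕ} {F G : Euc d → ℂ} (hF : ContDiffOn ℝ 2 F {0}ᶜ)
    (hG : ContDiff ℝ 2 G) (hGc : HasCompactSupport G) (hG0 : tsupport G ⊆ {0}ᶜ) :
    ∫ x, Δ F x * G x = ∫ x, F x * Δ G x := by
  have hU : IsOpen ({0}ᶜ : Set (Euc d)) := isOpen_compl_singleton
  have hFx : ∀ x ∈ ({0}ᶜ : Set (Euc d)), ContDiffAt ℝ 2 F x := fun x hx =>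
    hF.contDiffAt (hU.mem_nhds hx)
  have hF1 : ∀ v, ContDiffOn ℝ 1 (fun y => fderiv ℝ F y v) {0}ᶜ := fun v =>
    (hF.fderiv_of_isOpen hU (by norm_num)).clm_apply contDiffOn_const
  have hF2 : ∀ v, ContinuousOn (fun x => fderiv ℝ (fun y => fderiv ℝ F y v) x v) {0}ᶜ := fun v =>
    ((hF1 v).continuousOn_fderiv_of_isOpen hU (by norm_num)).clm_apply continuousOn_const
  have hG1 : ∀ v, ContDiff ℝ 1 (fun y => fderiv ℝ G y v) := fun v =>
    (hG.fderiv_right (by norm_num)).clm_apply contDiff_const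
  have hG2 : ∀ v, Continuous (fun x => fderiv ℝ (fun y => fderiv ℝ G y v) x v) := fun v =>
    ((hG1 v).continuous_fderiv (by norm_num)).clm_apply continuous_const
  have hs1 : ∀ v, tsupport (fun y => fderiv ℝ G y v) ⊆ tsupport G := fun v =>
    tsupport_fderiv_apply_subset ℝ v
  have hs2 : ∀ v, tsupport (fun x => fderiv ℝ (fun y => fderiv ℝ G y v) x v) ⊆ tsupport G :=
    fun v => (tsupport_fderiv_apply_subset ℝ v).trans (hs1 v)
  have hc1 : ∀ v, HasCompactSupport (fun y => fderiv ℝ G y v) := fun v =>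
    hGc.of_isClosed_subset (isClosed_tsupport _) (hs1 v)
  have hc2 : ∀ v, HasCompactSupport (fun x => fderiv ℝ (fun y => fderiv ℝ G y v) x v) := fun v =>
    hGc.of_isClosed_subset (isClosed_tsupport _) (hs2 v)
  have hi1 : ∀ v, Integrable fun x => fderiv ℝ (fun y => fderiv ℝ F y v) x v * G x := fun v =>
    integrable_mul_of_tsupport_subset (hF2 v) hG.continuous hGc hG0
  have hi2 : ∀ v, Integrable fun x => F x * fderiv ℝ (fun y => fderiv ℝ G y v) x v := fun v =>
    integrable_mul_of_tsupport_subset hF.continuousOn (hG2 v) (hc2 v) ((hs2 v).trans hG0)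
  have hi3 : ∀ v, Integrable fun x => fderiv ℝ F x v * fderiv ℝ G x v := fun v =>
    integrable_mul_of_tsupport_subset (hF1 v).continuousOn (hG1 v).continuous (hc1 v)
      ((hs1 v).trans hG0)
  have hi4 : ∀ v, Integrable fun x => fderiv ℝ F x v * G x := fun v =>
    integrable_mul_of_tsupport_subset (hF1 v).continuousOn hG.continuous hGc hG0
  have hi5 : ∀ v, Integrable fun x => F x * fderiv ℝ G x v := fun v =>
    integrable_mul_of_tsupport_subset hF.continuousOn (hG1 v).continuous (hc1 v)
      ((hs1 v).trans hG0)
  have key : ∀ v, ∫ x, fderiv ℝ (fun y => fderiv ℝ F y v) x v * G x =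
      ∫ x, F x * fderiv ℝ (fun y => fderiv ℝ G y v) x v := fun v => by
    have e1 := integral_mul_fderiv_eq_neg_fderiv_mul_of_integrable (μ := volume)
      (f := fun y => fderiv ℝ F y v) (g := G) (v := v) (hi1 v) (hi3 v) (hi4 v)
      (fun x hx => (fderiv_fderiv_apply (hFx x (hG0 hx)) v).1)
      (fun x _ => hG.differentiable (by norm_num) x)
    have e2 := integral_mul_fderiv_eq_neg_fderiv_mul_of_integrable (μ := volume)
      (f := F) (g := fun y => fderiv ℝ G y v) (v := v) (hi3 v) (hi2 v) (hi5 v)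
      (fun x hx => (hFx x (hG0 (hs1 v hx))).differentiableAt (by norm_num))
      (fun x _ => (hG1 v).differentiable (by norm_num) x)
    rw [e2, e1, neg_neg]
  calc ∫ x, Δ F x * G x
      = ∫ x, ∑ i, fderiv ℝ (fun y => fderiv ℝ F y (stdVec d i)) x (stdVec d i) * G x := by
        refine integral_congr_ae (Eventually.of_forall fun x => ?_)
        by_cases hx : x ∈ tsupport G
        · simp only [laplacian_eq_sum_fderiv (hFx x (hG0 hx)), Finset.sum_mul]
        · simp [image_eq_zero_of_notMem_tsupport hx]
    _ = ∫ x, ∑ i, F x * fderiv ℝ (fun y => fderiv ℝ G y (stdVec d i)) x (stdVec d i) := by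
        rw [integral_finsetSum _ fun i _ => hi1 _, integral_finsetSum _ fun i _ => hi2 _]
        exact Finset.sum_congr rfl fun i _ => key _
    _ = ∫ x, F x * Δ G x := by
        refine integral_congr_ae (Eventually.of_forall fun x => ?_)
        simp only [laplacian_eq_sum_fderiv hG.contDiffAt, Finset.mul_sum]

/-- The function on Euclidean space defined by a polynomial. -/
noncomputable def polyFun {d : ℕ} (p : MvPolynomial (Fin (d + 1)) ℂ) (y : Euc d) : ℂ :=
  MvPolynomial.eval (fun i => ((y i : ℝ) : ℂ)) p

theorem polyFun_smul {d l : ℕ} {p : MvPolynomial (Fin (d + 1)) ℂ} (hp : p.IsHomogeneous l)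
    (t : ℝ) (y : Euc d) : polyFun p (t • y) = (t : ℂ) ^ l * polyFun p y := by
  simp only [polyFun, MvPolynomial.eval_eq', Finset.mul_sum]
  refine Finset.sum_congr rfl fun e he => ?_
  have hl : ∑ i, e i = l := by
    rw [← hp (MvPolynomial.mem_support_iff.1 he), Finsupp.weight_apply,
      Finsupp.sum_fintype _ _ (by simp)]
    simp
  simp only [PiLp.smul_apply, smul_eq_mul, Complex.ofReal_mul, mul_pow, Finset.prod_mul_distrib,
    Finset.prod_pow_eq_pow_sum, hl]
  ring

theorem hasFDerivAt_polyFun {d : ℕ} (p : MvPolynomial (Fin (d + 1)) ℂ) (y : Euc d) :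
    DifferentiableAt ℝ (polyFun p) y ∧
      ∀ i, fderiv ℝ (polyFun p) y (stdVec d i) = polyFun (MvPolynomial.pderiv i p) y := by
  induction p using MvPolynomial.induction_on with
  | C a =>
    have : polyFun (MvPolynomial.C a) = fun _ : Euc d => a := by ext; simp [polyFun]
    rw [this]
    exact ⟨differentiableAt_const _, fun i => by simp [polyFun]⟩
  | add p q hp hq =>
    have : polyFun (p + q) = fun y : Euc d => polyFun p y + polyFun q y := by ext; simp [polyFun]
    rw [this]
    refine ⟨hp.1.add hq.1, fun i => ?_⟩
    rw [fderiv_fun_add hp.1 hq.1, add_apply, hp.2, hq.2]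
    simp [polyFun]
  | mul_X p k hp =>
    have h1 : polyFun (p * MvPolynomial.X k) = fun y : Euc d => polyFun p y * ((y k : ℝ) : ℂ) := by
      ext; simp [polyFun]
    have h2 : HasFDerivAt (fun y : Euc d => ((y k : ℝ) : ℂ))
        (Complex.ofRealCLM ∘L (EuclideanSpace.proj k : Euc d →L[ℝ] ℝ)) y :=
      (Complex.ofRealCLM ∘L (EuclideanSpace.proj k : Euc d →L[ℝ] ℝ)).hasFDerivAt
    have h3 := hp.1.hasFDerivAt.fun_mul h2
    rw [h1]
    refine ⟨h3.differentiableAt, fun i => ?_⟩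
    rw [h3.fderiv]
    simp only [add_apply, smul_apply, hp.2]
    simp only [polyFun, MvPolynomial.pderiv_mul, map_add, map_mul, MvPolynomial.eval_X,
      MvPolynomial.pderiv_X, Pi.single_apply]
    by_cases hik : k = i
    · subst hik
      simp
      ring
    · simp [hik]
      ring

theorem contDiff_polyFun {d : ℕ} {n : WithTop ℕ∞} (p : MvPolynomial (Fin (d + 1)) ℂ) :
    ContDiff ℝ n (polyFun p) := by
  have : polyFun p = fun y : Euc d => ∑ e ∈ p.support, p.coeff e * ∏ i, ((y i : ℝ) : ℂ) ^ e i := by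
    ext y
    rw [polyFun, MvPolynomial.eval_eq']
  rw [this]
  have h (k : Fin (d + 1)) : ContDiff ℝ n fun y : Euc d => ((y k : ℝ) : ℂ) :=
    (Complex.ofRealCLM ∘L (EuclideanSpace.proj k : Euc d →L[ℝ] ℝ)).contDiff
  exact ContDiff.sum fun e _ => contDiff_const.mul (contDiff_prod fun i _ => (h i).pow _)

/-- The product of a radial function with a polynomial. -/
noncomputable def radialMul {d : ℕ} (ψ : ℝ → ℝ) (p : MvPolynomial (Fin (d + 1)) ℂ) (y : Euc d) :
    ℂ :=
  ((ψ (‖y‖ ^ 2) : ℝ) : ℂ) * polyFun p y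

theorem contDiff_radialMul {d : ℕ} {n : WithTop ℕ∞} {ψ : ℝ → ℝ} (hψ : ContDiff ℝ n ψ)
    (p : MvPolynomial (Fin (d + 1)) ℂ) : ContDiff ℝ n (radialMul ψ p) :=
  (Complex.ofRealCLM.contDiff.comp (hψ.comp (contDiff_norm_sq ℝ))).mul (contDiff_polyFun p)

theorem fderiv_radialMul {d : ℕ} {ψ : ℝ → ℝ} (hψ : Differentiable ℝ ψ)
    (p : MvPolynomial (Fin (d + 1)) ℂ) (i : Fin (d + 1)) (y : Euc d) :
    fderiv ℝ (radialMul ψ p) y (stdVec d i) =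
      radialMul (deriv ψ) (2 * MvPolynomial.X i * p) y +
        radialMul ψ (MvPolynomial.pderiv i p) y := by
  have h1 : HasFDerivAt (fun y : Euc d => ‖y‖ ^ 2) (2 • innerSL ℝ y) y :=
    (hasStrictFDerivAt_norm_sq y).hasFDerivAt
  have h2 : HasFDerivAt (fun y : Euc d => ((ψ (‖y‖ ^ 2) : ℝ) : ℂ))
      (Complex.ofRealCLM ∘L (deriv ψ (‖y‖ ^ 2) • (2 • innerSL ℝ y))) y :=
    Complex.ofRealCLM.hasFDerivAt.comp y ((hψ _).hasDerivAt.comp_hasFDerivAt y h1)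
  have h3 := h2.fun_mul (hasFDerivAt_polyFun p y).1.hasFDerivAt
  have h4 : radialMul ψ p = fun y => ((ψ (‖y‖ ^ 2) : ℝ) : ℂ) * polyFun p y := rfl
  rw [h4, h3.fderiv]
  simp only [add_apply, smul_apply,
    (hasFDerivAt_polyFun p y).2]
  have h5 : inner ℝ y (stdVec d i) = y i := by
    rw [stdVec, real_inner_comm]
    simp [EuclideanSpace.inner_single_left]
  simp only [radialMul, ContinuousLinearMap.comp_apply, smul_apply,
    innerSL_apply_apply, h5, Complex.ofRealCLM_apply]
  simp [polyFun]
  ring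

/-- The Laplacian of `ψ(‖y‖²)` contributes `4‖y‖² ψ'' + 2(d+1) ψ'`, and the cross term contributes
`4 l ψ'` by Euler's identity; the remaining term vanishes by harmonicity. -/
theorem laplacian_radialMul {d l : ℕ} {ψ : ℝ → ℝ} (hψ : ContDiff ℝ 3 ψ)
    {p : MvPolynomial (Fin (d + 1)) ℂ} (hp : p.IsHomogeneous l) (h0 : polyLaplacian p = 0)
    (y : Euc d) :
    Δ (radialMul ψ p) y = ((4 * ‖y‖ ^ 2 * deriv (deriv ψ) (‖y‖ ^ 2) +
      (2 * (d + 1) + 4 * l) * deriv ψ (‖y‖ ^ 2) : ℝ) : ℂ) * polyFun p y := by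
  have hψ1 : ContDiff ℝ 2 (deriv ψ) := hψ.deriv'
  rw [laplacian_eq_sum_fderiv ((contDiff_radialMul hψ p).of_le (by norm_num)).contDiffAt]
  have h1 : ∀ i, fderiv ℝ (fun y => fderiv ℝ (radialMul ψ p) y (stdVec d i)) y (stdVec d i) =
      4 * (y i : ℂ) ^ 2 * ((deriv (deriv ψ) (‖y‖ ^ 2) : ℝ) : ℂ) * polyFun p y +
        2 * ((deriv ψ (‖y‖ ^ 2) : ℝ) : ℂ) * polyFun p y +
        4 * ((deriv ψ (‖y‖ ^ 2) : ℝ) : ℂ) *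
          polyFun (MvPolynomial.X i * MvPolynomial.pderiv i p) y +
        ((ψ (‖y‖ ^ 2) : ℝ) : ℂ) *
          polyFun (MvPolynomial.pderiv i (MvPolynomial.pderiv i p)) y := fun i => by
    have e1 : (fun y => fderiv ℝ (radialMul ψ p) y (stdVec d i)) = fun y =>
        radialMul (deriv ψ) (2 * MvPolynomial.X i * p) y +
        radialMul ψ (MvPolynomial.pderiv i p) y :=
      funext fun y => fderiv_radialMul (hψ.differentiable (by norm_num)) p i y
    have d1 := (contDiff_radialMul hψ1 (2 * MvPolynomial.X i * p)).differentiable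
      (by norm_num) y
    have d2 := (contDiff_radialMul hψ (MvPolynomial.pderiv i p)).differentiable (by norm_num) y
    rw [e1, fderiv_fun_add d1 d2, add_apply,
      fderiv_radialMul (hψ1.differentiable (by norm_num)),
      fderiv_radialMul (hψ.differentiable (by norm_num))]
    have e2 : MvPolynomial.pderiv i (2 * MvPolynomial.X i * p) =
        2 * p + 2 * (MvPolynomial.X i * MvPolynomial.pderiv i p) := by
      have : (2 : MvPolynomial (Fin (d + 1)) ℂ) = MvPolynomial.C 2 := (map_ofNat _ 2).symm
      rw [this, mul_assoc, MvPolynomial.pderiv_C_mul, MvPolynomial.pderiv_mul,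
        MvPolynomial.pderiv_X_self]
      ring
    rw [e2]
    simp [radialMul, polyFun]
    ring
  have h2 : ∑ i, polyFun (MvPolynomial.X i * MvPolynomial.pderiv i p) y = l * polyFun p y := by
    have := congrArg (fun q => polyFun q y) hp.sum_X_mul_pderiv
    simpa [polyFun] using this
  have h3 : ∑ i, polyFun (MvPolynomial.pderiv i (MvPolynomial.pderiv i p)) y = 0 := by
    have := congrArg (fun q => polyFun q y) h0
    simpa [polyFun, polyLaplacian_apply] using this
  have h4 : ∑ i, (y i : ℂ) ^ 2 = ((‖y‖ ^ 2 : ℝ) : ℂ) := by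
    rw [EuclideanSpace.real_norm_sq_eq]
    push_cast
    rfl
  simp only [h1, Finset.sum_add_distrib, ← Finset.mul_sum, h2, h3, ← Finset.sum_mul, h4]
  simp
  ring

end Green

/-! ### Polar coordinates and Green's identity for homogeneous functions. -/

section Green

open Laplacian

instance instIsFiniteMeasureSurf (d : ℕ) : IsFiniteMeasure (surf d) :=
  inferInstanceAs (IsFiniteMeasure (Measure.toSphere volume))

instance instIsOpenPosMeasureSurf (d : ℕ) : (surf d).IsOpenPosMeasure :=
  inferInstanceAs (Measure.toSphere volume).IsOpenPosMeasure

theorem laplacian_comp_smul {d : ℕ} {F : Type*} [NormedAddCommGroup F] [NormedSpace ℝ F]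
    (f : Euc d → F) {t : ℝ} (ht : t ≠ 0) (y : Euc d) :
    Δ (fun z => f (t • z)) y = t ^ 2 • Δ f (t • y) := by
  let L : Euc d ≃L[ℝ] Euc d := ContinuousLinearEquiv.smulLeft (Units.mk0 t ht)
  have hL : (fun z => f (t • z)) = f ∘ L := rfl
  rw [hL, InnerProductSpace.laplacian_eq_iteratedFDeriv_orthonormalBasis _
    (EuclideanSpace.basisFun (Fin (d + 1)) ℝ),
    InnerProductSpace.laplacian_eq_iteratedFDeriv_orthonormalBasis _
    (EuclideanSpace.basisFun (Fin (d + 1)) ℝ)]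
  simp only [Finset.smul_sum]
  refine Finset.sum_congr rfl fun i _ => ?_
  have := L.iteratedFDerivWithin_comp_right f uniqueDiffOn_univ (x := y) (Set.mem_univ _) 2
  simp only [Set.preimage_univ, iteratedFDerivWithin_univ] at this
  rw [this, ContinuousMultilinearMap.compContinuousLinearMap_apply]
  have h2 : (fun j => (L : Euc d →L[ℝ] Euc d)
      ((![stdVec d i, stdVec d i] : Fin 2 → Euc d) j)) =
      fun j => (fun _ : Fin 2 => t) j • (![stdVec d i, stdVec d i] : Fin 2 → Euc d) j := by
    ext j; rfl
  erw [h2, ContinuousMultilinearMap.map_smul_univ]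
  simp
  rfl

/-- The origin is null, and Lebesgue measure off it is the product of the surface measure and `r ^ d
dr`. No integrability is required: the product formula for Bochner integrals holds unconditionally.
-/
theorem integral_polar {d : ℕ} (φ : ℝ → ℂ) (g : Sph d → ℂ) (H : Euc d → ℂ)
    (hH : ∀ r : ℝ, 0 < r → ∀ x : Sph d, H (r • x.1) = φ r * g x) :
    ∫ y, H y = (∫ r in Set.Ioi (0 : ℝ), (r : ℂ) ^ d * φ r) * ∫ x, g x ∂(surf d) := by
  have hd : Module.finrank ℝ (Euc d) - 1 = d := by simp
  calc ∫ y, H y = ∫ y : ({(0)}ᶜ : Set (Euc d)), H y.1 ∂(volume.comap Subtype.val) := by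
        rw [integral_subtype_comap (measurableSet_singleton _).compl fun x ↦ H x,
          restrict_compl_singleton]
    _ = ∫ z, g z.1 * φ z.2.1 ∂(surf d).prod (.volumeIoiPow d) := by
        have := (volume : Measure (Euc d)).measurePreserving_homeomorphUnitSphereProd.integral_comp
          (Homeomorph.measurableEmbedding _) fun z => g z.1 * φ z.2.1
        rw [hd] at this
        rw [surf, ← this]
        refine integral_congr_ae (Eventually.of_forall fun y => ?_)
        have hy : 0 < ‖y.1‖ := norm_pos_iff.2 y.2
        have h1 := hH ‖y.1‖ hy (homeomorphUnitSphereProd (Euc d) y).1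
        simp only [homeomorphUnitSphereProd_apply_snd_coe]
        rw [mul_comm, ← h1]
        congr 1
        simp [smul_smul, hy.ne']
    _ = (∫ x, g x ∂(surf d)) * ∫ r : Set.Ioi (0 : ℝ), φ r.1 ∂.volumeIoiPow d :=
        integral_prod_mul g fun r : Set.Ioi (0 : ℝ) => φ r.1
    _ = _ := by
        rw [mul_comm]
        congr 1
        simp only [Measure.volumeIoiPow, ENNReal.ofReal]
        rw [integral_withDensity_eq_integral_smul,
          integral_subtype_comap measurableSet_Ioi fun a ↦ Real.toNNReal (a ^ d) • φ a,
          setIntegral_congr_fun measurableSet_Ioi fun x hx ↦ ?_]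
        · rw [NNReal.smul_def, Real.coe_toNNReal _ (pow_nonneg hx.out.le _)]
          simp
        · exact (measurable_subtype_coe.pow_const _).real_toNNReal

/-- A smooth nonnegative bump function supported in `[1, 3]`. -/
noncomputable def bumpFun : ContDiffBump (2 : ℝ) := ⟨1 / 2, 1, by norm_num, by norm_num⟩

theorem contDiff_bumpFun {n : ℕ∞} : ContDiff ℝ n bumpFun := bumpFun.contDiff

theorem tsupport_bumpFun : tsupport bumpFun = Set.Icc 1 3 := by
  rw [bumpFun.tsupport_eq, Real.closedBall_eq_Icc]
  norm_num [bumpFun]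

theorem tsupport_deriv_bumpFun : tsupport (deriv bumpFun) ⊆ Set.Icc 1 3 :=
  tsupport_deriv_subset.trans tsupport_bumpFun.le

theorem tsupport_deriv_deriv_bumpFun : tsupport (deriv (deriv bumpFun)) ⊆ Set.Icc 1 3 :=
  tsupport_deriv_subset.trans tsupport_deriv_bumpFun

/-- For `r > 0`, `r² ∈ [1, 3]` forces `1/2 < r ≤ 2`; any compact interval of positive reals with
`[1, √3]` in its interior would serve. -/
theorem setIntegral_Ioi_eq {g : ℝ → ℝ}
    (hg : ∀ r : ℝ, r ^ 2 ∉ Set.Icc (1 : ℝ) 3 → g r = 0) :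
    ∫ r in Set.Ioi (0 : ℝ), g r = ∫ r in (1 / 2 : ℝ)..2, g r := by
  rw [intervalIntegral.integral_of_le (by norm_num)]
  refine setIntegral_eq_of_subset_of_forall_sdiff_eq_zero measurableSet_Ioi
    (fun r hr => lt_trans (by norm_num) hr.1) fun r hr => hg r fun h => ?_
  have hr0 : 0 < r := hr.1
  exact hr.2 ⟨by nlinarith [h.1], by nlinarith [h.2]⟩

/-- The radial integral normalizing Green's identity. -/
noncomputable def radialConst (s : ℕ) : ℝ := ∫ r in (1 / 2 : ℝ)..2, r ^ s / r ^ 2 * bumpFun (r ^ 2)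

theorem continuousOn_radial {ψ : ℝ → ℝ} (hψ : Continuous ψ) (s : ℕ) :
    ContinuousOn (fun r : ℝ => r ^ s / r ^ 2 * ψ (r ^ 2)) (Set.uIcc (1 / 2) 2) := by
  refine ContinuousOn.mul (ContinuousOn.div (by fun_prop) (by fun_prop) fun r hr => ?_)
    (by fun_prop)
  rw [Set.uIcc_of_le (by norm_num)] at hr
  have : 0 < r := lt_of_lt_of_le (by norm_num) hr.1
  positivity

theorem radialConst_pos (s : ℕ) : 0 < radialConst s := by
  -- At `r = √2` the argument `r²` is the centre of the bump, where its value is one.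
  refine intervalIntegral.integral_pos (by norm_num) ?_ ?_ ⟨√2, ?_, ?_⟩
  · have := continuousOn_radial bumpFun.continuous s
    rwa [Set.uIcc_of_le (by norm_num)] at this
  · intro r hr
    have : 0 < r := lt_trans (by norm_num) hr.1
    have := bumpFun.nonneg (x := r ^ 2)
    positivity
  · constructor
    · exact Real.le_sqrt_of_sq_le (by norm_num)
    · exact Real.sqrt_le_iff.2 (by norm_num)
  · have h : bumpFun (√2 ^ 2) = 1 := by
      rw [Real.sq_sqrt (by norm_num)]
      exact bumpFun.one_of_mem_closedBall (by simp [bumpFun])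
    rw [h]
    positivity

/-- With `s = d + l + a`, the function `2 r^(s+1) ψ'(r²) + (l - a) r^(s-1) ψ(r²)` vanishes at both
endpoints. Its derivative is the integrand plus `(l - a)(s - 1) r^(s-2) ψ(r²)`: the choice of the
factor `l - a` gives `ψ'` the coefficient `2(s + 1) + 2(l - a) = 2(d + 1) + 4l`. -/
theorem integral_radial (d l a : ℕ) :
    ∫ r in (1 / 2 : ℝ)..2, (r : ℝ) ^ (d + l + a) * (4 * r ^ 2 * deriv (deriv bumpFun) (r ^ 2) +
      (2 * (d + 1) + 4 * l) * deriv bumpFun (r ^ 2)) =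
    ((a : ℝ) - l) * (l + a + d - 1) * radialConst (d + l + a) := by
  set s := d + l + a with hs
  have hsR : (s : ℝ) = d + l + a := by rw [hs]; push_cast; ring
  set ψ : ℝ → ℝ := ⇑bumpFun with hψ
  have c0 : ContDiff ℝ 3 ψ := contDiff_bumpFun
  have c1 : ContDiff ℝ 2 (deriv ψ) := c0.deriv'
  have c2 : ContDiff ℝ 1 (deriv (deriv ψ)) := c1.deriv'
  set I : ℝ → ℝ := fun r => r ^ s * (4 * r ^ 2 * deriv (deriv ψ) (r ^ 2) +
      (2 * (d + 1) + 4 * l) * deriv ψ (r ^ 2)) with hI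
  set J : ℝ → ℝ := fun r => r ^ s / r ^ 2 * ψ (r ^ 2) with hJ
  have hIc : Continuous I := by
    have := c1.continuous
    have := c2.continuous
    fun_prop
  have hJi : IntervalIntegrable J volume (1 / 2) 2 :=
    (continuousOn_radial c0.continuous s).intervalIntegrable
  -- Negative powers are written as quotients such as `r ^ s / r`, so that truncated exponents never
  -- appear.
  have hderiv : ∀ r ∈ Set.uIcc (1 / 2 : ℝ) 2,
      HasDerivAt (fun r => 2 * (r ^ (s + 1) * deriv ψ (r ^ 2)) +
        ((l : ℝ) - a) * (r ^ s / r * ψ (r ^ 2))) (I r + ((l : ℝ) - a) * (s - 1) * J r) r := by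
    intro r hr
    rw [Set.uIcc_of_le (by norm_num)] at hr
    have hr0 : r ≠ 0 := (lt_of_lt_of_le (by norm_num) hr.1).ne'
    have hsq : HasDerivAt (fun r : ℝ => r ^ 2) (2 * r) r := by simpa using hasDerivAt_pow 2 r
    have h0 : HasDerivAt (fun r => ψ (r ^ 2)) (deriv ψ (r ^ 2) * (2 * r)) r :=
      (c0.differentiable (by norm_num) _).hasDerivAt.comp r hsq
    have h1 : HasDerivAt (fun r => deriv ψ (r ^ 2)) (deriv (deriv ψ) (r ^ 2) * (2 * r)) r :=
      (c1.differentiable (by norm_num) _).hasDerivAt.comp r hsq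
    have h2 : HasDerivAt (fun r : ℝ => r ^ s / r) ((s - 1) * (r ^ s / r ^ 2)) r := by
      have h := (hasDerivAt_pow s r).fun_div (hasDerivAt_id r) hr0
      refine h.congr_deriv ?_
      simp only [id]
      rcases Nat.eq_zero_or_pos s with h0 | h0
      · simp [h0]
        ring
      · obtain ⟨k, hk⟩ := Nat.exists_eq_add_of_le' h0
        rw [hk]
        simp only [Nat.add_sub_cancel, pow_succ, Nat.cast_add, Nat.cast_one]
        field_simp
    have h3 := ((((hasDerivAt_pow (s + 1) r).fun_mul h1).const_mul 2).fun_add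
      ((h2.fun_mul h0).const_mul ((l : ℝ) - a)))
    refine h3.congr_deriv ?_
    simp only [hI, hJ, Nat.add_sub_cancel]
    have : r ^ s / r * (deriv ψ (r ^ 2) * (2 * r)) = 2 * r ^ s * deriv ψ (r ^ 2) := by
      field_simp
    rw [this]
    have h4 : (d : ℝ) = s - l - a := by rw [hsR]; ring
    rw [h4]
    push_cast
    ring
  have hint := intervalIntegral.integral_eq_sub_of_hasDerivAt hderiv
    ((hIc.intervalIntegrable _ _).add (hJi.const_mul _))
  rw [intervalIntegral.integral_add (hIc.intervalIntegrable _ _) (hJi.const_mul _),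
    intervalIntegral.integral_const_mul] at hint
  have z : ∀ t : ℝ, t ∉ Set.Icc (1 : ℝ) 3 → ψ t = 0 ∧ deriv ψ t = 0 := fun t ht =>
    ⟨image_eq_zero_of_notMem_tsupport fun h => ht (tsupport_bumpFun ▸ h),
      image_eq_zero_of_notMem_tsupport fun h => ht (tsupport_deriv_bumpFun h)⟩
  have z1 := z (2 ^ 2) (by norm_num)
  have z2 := z ((1 / 2) ^ 2) (by norm_num)
  rw [z1.1, z1.2, z2.1, z2.2] at hint
  have hJJ : ∫ r in (1 / 2 : ℝ)..2, J r = radialConst s := rfl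
  rw [hJJ] at hint
  have h5 : ((l : ℝ) + a + d - 1) = s - 1 := by rw [hsR]; ring
  rw [h5]
  linarith

/-- Green's identity on the sphere: the Laplacian of a positively homogeneous function is tested
against a spherical harmonic. -/
theorem integral_laplacian_mul_harm {d l a : ℕ} {F : Euc d → ℂ} (hF : ContDiffOn ℝ 2 F {0}ᶜ)
    (hFa : ∀ t : ℝ, 0 < t → ∀ y : Euc d, y ≠ 0 → F (t • y) = (t : ℂ) ^ a * F y)
    {p : MvPolynomial (Fin (d + 1)) ℂ} (hp : p.IsHomogeneous l) (h0 : polyLaplacian p = 0) :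
    ∫ x : Sph d, Δ F x.1 * polyFun p x.1 ∂(surf d) =
      (((a : ℝ) - l) * (l + a + d - 1) : ℝ) * ∫ x : Sph d, F x.1 * polyFun p x.1 ∂(surf d) := by
  have hU : IsOpen ({0}ᶜ : Set (Euc d)) := isOpen_compl_singleton
  have hx0 : ∀ x : Sph d, x.1 ≠ 0 := fun x => ne_zero_of_mem_unit_sphere x
  have hsub : tsupport (radialMul bumpFun p) ⊆ (fun y : Euc d => ‖y‖ ^ 2) ⁻¹' Set.Icc 1 3 := by
    refine closure_minimal (fun y hy => ?_) (isClosed_Icc.preimage (by fun_prop))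
    by_contra h
    refine hy ?_
    have : bumpFun (‖y‖ ^ 2) = 0 :=
      image_eq_zero_of_notMem_tsupport fun h' => h (tsupport_bumpFun ▸ h')
    rw [radialMul, this]
    simp
  have hG0 : tsupport (radialMul bumpFun p) ⊆ ({0}ᶜ : Set (Euc d)) := fun y hy h => by
    have := (hsub hy).1
    rw [Set.mem_singleton_iff.1 h] at this
    norm_num at this
  have hGc : HasCompactSupport (radialMul bumpFun p : Euc d → ℂ) := by
    refine (isCompact_closedBall (0 : Euc d) 2).of_isClosed_subset (isClosed_tsupport _)
      fun y hy => ?_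
    have := (hsub hy).2
    rw [mem_closedBall_zero_iff]
    nlinarith [norm_nonneg y]
  -- Test against the polynomial cut off to a shell. In polar coordinates each side is a radial
  -- integral times an integral over the sphere; the radial integrals are `radialConst` and `(a -
  -- l)(l + a + d - 1)` times it, so the positive constant cancels.
  have green := integral_laplacian_mul hF (contDiff_radialMul (n := 2)
    (contDiff_bumpFun) p) hGc hG0
  -- The Laplacian lowers the degree of homogeneity by two; the quotient form also covers `a < 2`.
  have hlapF : ∀ r : ℝ, 0 < r → ∀ x : Sph d, Δ F (r • x.1) = (r : ℂ) ^ a / (r : ℂ) ^ 2 * Δ F x.1 := by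
    intro r hr x
    have h1 := laplacian_comp_smul F hr.ne' x.1
    have h2 : Δ (fun z => F (r • z)) x.1 = (r : ℂ) ^ a * Δ F x.1 := by
      have h3 : (fun z => F (r • z)) =ᶠ[𝓝 x.1] ((r : ℂ) ^ a) • F := by
        filter_upwards [hU.mem_nhds (hx0 x)] with z hz
        simpa using hFa r hr z hz
      rw [InnerProductSpace.laplacian_congr_nhds h3 |>.self_of_nhds,
        InnerProductSpace.laplacian_smul _ (hF.contDiffAt (hU.mem_nhds (hx0 x)))]
      rfl
    have hr' : (r : ℂ) ≠ 0 := Complex.ofReal_ne_zero.2 hr.ne'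
    rw [h2, Complex.real_smul] at h1
    push_cast at h1
    field_simp
    linear_combination -h1
  have hnorm : ∀ r : ℝ, 0 < r → ∀ x : Sph d, ‖r • x.1‖ ^ 2 = r ^ 2 := fun r hr x => by
    rw [norm_smul, norm_eq_of_mem_sphere x, mul_one, Real.norm_eq_abs, sq_abs]
  have e1 := integral_polar
    (fun r => (r : ℂ) ^ a / (r : ℂ) ^ 2 * (((bumpFun (r ^ 2) : ℝ) : ℂ) * (r : ℂ) ^ l))
    (fun x : Sph d => Δ F x.1 * polyFun p x.1) (fun y => Δ F y * radialMul bumpFun p y)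
    (fun r hr x => by
      rw [hlapF r hr x, radialMul, hnorm r hr x, polyFun_smul hp]
      ring)
  have e2 := integral_polar
    (fun r => (r : ℂ) ^ a * (((4 * r ^ 2 * deriv (deriv bumpFun) (r ^ 2) +
      (2 * (d + 1) + 4 * l) * deriv bumpFun (r ^ 2) : ℝ) : ℂ) * (r : ℂ) ^ l))
    (fun x : Sph d => F x.1 * polyFun p x.1) (fun y => F y * Δ (radialMul bumpFun p) y)
    (fun r hr x => by
      rw [hFa r hr _ (hx0 x), laplacian_radialMul contDiff_bumpFun hp h0, hnorm r hr x,
        polyFun_smul hp]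
      ring)
  have z : ∀ t : ℝ, t ∉ Set.Icc (1 : ℝ) 3 →
      bumpFun t = 0 ∧ deriv bumpFun t = 0 ∧ deriv (deriv bumpFun) t = 0 := fun t ht =>
    ⟨image_eq_zero_of_notMem_tsupport fun h => ht (tsupport_bumpFun ▸ h),
      image_eq_zero_of_notMem_tsupport fun h => ht (tsupport_deriv_bumpFun h),
      image_eq_zero_of_notMem_tsupport fun h => ht (tsupport_deriv_deriv_bumpFun h)⟩
  have i1 : ∫ r in Set.Ioi (0 : ℝ), (r : ℂ) ^ d *
      ((r : ℂ) ^ a / (r : ℂ) ^ 2 * (((bumpFun (r ^ 2) : ℝ) : ℂ) * (r : ℂ) ^ l)) =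
      (radialConst (d + l + a) : ℝ) := by
    rw [radialConst, ← setIntegral_Ioi_eq fun r hr => by rw [(z _ hr).1, mul_zero],
      ← integral_complex_ofReal]
    refine integral_congr_ae (Eventually.of_forall fun r => ?_)
    push_cast
    ring
  have i2 : ∫ r in Set.Ioi (0 : ℝ), (r : ℂ) ^ d *
      ((r : ℂ) ^ a * (((4 * r ^ 2 * deriv (deriv bumpFun) (r ^ 2) +
      (2 * (d + 1) + 4 * l) * deriv bumpFun (r ^ 2) : ℝ) : ℂ) * (r : ℂ) ^ l)) =
      (((a : ℝ) - l) * (l + a + d - 1) * radialConst (d + l + a) : ℝ) := by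
    rw [← integral_radial]
    rw [← setIntegral_Ioi_eq fun r hr => by rw [(z _ hr).2.1, (z _ hr).2.2]; ring,
      ← integral_complex_ofReal]
    refine integral_congr_ae (Eventually.of_forall fun r => ?_)
    push_cast
    ring
  rw [e1, e2, i1, i2] at green
  have hc : ((radialConst (d + l + a) : ℝ) : ℂ) ≠ 0 :=
    Complex.ofReal_ne_zero.2 (radialConst_pos _).ne'
  refine mul_left_cancel₀ hc ?_
  rw [green]
  push_cast
  ring

end Green

/-! ### Smooth functions on the sphere and the Laplace-Beltrami operator -/

section Smooth

open Laplacian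

theorem radialExt_of_ne {d : ℕ} (f : Sph d → ℝ) {y : Euc d} (hy : y ≠ 0) :
    radialExt f y = f ⟨‖y‖⁻¹ • y, by simp [norm_smul, hy]⟩ := by
  simp [radialExt, hy]

theorem radialExt_coe {d : ℕ} (f : Sph d → ℝ) (x : Sph d) : radialExt f x.1 = f x := by
  rw [radialExt_of_ne f (ne_zero_of_mem_unit_sphere x)]
  congr 1
  ext1
  simp

theorem radialExt_smul {d : ℕ} (f : Sph d → ℝ) {t : ℝ} (ht : 0 < t) {y : Euc d} (hy : y ≠ 0) :
    radialExt f (t • y) = radialExt f y := by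
  rw [radialExt_of_ne f hy, radialExt_of_ne f (smul_ne_zero ht.ne' hy)]
  congr 1
  ext1
  simp only [norm_smul, Real.norm_eq_abs, abs_of_pos ht, smul_smul]
  congr 1
  field_simp

/-- The radial extension is `f` composed with `y ↦ y / ‖y‖`, which is smooth as a map from the
punctured space into the sphere as a manifold. This passes from manifold smoothness to Euclidean
calculus. -/
theorem IsCs.contDiffOn_radialExt {d s : ℕ} {f : Sph d → ℝ} (hf : IsCs s f) :
    ContDiffOn ℝ s (radialExt f) {0}ᶜ := by
  have : Fact (Module.finrank ℝ (EuclideanSpace ℝ (Fin (d + 1))) = d + 1) :=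
    ⟨finrank_euclideanSpace_fin⟩
  let U : TopologicalSpace.Opens (Euc d) := ⟨{0}ᶜ, isOpen_compl_singleton⟩
  have hn : ContDiffOn ℝ s (fun y : Euc d => ‖y‖⁻¹ • y) {0}ᶜ := by
    refine ContDiffOn.smul (ContDiffOn.inv ?_ fun y hy => norm_ne_zero_iff.2 hy) contDiffOn_id
    exact fun y hy => (contDiffAt_norm ℝ hy).contDiffWithinAt
  have h1 : ContMDiff 𝓘(ℝ, Euc d) 𝓘(ℝ, Euc d) s (fun y : U => ‖y.1‖⁻¹ • y.1) := fun y =>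
    ContMDiffAt.comp y (f := fun y : U => y.1) (g := fun y : Euc d => ‖y‖⁻¹ • y)
      (hn.contDiffAt (U.2.mem_nhds y.2)).contMDiffAt (contMDiff_subtype_val y)
  have h2 : ∀ y : U, ‖y.1‖⁻¹ • y.1 ∈ Metric.sphere (0 : Euc d) 1 := fun y => by
    have : y.1 ≠ 0 := y.2
    simp [norm_smul, this]
  have h3 : ContMDiff 𝓘(ℝ, Euc d) 𝓘(ℝ, ℝ) s (fun y : U => radialExt f y.1) := by
    have := hf.comp (h1.codRestrict_sphere (n := d) h2)
    refine this.congr fun y => ?_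
    rw [radialExt_of_ne f y.2]
    rfl
  intro y hy
  have h4 := (contMDiffAt_subtype_iff (U := U) (f := radialExt f) (x := ⟨y, hy⟩)).1 (h3 ⟨y, hy⟩)
  exact h4.contDiffAt.contDiffWithinAt

theorem IsCs.sphLaplacian {d s : ℕ} {f : Sph d → ℝ} (hf : IsCs (s + 2) f) :
    IsCs s (sphLaplacian f) := by
  have : Fact (Module.finrank ℝ (EuclideanSpace ℝ (Fin (d + 1))) = d + 1) :=
    ⟨finrank_euclideanSpace_fin⟩
  have hU : IsOpen ({0}ᶜ : Set (Euc d)) := isOpen_compl_singleton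
  have h0 := hf.contDiffOn_radialExt
  have h1 : ContDiffOn ℝ s (Δ (radialExt f)) {0}ᶜ := by
    have h2 : ∀ v, ContDiffOn ℝ (s + 1 : ℕ) (fun y => fderiv ℝ (radialExt f) y v) {0}ᶜ := fun v =>
      (h0.fderiv_of_isOpen hU (by norm_cast)).clm_apply contDiffOn_const
    have h3 : ∀ v, ContDiffOn ℝ s
        (fun x => fderiv ℝ (fun y => fderiv ℝ (radialExt f) y v) x v) {0}ᶜ := fun v =>
      ((h2 v).fderiv_of_isOpen hU (by norm_cast)).clm_apply contDiffOn_const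
    refine (ContDiffOn.sum (s := Finset.univ) fun i _ => h3 (stdVec d i)).congr fun y hy => ?_
    exact laplacian_eq_sum_fderiv ((h0.contDiffAt (hU.mem_nhds hy)).of_le
      (by exact_mod_cast Nat.le_add_left 2 s))
  exact h1.contMDiffOn.comp_contMDiff (contMDiff_coe_sphere (n := d))
    fun x => ne_zero_of_mem_unit_sphere x

theorem IsCs.of_le {d s t : ℕ} {f : Sph d → ℝ} (hf : IsCs s f) (h : t ≤ s) : IsCs t f :=
  ContMDiff.of_le hf (by exact_mod_cast h)

theorem IsCs.continuous {d s : ℕ} {f : Sph d → ℝ} (hf : IsCs s f) : Continuous f :=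
  ContMDiff.continuous hf

theorem IsCs.iterate_sphLaplacian {d s k : ℕ} {f : Sph d → ℝ} (hf : IsCs (s + 2 * k) f) :
    IsCs s (SphereDeconv.sphLaplacian^[k] f) := by
  induction k generalizing f with
  | zero => simpa using hf
  | succ k ih => exact ih (IsCs.sphLaplacian hf)

theorem exists_of_mem_sphHarm {d l : ℕ} {h : Sph d → ℂ} (hh : h ∈ sphHarm d l) :
    ∃ p : MvPolynomial (Fin (d + 1)) ℂ, p.IsHomogeneous l ∧ polyLaplacian p = 0 ∧
      ∀ x, h x = polyFun p x.1 := by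
  obtain ⟨p, hp, hp', hpf⟩ := hh
  exact ⟨p, hp, by rwa [polyLaplacian_apply], hpf⟩

/-- Green's identity with `a = 0`, since the radial extension is homogeneous of degree zero. -/
theorem integral_sphLaplacian_mul {d l : ℕ} {f : Sph d → ℝ} (hf : IsCs 2 f) {h : Sph d → ℂ}
    (hh : h ∈ sphHarm d l) :
    ∫ x, (sphLaplacian f x : ℂ) * h x ∂(surf d) =
      -((l : ℂ) * (l + d - 1)) * ∫ x, (f x : ℂ) * h x ∂(surf d) := by
  obtain ⟨p, hp, hp', hpf⟩ := exists_of_mem_sphHarm hh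
  have h0 := hf.contDiffOn_radialExt
  have hF : ContDiffOn ℝ 2 (Complex.ofRealCLM ∘ radialExt f) {0}ᶜ :=
    Complex.ofRealCLM.contDiff.comp_contDiffOn h0
  have := integral_laplacian_mul_harm (a := 0) hF
    (fun t ht y hy => by simp [radialExt_smul f ht hy]) hp hp'
  have hlap : ∀ x : Sph d, Δ (Complex.ofRealCLM ∘ radialExt f) x.1 = (sphLaplacian f x : ℂ) :=
    fun x => (h0.contDiffAt (isOpen_compl_singleton.mem_nhds
      (ne_zero_of_mem_unit_sphere x))).laplacian_CLM_comp_left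
  simp only [hlap, Function.comp_apply, radialExt_coe, ← hpf, Complex.ofRealCLM_apply] at this
  rw [this]
  push_cast
  ring

/-- Apply Green's identity to the harmonic polynomial of degree `l'`, whose Laplacian is zero. The
factor `(l' - l)(l + l' + d - 1)` is nonzero because `l ≠ l'` and `d ≥ 1`. -/
theorem integral_mul_eq_zero_of_ne {d l l' : ℕ} (hd : 1 ≤ d) (hl : l ≠ l') {h h' : Sph d → ℂ}
    (hh : h ∈ sphHarm d l) (hh' : h' ∈ sphHarm d l') : ∫ x, h' x * h x ∂(surf d) = 0 := by
  obtain ⟨p, hp, hp0, hpf⟩ := exists_of_mem_sphHarm hh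
  obtain ⟨q, hq, hq0, hqf⟩ := exists_of_mem_sphHarm hh'
  have key := integral_laplacian_mul_harm (a := l') (contDiff_polyFun q).contDiffOn
    (fun t _ y _ => polyFun_smul hq t y) hp hp0
  have hlap : ∀ y : Euc d, Δ (polyFun q) y = 0 := fun y => by
    have h1 : polyFun q = radialMul (d := d) (fun _ => 1) q := by ext; simp [radialMul]
    rw [h1, laplacian_radialMul contDiff_const hq hq0]
    simp
  simp only [hlap, zero_mul, integral_zero, ← hpf, ← hqf] at key
  refine (mul_eq_zero.1 key.symm).resolve_left (Complex.ofReal_ne_zero.2 (mul_ne_zero ?_ ?_))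
  · exact sub_ne_zero.2 (Nat.cast_injective.ne hl.symm)
  · have : 1 ≤ l + l' := by omega
    have h1 : (1 : ℝ) ≤ l + l' := by exact_mod_cast this
    have h2 : (1 : ℝ) ≤ d := by exact_mod_cast hd
    linarith

/-- The absolute value of the eigenvalue of the Laplace-Beltrami operator in degree `l`. -/
noncomputable def eigval (d l : ℕ) : ℝ := l * (l + d - 1)

theorem sq_le_eigval {d : ℕ} (hd : 1 ≤ d) (l : ℕ) : (l : ℝ) ^ 2 ≤ eigval d l := by
  have h2 : (1 : ℝ) ≤ d := by exact_mod_cast hd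
  have h3 : (0 : ℝ) ≤ l := Nat.cast_nonneg l
  rw [eigval]
  nlinarith

theorem integral_iterate_sphLaplacian_mul {d l k : ℕ} {f : Sph d → ℝ} (hf : IsCs (2 * k) f)
    {h : Sph d → ℂ} (hh : h ∈ sphHarm d l) :
    ∫ x, ((sphLaplacian^[k] f x : ℝ) : ℂ) * h x ∂(surf d) =
      (-eigval d l : ℂ) ^ k * ∫ x, (f x : ℂ) * h x ∂(surf d) := by
  induction k with
  | zero => simp
  | succ k ih =>
    have h1 : IsCs 2 (sphLaplacian^[k] f) := IsCs.iterate_sphLaplacian (hf.of_le (by omega))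
    rw [Function.iterate_succ_apply', integral_sphLaplacian_mul h1 hh,
      ih (hf.of_le (by omega)), eigval]
    push_cast
    ring

end Smooth

/-! ### Fourier-Laplace series -/

section FourierLaplace

variable {d : ℕ} {B : HarmFamily d}

theorem integrable_surf {E : Type*} [NormedAddCommGroup E] {g : Sph d → E} (hg : Continuous g) :
    Integrable g (surf d) := by
  rw [← integrableOn_univ]
  exact hg.continuousOn.integrableOn_compact isCompact_univ

theorem IsHarmONB.mem (hB : IsHarmONB B) (l : ℕ) (q : Fin (N d l)) : B l q ∈ sphHarm d l :=
  (hB l).2 ▸ Submodule.subset_span ⟨q, rfl⟩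

theorem IsHarmONB.continuous (hB : IsHarmONB B) (l : ℕ) (q : Fin (N d l)) : Continuous (B l q) :=
  continuous_of_mem_sphHarm (hB.mem l q)

theorem IsHarmONB.integrable_mul_conj (hB : IsHarmONB B) {g : Sph d → ℂ} (hg : Continuous g)
    (l : ℕ) (q : Fin (N d l)) : Integrable (fun x => g x * conj (B l q x)) (surf d) :=
  integrable_surf (hg.mul (Complex.continuous_conj.comp (hB.continuous l q)))

/-- The coefficients of a combination of basis functions. -/
theorem IsHarmONB.integral_sum_mul_conj (hB : IsHarmONB B) {l : ℕ} (c : Fin (N d l) → ℂ)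
    (r : Fin (N d l)) : ∫ x, (∑ q, c q * B l q x) * conj (B l r x) ∂(surf d) = c r := by
  simp only [Finset.sum_mul, mul_assoc]
  rw [integral_finsetSum _ fun q _ => (hB.integrable_mul_conj (hB.continuous l q) l r).const_mul _]
  simp only [integral_const_mul, (hB l).1]
  simp

theorem IsHarmONB.expand (hB : IsHarmONB B) {l : ℕ} {h : Sph d → ℂ} (hh : h ∈ sphHarm d l)
    (x : Sph d) : h x = ∑ q, (∫ y, h y * conj (B l q y) ∂(surf d)) * B l q x := by
  rw [← (hB l).2, Submodule.mem_span_range_iff_exists_fun] at hh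
  obtain ⟨c, rfl⟩ := hh
  have h1 : ∀ x, (∑ q, c q • B l q) x = ∑ q, c q * B l q x := fun x => by simp
  simp only [h1, hB.integral_sum_mul_conj]

theorem IsHarmONB.integral_norm_sq (hB : IsHarmONB B) {l : ℕ} (c : Fin (N d l) → ℂ) :
    ∫ x, (∑ q, c q * B l q x) * conj (∑ q, c q * B l q x) ∂(surf d) =
      ((∑ q, ‖c q‖ ^ 2 : ℝ) : ℂ) := by
  have hc : Continuous fun x => ∑ q, c q * B l q x :=
    continuous_finsetSum _ fun q _ => continuous_const.mul (hB.continuous l q)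
  have h1 : ∀ x, (∑ q, c q * B l q x) * conj (∑ q, c q * B l q x) =
      ∑ r, conj (c r) * ((∑ q, c q * B l q x) * conj (B l r x)) := fun x => by
    rw [map_sum, Finset.mul_sum]
    refine Finset.sum_congr rfl fun r _ => ?_
    rw [map_mul]
    ring
  simp only [h1]
  rw [integral_finsetSum _ fun q _ => (hB.integrable_mul_conj hc l q).const_mul _]
  simp only [integral_const_mul, hB.integral_sum_mul_conj]
  push_cast
  exact Finset.sum_congr rfl fun q _ => Complex.conj_mul' _

/-- The sum of the squared moduli of the basis functions of degree `l`. -/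
noncomputable def sqSum (B : HarmFamily d) (l : ℕ) (x : Sph d) : ℝ := ∑ q, ‖B l q x‖ ^ 2

theorem sqSum_nonneg (B : HarmFamily d) (l : ℕ) (x : Sph d) : 0 ≤ sqSum B l x :=
  Finset.sum_nonneg fun _ _ => by positivity

theorem norm_sum_mul_le {ι : Type*} (s : Finset ι) (a b : ι → ℂ) :
    ‖∑ i ∈ s, a i * b i‖ ≤ √(∑ i ∈ s, ‖a i‖ ^ 2) * √(∑ i ∈ s, ‖b i‖ ^ 2) := by
  refine (norm_sum_le _ _).trans ?_
  simp only [norm_mul]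
  exact Real.sum_mul_le_sqrt_mul_sqrt _ _ _

/-- The map of the sphere induced by a linear isometry. -/
noncomputable def isomSph (L : Euc d ≃ₗᵢ[ℝ] Euc d) (x : Sph d) : Sph d :=
  ⟨L x.1, by simp⟩

theorem comp_isomSph_mem_sphHarm (L : Euc d ≃ₗᵢ[ℝ] Euc d) {l : ℕ} {h : Sph d → ℂ}
    (hh : h ∈ sphHarm d l) : (fun x => h (isomSph L x)) ∈ sphHarm d l := by
  let A : Matrix (Fin (d + 1)) (Fin (d + 1)) ℝ := Matrix.of fun i j => L (stdVec d j) i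
  have hA : A.transpose * A = 1 := by
    ext j k
    have h1 : inner ℝ (L (stdVec d k)) (L (stdVec d j)) = inner ℝ (stdVec d k) (stdVec d j) :=
      L.inner_map_map _ _
    rw [PiLp.inner_apply] at h1
    simp only [Matrix.mul_apply, Matrix.transpose_apply, A, Matrix.of_apply]
    have h2 := (orthonormal_iff_ite.1 (EuclideanSpace.basisFun (Fin (d + 1)) ℝ).orthonormal) k j
    rw [stdVec, stdVec] at h1
    rw [h2] at h1
    rw [Matrix.one_apply]
    simp only [eq_comm (a := j)]
    rw [← h1]
    exact Finset.sum_congr rfl fun i _ => by simp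
  refine comp_mem_sphHarm hh (mul_eq_one_comm.1 hA) fun x i => ?_
  have hx : x.1 = ∑ j, x.1 j • stdVec d j := by
    conv_lhs => rw [← (EuclideanSpace.basisFun (Fin (d + 1)) ℝ).sum_repr x.1]
    rfl
  have hL : L x.1 = ∑ j, x.1 j • L (stdVec d j) := by
    conv_lhs => rw [hx, map_sum]
    simp only [map_smul]
  change (L x.1) i = _
  rw [hL]
  simp [Matrix.mulVec, dotProduct, A, mul_comm]

/-- Invariance of the surface measure is inherited from Lebesgue measure: extend `g` by a fixed
radial profile, use polar coordinates before and after `L`, and cancel the radial integral. The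
profile is chosen so that this integral is `radialConst d`. -/
theorem integral_comp_isomSph (L : Euc d ≃ₗᵢ[ℝ] Euc d) (g : Sph d → ℂ) :
    ∫ x, g (isomSph L x) ∂(surf d) = ∫ x, g x ∂(surf d) := by
  classical
  let H : Euc d → ℂ := fun y => if hy : y = 0 then 0 else
    ((‖y‖ : ℂ) ^ 2)⁻¹ * (bumpFun (‖y‖ ^ 2) : ℝ) * g ⟨‖y‖⁻¹ • y, by simp [norm_smul, hy]⟩
  have hH : ∀ r : ℝ, 0 < r → ∀ x : Sph d, H (r • x.1) =
      ((r : ℂ) ^ 2)⁻¹ * (bumpFun (r ^ 2) : ℝ) * g x := fun r hr x => by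
    have hx0 : x.1 ≠ 0 := ne_zero_of_mem_unit_sphere x
    have hn : ‖r • x.1‖ = r := by
      rw [norm_smul, norm_eq_of_mem_sphere x, mul_one, Real.norm_of_nonneg hr.le]
    simp only [H, dif_neg (smul_ne_zero hr.ne' hx0), hn]
    congr 2
    ext1
    simp [smul_smul, hr.ne']
  have e1 := integral_polar (fun r => ((r : ℂ) ^ 2)⁻¹ * (bumpFun (r ^ 2) : ℝ)) g H hH
  have e2 := integral_polar (fun r => ((r : ℂ) ^ 2)⁻¹ * (bumpFun (r ^ 2) : ℝ))
    (fun x => g (isomSph L x)) (fun y => H (L y)) fun r hr x => by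
      rw [map_smul]
      exact hH r hr (isomSph L x)
  have e3 : ∫ y, H (L y) = ∫ y, H y :=
    L.measurePreserving.integral_comp L.toHomeomorph.measurableEmbedding H
  have hc : ∫ r in Set.Ioi (0 : ℝ), (r : ℂ) ^ d * (((r : ℂ) ^ 2)⁻¹ * (bumpFun (r ^ 2) : ℝ)) =
      (radialConst d : ℝ) := by
    rw [radialConst, ← setIntegral_Ioi_eq fun r hr => by
      rw [image_eq_zero_of_notMem_tsupport fun h => hr (tsupport_bumpFun ▸ h), mul_zero],
      ← integral_complex_ofReal]
    refine integral_congr_ae (Eventually.of_forall fun r => ?_)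
    push_cast
    ring
  rw [e1, e2] at e3
  refine mul_left_cancel₀ ?_ e3
  rw [hc]
  exact Complex.ofReal_ne_zero.2 (radialConst_pos _).ne'

/-- Let `h` be the reproducing kernel at `L x`, so that `h(L x)` and `‖h‖²` both equal `sqSum B l (L
x)`. Then `h ∘ L` is a spherical harmonic of the same norm, and Cauchy-Schwarz for its expansion at
`x` gives `S ≤ √S · √(sqSum B l x)` with `S = sqSum B l (L x)`. -/
theorem IsHarmONB.sqSum_isomSph_le (hB : IsHarmONB B) (L : Euc d ≃ₗᵢ[ℝ] Euc d) (l : ℕ)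
    (x : Sph d) : sqSum B l (isomSph L x) ≤ sqSum B l x := by
  set c : Fin (N d l) → ℂ := fun q => conj (B l q (isomSph L x)) with hc
  set h : Sph d → ℂ := fun y => ∑ q, c q * B l q y with hh
  have hcs : ∑ q, ‖c q‖ ^ 2 = sqSum B l (isomSph L x) := by simp [hc, sqSum]
  have hmem : h ∈ sphHarm d l := by
    have : h = ∑ q, c q • B l q := by ext; simp [hh]
    rw [this]
    exact Submodule.sum_mem _ fun q _ => Submodule.smul_mem _ _ (hB.mem l q)
  have hval : h (isomSph L x) = (sqSum B l (isomSph L x) : ℝ) := by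
    simp only [hh, hc, sqSum]
    push_cast
    exact Finset.sum_congr rfl fun q _ => Complex.conj_mul' _
  have hexp := hB.expand (comp_isomSph_mem_sphHarm L hmem)
  set e : Fin (N d l) → ℂ := fun q => ∫ y, h (isomSph L y) * conj (B l q y) ∂(surf d) with he
  have hes : ∑ q, ‖e q‖ ^ 2 = sqSum B l (isomSph L x) := by
    rw [← hcs]
    have h1 := hB.integral_norm_sq e
    have h2 := hB.integral_norm_sq c
    have h3 := integral_comp_isomSph L fun y => h y * conj (h y)
    have h4 : ∫ x, (∑ q, e q * B l q x) * conj (∑ q, e q * B l q x) ∂(surf d) =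
        ∫ x, h (isomSph L x) * conj (h (isomSph L x)) ∂(surf d) :=
      integral_congr_ae (Eventually.of_forall fun x =>
        (congrArg (fun z => z * conj z) (hexp x)).symm)
    exact Complex.ofReal_injective (h1.symm.trans (h4.trans (h3.trans h2)))
  have hle := norm_sum_mul_le Finset.univ e fun q => B l q x
  rw [← hexp x, hval, hes, Complex.norm_real, Real.norm_of_nonneg (sqSum_nonneg _ _ _)] at hle
  change _ ≤ √_ * √(sqSum B l x) at hle
  set a := sqSum B l (isomSph L x)
  rcases (sqSum_nonneg B l (isomSph L x)).eq_or_lt with h0 | h0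
  · exact h0.symm.le.trans (sqSum_nonneg _ _ _)
  · have h1 : √a * √a ≤ √a * √(sqSum B l x) := by rwa [Real.mul_self_sqrt h0.le]
    exact (Real.sqrt_le_sqrt_iff (sqSum_nonneg _ _ _)).1
      (le_of_mul_le_mul_left h1 (Real.sqrt_pos.2 h0))

/-- The surface area of the sphere. -/
noncomputable def area (d : ℕ) : ℝ := (surf d).real Set.univ

theorem area_pos (d : ℕ) : 0 < area d := by
  have : surf d ≠ 0 := Measure.toSphere_ne_zero _
  exact ENNReal.toReal_pos (by simpa using this) (measure_ne_top _ _)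

/-- The reflection exchanging two unit vectors shows that the sum of squares is constant, and its
integral is the number of basis functions. -/
theorem IsHarmONB.sqSum_eq (hB : IsHarmONB B) (l : ℕ) (x : Sph d) :
    sqSum B l x = N d l / area d := by
  have hle : ∀ x y, sqSum B l y ≤ sqSum B l x := fun x y => by
    have h := Submodule.reflection_sub (F := Euc d) (v := x.1) (w := y.1) (by simp)
    have := hB.sqSum_isomSph_le (Submodule.reflection (ℝ ∙ (x.1 - y.1))ᗮ) l x
    rwa [show isomSph (Submodule.reflection (ℝ ∙ (x.1 - y.1))ᗮ) x = y from Subtype.ext h] at this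
  have hconst : ∀ y, sqSum B l y = sqSum B l x := fun y => le_antisymm (hle _ _) (hle _ _)
  have h1 : ∫ y, sqSum B l y ∂(surf d) = N d l := by
    simp only [sqSum]
    rw [integral_finsetSum _ fun q _ => integrable_surf (g := fun y => ‖B l q y‖ ^ 2)
      ((hB.continuous l q).norm.pow 2)]
    have h2 : ∀ q, ∫ y, ‖B l q y‖ ^ 2 ∂(surf d) = 1 := fun q => by
      have h3 := (hB l).1 q q
      simp only [Complex.mul_conj', if_true] at h3
      exact_mod_cast h3
    simp [h2]
  simp only [hconst, integral_const, smul_eq_mul] at h1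
  rw [eq_div_iff (area_pos d).ne', ← h1, area]
  ring

theorem IsHarmONB.integral_mul_conj_of_ne (hB : IsHarmONB B) (hd : 1 ≤ d) {l l' : ℕ} (h : l ≠ l')
    (q : Fin (N d l)) (r : Fin (N d l')) : ∫ x, B l q x * conj (B l' r x) ∂(surf d) = 0 :=
  integral_mul_eq_zero_of_ne hd h.symm (star_mem_sphHarm (hB.mem l' r)) (hB.mem l q)

/-- Bessel's inequality for spherical harmonics. -/
theorem IsHarmONB.summable_sq_fourierCoeff (hB : IsHarmONB B) (hd : 1 ≤ d) {g : Sph d → ℝ}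
    (hg : Continuous g) : Summable fun l => ∑ q, ‖fourierCoeff B g l q‖ ^ 2 := by
  let v : (Σ l, Fin (N d l)) → Lp ℂ 2 (surf d) := fun i =>
    ContinuousMap.toLp 2 (surf d) ℂ ⟨B i.1 i.2, hB.continuous i.1 i.2⟩
  have hv : Orthonormal ℂ v := by
    rw [orthonormal_iff_ite]
    rintro ⟨l, q⟩ ⟨l', r⟩
    rw [ContinuousMap.inner_toLp]
    simp only [ContinuousMap.coe_mk]
    by_cases h : l' = l
    · subst h
      rw [(hB l').1 r q]
      simp [eq_comm]
    · rw [hB.integral_mul_conj_of_ne hd h, if_neg]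
      exact fun h' => h (congrArg Sigma.fst h').symm
  have h1 := hv.inner_products_summable
    (x := ContinuousMap.toLp 2 (surf d) ℂ ⟨fun x => (g x : ℂ), by fun_prop⟩)
  have h2 := h1.sigma
  refine h2.congr fun l => ?_
  rw [tsum_fintype]
  refine Finset.sum_congr rfl fun q _ => ?_
  rw [ContinuousMap.inner_toLp]
  rfl

theorem fourierCoeff_iterate_sphLaplacian (hB : IsHarmONB B) {f : Sph d → ℝ} {k : ℕ}
    (hf : IsCs (2 * k) f) (l : ℕ) (q : Fin (N d l)) :
    fourierCoeff B (sphLaplacian^[k] f) l q = (-eigval d l : ℂ) ^ k * fourierCoeff B f l q :=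
  integral_iterate_sphLaplacian_mul hf (star_mem_sphHarm (hB.mem l q))

theorem fourierLaplaceTerm_iterate_sphLaplacian (hB : IsHarmONB B) {f : Sph d → ℝ} {k : ℕ}
    (hf : IsCs (2 * k) f) (l : ℕ) (x : Sph d) :
    fourierLaplaceTerm B (sphLaplacian^[k] f) l x =
      (-eigval d l : ℂ) ^ k * fourierLaplaceTerm B f l x := by
  simp only [fourierLaplaceTerm, fourierCoeff_iterate_sphLaplacian hB hf, Finset.mul_sum, mul_assoc]

/-- The eigenvalue `l (l + d - 1)` is at least `l²`, so `k` Laplacians gain a factor of at least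
`l^(2k)`. -/
theorem pow_mul_norm_fourierLaplaceTerm_le (hB : IsHarmONB B) (hd : 1 ≤ d) {f : Sph d → ℝ} {k : ℕ}
    (hf : IsCs (2 * k) f) (l : ℕ) (x : Sph d) :
    (l : ℝ) ^ (2 * k) * ‖fourierLaplaceTerm B f l x‖ ≤
      ‖fourierLaplaceTerm B (sphLaplacian^[k] f) l x‖ := by
  have h := sq_le_eigval hd l
  rw [fourierLaplaceTerm_iterate_sphLaplacian hB hf, norm_mul, norm_pow, norm_neg,
    Complex.norm_real, Real.norm_of_nonneg ((sq_nonneg _).trans h), pow_mul]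
  gcongr

/-- A summable majorant of the Fourier-Laplace series of a smooth function. -/
theorem exists_summable_bound (hB : IsHarmONB B) (hd : 1 ≤ d) {f : Sph d → ℝ} {k : ℕ}
    (hk : d < 4 * k) (hf : IsCs (2 * k) f) :
    ∃ u : ℕ → ℝ, Summable u ∧ ∀ l x, ‖fourierLaplaceTerm B f l x‖ ≤ u l := by
  set g := sphLaplacian^[k] f with hg
  have hgc : Continuous g :=
    IsCs.continuous (s := 0) (IsCs.iterate_sphLaplacian (hf.of_le (by omega)))
  set a : ℕ → ℝ := fun l => ∑ q, ‖fourierCoeff B g l q‖ ^ 2 with ha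
  have hasum : Summable a := hB.summable_sq_fourierCoeff hd hgc
  -- From `N(d,l) ≤ 2 (l+1)^(d-1) ≤ 2 · 2^(d-1) l^(d-1)` for `l ≥ 1`.
  set C : ℝ := 2 * 2 ^ (d - 1) / area d with hC
  -- Cauchy-Schwarz bounds the term by `l^(-2k) √(a l) √(C l^(d-1)) ≤ √(a l) √(C / l²)`, and the
  -- product of the roots is at most the sum `a l + C / l²`; the first sequence is summable by
  -- Bessel's inequality for `Δ^k f`.
  have hbound : ∀ l, 1 ≤ l → ∀ x, ‖fourierLaplaceTerm B f l x‖ ≤ a l + C * (1 / (l : ℝ) ^ 2) := by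
    intro l hl x
    have hlR : (1 : ℝ) ≤ l := by exact_mod_cast hl
    have hl0 : (0 : ℝ) < l := by linarith
    have h1 := pow_mul_norm_fourierLaplaceTerm_le hB hd hf l x
    have h2 : ‖fourierLaplaceTerm B g l x‖ ≤ √(a l) * √(sqSum B l x) := norm_sum_mul_le _ _ _
    set t := ‖fourierLaplaceTerm B f l x‖
    have h3 : sqSum B l x ≤ C * (l : ℝ) ^ (d - 1) := by
      rw [hB.sqSum_eq, hC, div_mul_eq_mul_div]
      have := (area_pos d).le
      gcongr
      have h4 : (N d l : ℝ) ≤ 2 * ((l : ℝ) + 1) ^ (d - 1) := by exact_mod_cast N_le hd l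
      refine h4.trans ?_
      rw [mul_assoc, ← mul_pow]
      gcongr
      linarith
    have h5 : (l : ℝ) ^ (2 * k) * t ≤ √(a l) * √(C * (l : ℝ) ^ (d - 1)) :=
      (h1.trans h2).trans (by gcongr)
    have hC0 : 0 ≤ C := by
      have := (area_pos d).le
      positivity
    have ha0 : 0 ≤ a l := Finset.sum_nonneg fun _ _ => by positivity
    have h6 : t ≤ √(a l) * √(C * (1 / (l : ℝ) ^ 2)) := by
      have e : √(C * (l : ℝ) ^ (d - 1)) ≤ (l : ℝ) ^ (2 * k) * √(C * (1 / (l : ℝ) ^ 2)) := by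
        rw [Real.sqrt_le_left (by positivity), mul_pow, Real.sq_sqrt (by positivity), ← pow_mul]
        -- This is where `d < 4k` enters, as `d + 1 ≤ 4k`.
        have h8 : (l : ℝ) ^ (d - 1) * (l : ℝ) ^ 2 ≤ (l : ℝ) ^ (2 * k * 2) := by
          rw [← pow_add]
          exact pow_le_pow_right₀ hlR (by omega)
        calc C * (l : ℝ) ^ (d - 1)
            = C * ((l : ℝ) ^ (d - 1) * (l : ℝ) ^ 2) * (1 / (l : ℝ) ^ 2) := by field_simp
          _ ≤ C * (l : ℝ) ^ (2 * k * 2) * (1 / (l : ℝ) ^ 2) := by gcongr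
          _ = _ := by ring
      have h9 : (l : ℝ) ^ (2 * k) * t ≤ (l : ℝ) ^ (2 * k) * (√(a l) * √(C * (1 / (l : ℝ) ^ 2))) := by
        refine h5.trans ?_
        calc √(a l) * √(C * (l : ℝ) ^ (d - 1))
            ≤ √(a l) * ((l : ℝ) ^ (2 * k) * √(C * (1 / (l : ℝ) ^ 2))) := by gcongr
          _ = _ := by ring
      exact le_of_mul_le_mul_left h9 (by positivity)
    have hb0 : 0 ≤ C * (1 / (l : ℝ) ^ 2) := by positivity
    nlinarith [Real.sq_sqrt ha0, Real.sq_sqrt hb0,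
      sq_nonneg (√(a l) - √(C * (1 / (l : ℝ) ^ 2))), sq_nonneg (√(a l)),
      sq_nonneg (√(C * (1 / (l : ℝ) ^ 2)))]
  -- Degree zero gains nothing from the Laplacian; its term is bounded by compactness instead.
  have hcont : Continuous fun x => fourierLaplaceTerm B f 0 x :=
    continuous_finsetSum _ fun q _ => continuous_const.mul (hB.continuous 0 q)
  obtain ⟨M, hM⟩ := (isCompact_range hcont).isBounded.exists_norm_le
  refine ⟨fun l => if l = 0 then M else a l + C * (1 / (l : ℝ) ^ 2), ?_, fun l x => ?_⟩
  · rw [← summable_nat_add_iff 1]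
    simp only [Nat.add_eq_zero_iff, one_ne_zero, and_false, if_false]
    exact (summable_nat_add_iff 1).2
      (hasum.add ((Real.summable_one_div_nat_pow.2 one_lt_two).mul_left C))
  · by_cases h : l = 0
    · subst h
      simpa using hM _ ⟨x, rfl⟩
    · simpa [h] using hbound l (Nat.one_le_iff_ne_zero.2 h) x

end FourierLaplace

/-! ### Completeness of the spherical harmonics -/

section Completeness

variable {d : ℕ} {B : HarmFamily d}

theorem continuous_fourierLaplaceTerm (hB : IsHarmONB B) (f : Sph d → ℝ) (l : ℕ) :
    Continuous (fourierLaplaceTerm B f l) :=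
  continuous_finsetSum _ fun q _ => continuous_const.mul (hB.continuous l q)

theorem polyRestrict_sumSq (x : Sph d) : polyRestrict d (sumSq (Fin (d + 1))) x = 1 := by
  have h : ∑ i, x.1 i ^ 2 = 1 := by
    rw [← EuclideanSpace.real_norm_sq_eq, norm_eq_of_mem_sphere x, one_pow]
  change MvPolynomial.eval (fun i => ((x.1 i : ℝ) : ℂ)) (∑ i, MvPolynomial.X i ^ 2) = 1
  simp only [map_sum, map_pow, MvPolynomial.eval_X]
  exact_mod_cast h

/-- A continuous function orthogonal to all spherical harmonics is orthogonal to all polynomials. -/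
theorem integral_mul_polyRestrict_eq_zero {D : Sph d → ℂ} (hD : Continuous D)
    (h : ∀ l, ∀ g ∈ sphHarm d l, ∫ x, D x * g x ∂(surf d) = 0)
    (p : MvPolynomial (Fin (d + 1)) ℂ) : ∫ x, D x * polyRestrict d p x ∂(surf d) = 0 := by
  have hint : ∀ p, Integrable (fun x => D x * polyRestrict d p x) (surf d) := fun p =>
    integrable_surf (hD.mul (continuous_polyRestrict p))
  let Λ : MvPolynomial (Fin (d + 1)) ℂ →ₗ[ℂ] ℂ :=
    { toFun := fun p => ∫ x, D x * polyRestrict d p x ∂(surf d)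
      map_add' := fun p q => by
        rw [← integral_add (hint p) (hint q)]
        simp [mul_add]
      map_smul' := fun c p => by
        rw [RingHom.id_apply, smul_eq_mul, ← integral_const_mul]
        congr 1
        ext x
        rw [map_smul, Pi.smul_apply, smul_eq_mul]
        ring }
  -- On the sphere `sumSq` equals one, so each generator restricts to a spherical harmonic.
  have hspan : ∀ l, harmonicSpan (Fin (d + 1)) l ≤ LinearMap.ker Λ := fun l => by
    refine Submodule.span_le.2 ?_
    rintro _ ⟨j, m, q, hq, hq0, -, rfl⟩
    refine (integral_congr_ae (Eventually.of_forall fun x => ?_)).trans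
      (h m (polyRestrict d q) ?_)
    · have : polyRestrict d (sumSq (Fin (d + 1)) ^ j * q) x = polyRestrict d q x := by
        have h1 := polyRestrict_sumSq x
        simp only [polyRestrict, LinearMap.coe_mk, AddHom.coe_mk] at h1 ⊢
        rw [map_mul, map_pow, h1, one_pow, one_mul]
      simp only [this]
    · rw [← map_polyRestrict_harmPoly]
      exact ⟨q, ⟨hq, hq0⟩, rfl⟩
  change Λ p = 0
  rw [← MvPolynomial.sum_homogeneousComponent p, map_sum]
  exact Finset.sum_eq_zero fun l _ => hspan l (mem_harmonicSpan l _
    (MvPolynomial.homogeneousComponent_isHomogeneous l p))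

/-- The coordinate functions, as continuous functions on the sphere. -/
noncomputable def coordMap (d : ℕ) (i : Fin (d + 1)) : C(Sph d, ℂ) :=
  ⟨fun x => ((x.1 i : ℝ) : ℂ), by fun_prop⟩

/-- The star-subalgebra of polynomial functions on the sphere. -/
noncomputable def polyAlgebra (d : ℕ) : StarSubalgebra ℂ C(Sph d, ℂ) where
  toSubalgebra := (MvPolynomial.aeval (R := ℂ) (coordMap d)).range
  star_mem' := by
    rintro _ ⟨p, rfl⟩
    refine ⟨MvPolynomial.map (starRingEnd ℂ) p, ?_⟩
    change MvPolynomial.aeval (coordMap d) _ = star (MvPolynomial.aeval (coordMap d) p)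
    induction p using MvPolynomial.induction_on with
    | C a =>
      ext x
      simp
    | add p q hp hq => simp only [map_add, hp, hq, star_add]
    | mul_X p k hp =>
      rw [map_mul, map_mul, map_mul, star_mul', hp, MvPolynomial.map_X, MvPolynomial.aeval_X]
      congr 1
      ext x
      simp [coordMap]

theorem aeval_coordMap_apply (p : MvPolynomial (Fin (d + 1)) ℂ) (x : Sph d) :
    MvPolynomial.aeval (coordMap d) p x = polyRestrict d p x := by
  induction p using MvPolynomial.induction_on with
  | C a => simp [polyRestrict]
  | add p q hp hq => simp only [map_add, ContinuousMap.add_apply, hp, hq, Pi.add_apply]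
  | mul_X p k hp =>
    rw [map_mul, ContinuousMap.mul_apply, hp, MvPolynomial.aeval_X]
    simp [polyRestrict, coordMap]

/-- Stone-Weierstrass: the coordinates already separate points. -/
theorem polyAlgebra_dense (d : ℕ) : (polyAlgebra d).topologicalClosure = ⊤ := by
  refine ContinuousMap.starSubalgebra_topologicalClosure_eq_top_of_separatesPoints _ ?_
  intro x y hxy
  have : ∃ i, x.1 i ≠ y.1 i := by
    by_contra! h
    exact hxy (Subtype.ext (PiLp.ext h))
  obtain ⟨i, hi⟩ := this
  refine ⟨coordMap d i, ⟨coordMap d i, ⟨MvPolynomial.X i, by simp⟩, rfl⟩, ?_⟩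
  simpa [coordMap] using hi

/-- The spherical harmonics are complete. -/
theorem eq_zero_of_orthogonal {D : Sph d → ℂ} (hD : Continuous D)
    (h : ∀ l, ∀ g ∈ sphHarm d l, ∫ x, D x * g x ∂(surf d) = 0) (x : Sph d) : D x = 0 := by
  have hcont : Continuous fun φ : C(Sph d, ℂ) => ∫ x, D x * φ x ∂(surf d) := by
    obtain ⟨M, hM⟩ := (isCompact_range hD).isBounded.exists_norm_le
    refine continuous_iff_continuousAt.2 fun φ₀ => ?_
    refine continuousAt_of_dominated (bound := fun _ => M * (‖φ₀‖ + 1))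
      (Eventually.of_forall fun φ => (hD.mul φ.continuous).aestronglyMeasurable) ?_
      (integrable_const _) (Eventually.of_forall fun x => ?_)
    · filter_upwards [Metric.ball_mem_nhds φ₀ one_pos] with φ hφ
      refine Eventually.of_forall fun y => ?_
      rw [norm_mul]
      refine mul_le_mul (hM _ ⟨y, rfl⟩) ((φ.norm_coe_le_norm y).trans ?_) (norm_nonneg _)
        ((norm_nonneg _).trans (hM _ ⟨y, rfl⟩))
      have := norm_le_norm_add_norm_sub' φ φ₀
      rw [← dist_eq_norm] at this
      exact this.trans (by gcongr; exact (Metric.mem_ball.1 hφ).le)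
    · exact (continuous_const.mul (ContinuousEvalConst.continuous_eval_const x)).continuousAt
  have hclosed : IsClosed {φ : C(Sph d, ℂ) | ∫ x, D x * φ x ∂(surf d) = 0} :=
    isClosed_eq hcont continuous_const
  have hsub : ((polyAlgebra d : StarSubalgebra ℂ C(Sph d, ℂ)) : Set C(Sph d, ℂ)) ⊆
      {φ : C(Sph d, ℂ) | ∫ x, D x * φ x ∂(surf d) = 0} := by
    rintro _ ⟨p, rfl⟩
    have := integral_mul_polyRestrict_eq_zero hD h p
    simp only [← aeval_coordMap_apply] at this
    exact this
  have hall : ∀ φ : C(Sph d, ℂ), ∫ x, D x * φ x ∂(surf d) = 0 := fun φ => by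
    have h1 : φ ∈ (polyAlgebra d).topologicalClosure := by
      rw [polyAlgebra_dense]
      trivial
    exact closure_minimal hsub hclosed h1
  -- Testing against the conjugate of `D` makes the integral of `‖D‖²` vanish; continuity and
  -- positivity of the surface measure on open sets then give `D = 0`.
  have h2 := hall ⟨fun x => conj (D x), Complex.continuous_conj.comp hD⟩
  simp only [ContinuousMap.coe_mk, Complex.mul_conj'] at h2
  have h2' : ∫ x, ‖D x‖ ^ 2 ∂(surf d) = 0 := by exact_mod_cast h2
  by_contra hne
  refine (Continuous.integral_pos_of_hasCompactSupport_nonneg_nonzero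
    (μ := surf d) (f := fun x => ‖D x‖ ^ 2) (by fun_prop)
    (HasCompactSupport.of_compactSpace _) (fun x => by positivity) (x := x) ?_).ne' h2'
  simpa using hne

/-- The summable majorant makes the sum continuous and allows termwise integration, so the sum has
the same Fourier coefficients as `f`; by completeness the two agree everywhere. -/
theorem hasSum_fourierLaplaceTerm (hB : IsHarmONB B) (hd : 1 ≤ d) {f : Sph d → ℝ} {k : ℕ}
    (hk : d < 4 * k) (hf : IsCs (2 * k) f) (x : Sph d) :
    HasSum (fun l => fourierLaplaceTerm B f l x) (f x : ℂ) := by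
  obtain ⟨u, hu, hfu⟩ := exists_summable_bound hB hd hk hf
  have hsum : ∀ x, Summable fun l => fourierLaplaceTerm B f l x := fun x =>
    hu.of_norm_bounded fun l => hfu l x
  have hu0 : ∀ l, 0 ≤ u l := fun l => (norm_nonneg _).trans (hfu l x)
  set S : Sph d → ℂ := fun x => ∑' l, fourierLaplaceTerm B f l x with hS
  have hSc : Continuous S := continuous_tsum (continuous_fourierLaplaceTerm hB f) hu hfu
  have hfc : Continuous fun x => (f x : ℂ) := Complex.continuous_ofReal.comp hf.continuous
  have hcoef : ∀ l r, ∫ y, S y * conj (B l r y) ∂(surf d) = fourierCoeff B f l r := by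
    intro l r
    have hcb : Continuous fun y => conj (B l r y) :=
      Complex.continuous_conj.comp (hB.continuous l r)
    obtain ⟨M, hM⟩ := (isCompact_range hcb).isBounded.exists_norm_le
    have hint : ∀ m, Integrable (fun y => fourierLaplaceTerm B f m y * conj (B l r y)) (surf d) :=
      fun m => integrable_surf ((continuous_fourierLaplaceTerm hB f m).mul hcb)
    have h1 := hasSum_integral_of_summable_integral_norm hint (by
      refine Summable.of_nonneg_of_le (fun m => integral_nonneg fun y => norm_nonneg _)
        (fun m => ?_) ((hu.mul_right M).mul_right (area d))
      refine (integral_mono (hint m).norm (integrable_const (u m * M)) fun y => ?_).trans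
        (le_of_eq ?_)
      · simp only [norm_mul]
        exact mul_le_mul (hfu m y) (hM _ ⟨y, rfl⟩) (norm_nonneg _) (hu0 m)
      · rw [integral_const, smul_eq_mul, area, mul_comm])
    have h2 : ∀ m, ∫ y, fourierLaplaceTerm B f m y * conj (B l r y) ∂(surf d) =
        if m = l then fourierCoeff B f l r else 0 := fun m => by
      split_ifs with hml
      · subst hml
        exact hB.integral_sum_mul_conj _ r
      · simp only [fourierLaplaceTerm, Finset.sum_mul, mul_assoc]
        rw [integral_finsetSum _ fun q _ =>
          (hB.integrable_mul_conj (hB.continuous m q) l r).const_mul _]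
        simp only [integral_const_mul, hB.integral_mul_conj_of_ne hd hml, mul_zero,
          Finset.sum_const_zero]
    simp only [h2, tsum_mul_right] at h1
    rw [← h1.unique (hasSum_ite_eq l _)]
  have hzero := eq_zero_of_orthogonal (D := fun y => (f y : ℂ) - S y) (hfc.sub hSc) (by
    intro l g hg
    have h3 : ∀ r, ∫ y, ((f y : ℂ) - S y) * conj (B l r y) ∂(surf d) = 0 := fun r => by
      simp only [sub_mul]
      rw [integral_sub (hB.integrable_mul_conj hfc l r) (hB.integrable_mul_conj hSc l r), hcoef]
      exact sub_self _
    have h4 : ∀ y, g y = ∑ r, conj (∫ z, conj (g z) * conj (B l r z) ∂(surf d)) *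
        conj (B l r y) := fun y => by
      have := congrArg conj (hB.expand (star_mem_sphHarm hg) y)
      simpa using this
    set c : Fin (N d l) → ℂ := fun r => conj (∫ z, conj (g z) * conj (B l r z) ∂(surf d))
    calc ∫ y, ((f y : ℂ) - S y) * g y ∂(surf d)
        = ∫ y, ∑ r, c r * (((f y : ℂ) - S y) * conj (B l r y)) ∂(surf d) := by
          refine integral_congr_ae (Eventually.of_forall fun y => ?_)
          simp only
          conv_lhs => rw [h4 y, Finset.mul_sum]
          exact Finset.sum_congr rfl fun r _ => by ring
      _ = 0 := by
          rw [integral_finsetSum _ fun r _ =>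
            (hB.integrable_mul_conj (g := fun y => (f y : ℂ) - S y) (hfc.sub hSc) l r).const_mul _]
          simp only [integral_const_mul, h3, mul_zero, Finset.sum_const_zero]) x
  rw [sub_eq_zero.1 hzero]
  exact (hsum x).hasSum

/-- The truncation error of the Fourier-Laplace series of a `C^(2k)` function `f` is negligible with
respect to `T ^ (-2k)`, if the series of the `k`-th iterate of the Laplacian converges absolutely. -/
theorem tendsto_pow_mul_truncation_error (hB : IsHarmONB B) (hd : 1 ≤ d) {f : Sph d → ℝ} {k : ℕ}
    (hk : d < 4 * k) (hf : IsCs (2 * k) f) (hF : FourierLaplaceAbsConv B (sphLaplacian^[k] f))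
    {T : ℕ → ℝ} (hT : Tendsto T atTop atTop) (x : Sph d) :
    Tendsto (fun n => T n ^ (2 * k) *
      ‖∑ l ∈ Finset.range (⌊T n⌋₊ + 1), fourierLaplaceTerm B f l x - f x‖) atTop (𝓝 0) := by
  have hs := hasSum_fourierLaplaceTerm hB hd hk hf x
  set t : ℕ → ℂ := fun l => fourierLaplaceTerm B f l x
  set v : ℕ → ℝ := fun l => ‖fourierLaplaceTerm B (sphLaplacian^[k] f) l x‖
  have hv : Summable v := hF x
  have htail : Tendsto (fun M : ℕ => ∑' l, v (l + M)) atTop (𝓝 0) :=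
    tendsto_sum_nat_add v
  have hM : Tendsto (fun n => ⌊T n⌋₊ + 1) atTop atTop :=
    (tendsto_add_atTop_nat 1).comp (tendsto_nat_floor_atTop.comp hT)
  refine squeeze_zero' ?_ ?_ (htail.comp hM)
  · filter_upwards [hT.eventually_ge_atTop 0] with n hn
    positivity
  · filter_upwards [hT.eventually_ge_atTop 0] with n hn
    set M := ⌊T n⌋₊ + 1
    have hTM : T n ≤ M := by
      have := (Nat.lt_floor_add_one (T n)).le
      simpa [M] using this
    have h1 : ∑ l ∈ Finset.range M, t l - f x = -∑' l, t (l + M) := by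
      rw [← hs.tsum_eq, ← hs.summable.sum_add_tsum_nat_add M]
      ring
    have hvM : Summable fun l => v (l + M) := (summable_nat_add_iff M).2 hv
    -- Every omitted degree is at least `M ≥ T n`, so `T n ^ (2k)` is absorbed by the eigenvalue;
    -- what is left is a tail of the convergent series `v`.
    have h2 : ∀ l, T n ^ (2 * k) * ‖t (l + M)‖ ≤ v (l + M) := fun l => by
      refine le_trans ?_ (pow_mul_norm_fourierLaplaceTerm_le hB hd hf (l + M) x)
      gcongr
      refine hTM.trans ?_
      push_cast
      linarith [(Nat.cast_nonneg l : (0 : ℝ) ≤ l)]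
    rw [h1, norm_neg]
    calc T n ^ (2 * k) * ‖∑' l, t (l + M)‖ = ‖∑' l, (T n : ℂ) ^ (2 * k) * t (l + M)‖ := by
          rw [tsum_mul_left, norm_mul, norm_pow, Complex.norm_real, Real.norm_of_nonneg hn]
      _ ≤ ∑' l, v (l + M) := by
          refine tsum_of_norm_bounded hvM.hasSum fun l => ?_
          rw [norm_mul, norm_pow, Complex.norm_real, Real.norm_of_nonneg hn]
          exact h2 l

end Completeness

/-! ### Limit theorems for triangular arrays -/

section Arrays

/-- For `|x| ≤ 1` the Taylor remainder is at most `e |x|²` and `1 + δ ≤ 2`; for `|x| > 1` the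
trivial bound `2 + |x|` suffices. The constant `4` covers both cases. -/
theorem norm_exp_I_sub_one_sub_le {δ : ℝ} (hδ0 : 0 ≤ δ) (hδ1 : δ ≤ 1) (x : ℝ) :
    ‖Complex.exp (x * Complex.I) - 1 - x * Complex.I‖ ≤ 4 * |x| ^ (1 + δ) := by
  have hn : ‖(x : ℂ) * Complex.I‖ = |x| := by simp
  rcases le_or_gt |x| 1 with h | h
  · have h1 := Complex.norm_exp_sub_sum_le_norm_mul_exp ((x : ℂ) * Complex.I) 2
    rw [hn] at h1
    have h2 : Real.exp |x| ≤ 4 :=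
      (Real.exp_le_exp.2 h).trans (Real.exp_one_lt_d9.le.trans (by norm_num))
    have h3 : |x| ^ 2 ≤ |x| ^ (1 + δ) := by
      rcases (abs_nonneg x).eq_or_lt with h0 | h0
      · rw [← h0, Real.zero_rpow (by linarith)]
        norm_num
      · rw [← Real.rpow_natCast]
        exact Real.rpow_le_rpow_of_exponent_ge h0 h (by norm_num; linarith)
    have h4 : Complex.exp (x * Complex.I) - 1 - x * Complex.I =
        Complex.exp (x * Complex.I) - ∑ m ∈ Finset.range 2,
          ((x : ℂ) * Complex.I) ^ m / (m.factorial : ℂ) := by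
      simp [Finset.sum_range_succ]
      ring
    rw [h4]
    calc _ ≤ |x| ^ 2 * Real.exp |x| := h1
      _ ≤ |x| ^ (1 + δ) * 4 := by gcongr
      _ = _ := by ring
  · have h1 : ‖Complex.exp (x * Complex.I) - 1 - x * Complex.I‖ ≤ 1 + 1 + |x| := by
      refine (norm_sub_le _ _).trans ?_
      rw [hn]
      gcongr
      refine (norm_sub_le _ _).trans ?_
      rw [Complex.norm_exp_ofReal_mul_I, norm_one]
    have h2 : |x| ^ (1 : ℝ) ≤ |x| ^ (1 + δ) :=
      Real.rpow_le_rpow_of_exponent_le h.le (by linarith)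
    rw [Real.rpow_one] at h2
    linarith

theorem norm_exp_I_sub_one_sub_add_le {δ : ℝ} (hδ0 : 0 ≤ δ) (hδ1 : δ ≤ 1) (x : ℝ) :
    ‖Complex.exp (x * Complex.I) - 1 - x * Complex.I + x ^ 2 / 2‖ ≤ 4 * |x| ^ (2 + δ) := by
  have hn : ‖(x : ℂ) * Complex.I‖ = |x| := by simp
  rcases le_or_gt |x| 1 with h | h
  · have h1 := Complex.norm_exp_sub_sum_le_norm_mul_exp ((x : ℂ) * Complex.I) 3
    rw [hn] at h1
    have h2 : Real.exp |x| ≤ 4 :=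
      (Real.exp_le_exp.2 h).trans (Real.exp_one_lt_d9.le.trans (by norm_num))
    have h3 : |x| ^ 3 ≤ |x| ^ (2 + δ) := by
      rcases (abs_nonneg x).eq_or_lt with h0 | h0
      · rw [← h0, Real.zero_rpow (by linarith)]
        norm_num
      · rw [← Real.rpow_natCast]
        exact Real.rpow_le_rpow_of_exponent_ge h0 h (by norm_num; linarith)
    have h4 : Complex.exp (x * Complex.I) - 1 - x * Complex.I + x ^ 2 / 2 =
        Complex.exp (x * Complex.I) - ∑ m ∈ Finset.range 3,
          ((x : ℂ) * Complex.I) ^ m / (m.factorial : ℂ) := by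
      simp [Finset.sum_range_succ, Nat.factorial, mul_pow]
      ring
    rw [h4]
    calc _ ≤ |x| ^ 3 * Real.exp |x| := h1
      _ ≤ |x| ^ (2 + δ) * 4 := by gcongr
      _ = _ := by ring
  · have h1 : ‖Complex.exp (x * Complex.I) - 1 - x * Complex.I + x ^ 2 / 2‖ ≤
        1 + 1 + |x| + |x| ^ 2 / 2 := by
      refine (norm_add_le _ _).trans ?_
      have : ‖(x : ℂ) ^ 2 / 2‖ = |x| ^ 2 / 2 := by simp
      rw [this]
      gcongr
      refine (norm_sub_le _ _).trans ?_
      rw [hn]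
      gcongr
      refine (norm_sub_le _ _).trans ?_
      rw [Complex.norm_exp_ofReal_mul_I, norm_one]
    have h2 : |x| ^ (2 : ℝ) ≤ |x| ^ (2 + δ) :=
      Real.rpow_le_rpow_of_exponent_le h.le (by linarith)
    rw [Real.rpow_two] at h2
    nlinarith

variable {Ω Ω' E : Type*} [MeasurableSpace Ω] [MeasurableSpace Ω'] [MeasurableSpace E]
  {P : Measure Ω} [IsProbabilityMeasure P] {P' : Measure Ω'} [IsProbabilityMeasure P']
  {V : ℕ → Ω' → E} {V₀ : Ω → E}

omit [IsProbabilityMeasure P] [IsProbabilityMeasure P'] in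
theorem charFun_map_sum (hindep : iIndepFun V P') (hident : ∀ i, IdentDistrib (V i) V₀ P' P)
    {g : E → ℝ} (hg : Measurable g) (n : ℕ) (t : ℝ) :
    charFun (P'.map fun ω => ∑ i ∈ Finset.range n, g (V i ω)) t =
      (∫ ω, Complex.exp (↑(t * g (V₀ ω)) * Complex.I) ∂P) ^ n := by
  have hV : ∀ i, AEMeasurable (fun ω => g (V i ω)) P' := fun i =>
    hg.comp_aemeasurable (hident i).aemeasurable_fst
  have hV₀ : AEMeasurable (fun ω => g (V₀ ω)) P := by
    exact hg.comp_aemeasurable (hident 0).aemeasurable_snd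
  have hi : iIndepFun (fun i ω => g (V i ω)) P' := hindep.comp (fun _ => g) fun _ => hg
  have h1 : ∀ i, charFun (P'.map fun ω => g (V i ω)) t =
      ∫ ω, Complex.exp (↑(t * g (V₀ ω)) * Complex.I) ∂P := fun i => by
    have hm : P'.map (fun ω => g (V i ω)) = P.map (fun ω => g (V₀ ω)) :=
      ((hident i).comp hg).map_eq
    rw [hm, charFun_apply_real, integral_map hV₀ (by fun_prop)]
    simp
  rw [(hi.restrict _).charFun_map_fun_finsetSum_eq_prod (fun _ _ ↦ hV _)]
  simp [h1]

omit [IsProbabilityMeasure P] in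
-- The characteristic function of the row sum is an `n`-th power of `1 + z_n` with `n z_n → ψ t`, so
-- it tends to `exp (ψ t)`; Lévy's continuity theorem concludes. The normal limit and the law of
-- large numbers for squares are both instances.
theorem tendsto_sum_of_tendsto_charFun (hindep : iIndepFun V P')
    (hident : ∀ i, IdentDistrib (V i) V₀ P' P) {g : ℕ → E → ℝ} (hg : ∀ n, Measurable (g n))
    {μ : Measure ℝ} [IsProbabilityMeasure μ] {ψ : ℝ → ℂ}
    (hψ : ∀ t, charFun μ t = Complex.exp (ψ t))
    (h : ∀ t, Tendsto (fun n : ℕ => (n : ℂ) *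
      (∫ ω, Complex.exp (↑(t * g n (V₀ ω)) * Complex.I) ∂P - 1)) atTop (𝓝 (ψ t))) :
    TendstoInDistribution (fun n ω => ∑ i ∈ Finset.range n, g n (V i ω)) atTop (id : ℝ → ℝ)
      (fun _ => P') μ where
  forall_aemeasurable n := Finset.aemeasurable_fun_sum _ fun i _ =>
    (hg n).comp_aemeasurable (hident i).aemeasurable_fst
  aemeasurable_limit := aemeasurable_id
  tendsto := by
    refine ProbabilityMeasure.tendsto_iff_tendsto_charFun.2 fun t ↦ ?_
    simp only [ProbabilityMeasure.coe_mk, Measure.map_id]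
    rw [hψ]
    have := Complex.tendsto_one_add_pow_exp_of_tendsto (h t)
    refine this.congr fun n => ?_
    rw [charFun_map_sum hindep hident (hg n)]
    ring

/-- Moment conditions on the rows of a triangular array with independent and identically
distributed entries, under which a central limit theorem holds. -/
structure LyapunovArray (P : Measure Ω) (X : ℕ → Ω → ℝ) (δ : ℝ) : Prop where
  pos : 0 < δ
  le_one : δ ≤ 1
  aemeasurable : ∀ n, AEMeasurable (X n) P
  integrable_rpow : ∀ n, Integrable (fun ω => |X n ω| ^ (2 + δ)) P
  integrable_sq : ∀ n, Integrable (fun ω => X n ω ^ 2) P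
  integrable : ∀ n, Integrable (X n) P
  mean : Tendsto (fun n : ℕ => n * ∫ ω, X n ω ∂P) atTop (𝓝 0)
  sq : Tendsto (fun n : ℕ => n * ∫ ω, X n ω ^ 2 ∂P) atTop (𝓝 1)
  rpow : Tendsto (fun n : ℕ => n * ∫ ω, |X n ω| ^ (2 + δ) ∂P) atTop (𝓝 0)

theorem integrable_exp_I {X : Ω → ℝ} (hX : AEMeasurable X P) :
    Integrable (fun ω => Complex.exp (↑(X ω) * Complex.I)) P := by
  refine Integrable.of_bound (C := 1) ?_ (Eventually.of_forall fun ω => by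
    rw [Complex.norm_exp_ofReal_mul_I])
  have : Measurable fun x : ℝ => Complex.exp (↑x * Complex.I) := by fun_prop
  exact (this.comp_aemeasurable hX).aestronglyMeasurable

/-- Second-order expansion of the exponential, with remainder dominated by `|t X|^(2+δ)`. The
entries need not be centred: the first-order term vanishes because `n E X_n → 0`. -/
theorem LyapunovArray.tendsto_charFun {X : ℕ → Ω → ℝ} {δ : ℝ} (hX : LyapunovArray P X δ) (t : ℝ) :
    Tendsto (fun n : ℕ => (n : ℂ) * (∫ ω, Complex.exp (↑(t * X n ω) * Complex.I) ∂P - 1)) atTop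
      (𝓝 (-(t : ℂ) ^ 2 / 2)) := by
  have hrem : ∀ n : ℕ, ‖(n : ℂ) * (∫ ω, Complex.exp (↑(t * X n ω) * Complex.I) ∂P - 1) -
      (((n * ∫ ω, X n ω ∂P : ℝ) : ℂ) * (t * Complex.I) -
        ((n * ∫ ω, X n ω ^ 2 ∂P : ℝ) : ℂ) * (t ^ 2 / 2))‖ ≤
      4 * |t| ^ (2 + δ) * (n * ∫ ω, |X n ω| ^ (2 + δ) ∂P) := fun n => by
    have i1 := integrable_exp_I ((hX.aemeasurable n).const_mul t)
    have i2 : Integrable (fun ω => ((t * X n ω : ℝ) : ℂ) * Complex.I) P :=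
      ((hX.integrable n).const_mul t).ofReal.mul_const _
    have i3 : Integrable (fun ω => ((t * X n ω : ℝ) : ℂ) ^ 2 / 2) P := by
      have := (((hX.integrable_sq n).const_mul (t ^ 2)).ofReal (𝕜 := ℂ)).div_const 2
      refine this.congr (Eventually.of_forall fun ω => ?_)
      simp
      ring
    have e1 : (∫ ω, Complex.exp (↑(t * X n ω) * Complex.I) ∂P - 1) -
        (((∫ ω, X n ω ∂P : ℝ) : ℂ) * (t * Complex.I) -
          ((∫ ω, X n ω ^ 2 ∂P : ℝ) : ℂ) * (t ^ 2 / 2)) =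
        ∫ ω, (Complex.exp (↑(t * X n ω) * Complex.I) - 1 - ↑(t * X n ω) * Complex.I +
          ((t * X n ω : ℝ) : ℂ) ^ 2 / 2) ∂P := by
      have j1 : Integrable (fun ω => Complex.exp (↑(t * X n ω) * Complex.I) - 1) P :=
        i1.sub (integrable_const _)
      have j2 : Integrable (fun ω => Complex.exp (↑(t * X n ω) * Complex.I) - 1 -
        ((t * X n ω : ℝ) : ℂ) * Complex.I) P := j1.sub i2
      rw [integral_add j2 i3, integral_sub j1 i2, integral_sub i1 (integrable_const _)]
      have e2 : ∫ ω, ((t * X n ω : ℝ) : ℂ) * Complex.I ∂P =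
          ((∫ ω, X n ω ∂P : ℝ) : ℂ) * (t * Complex.I) := by
        rw [integral_mul_const, integral_complex_ofReal, integral_const_mul]
        push_cast
        ring
      have e3 : ∫ ω, ((t * X n ω : ℝ) : ℂ) ^ 2 / 2 ∂P =
          ((∫ ω, X n ω ^ 2 ∂P : ℝ) : ℂ) * (t ^ 2 / 2) := by
        rw [← integral_complex_ofReal, ← integral_mul_const]
        refine integral_congr_ae (Eventually.of_forall fun ω => ?_)
        simp
        ring
      rw [e2, e3]
      simp
      ring
    have e4 : ‖∫ ω, (Complex.exp (↑(t * X n ω) * Complex.I) - 1 - ↑(t * X n ω) * Complex.I +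
          ((t * X n ω : ℝ) : ℂ) ^ 2 / 2) ∂P‖ ≤
        ∫ ω, 4 * |t| ^ (2 + δ) * |X n ω| ^ (2 + δ) ∂P := by
      refine norm_integral_le_of_norm_le ((hX.integrable_rpow n).const_mul _)
        (Eventually.of_forall fun ω => ?_)
      refine (norm_exp_I_sub_one_sub_add_le hX.pos.le hX.le_one _).trans (le_of_eq ?_)
      rw [abs_mul, Real.mul_rpow (abs_nonneg _) (abs_nonneg _)]
      ring
    rw [integral_const_mul] at e4
    have e5 : (n : ℂ) * (∫ ω, Complex.exp (↑(t * X n ω) * Complex.I) ∂P - 1) -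
      (((n * ∫ ω, X n ω ∂P : ℝ) : ℂ) * (t * Complex.I) -
        ((n * ∫ ω, X n ω ^ 2 ∂P : ℝ) : ℂ) * (t ^ 2 / 2)) =
        n * ∫ ω, (Complex.exp (↑(t * X n ω) * Complex.I) - 1 - ↑(t * X n ω) * Complex.I +
          ((t * X n ω : ℝ) : ℂ) ^ 2 / 2) ∂P := by
      rw [← e1]
      push_cast
      ring
    rw [e5, norm_mul, Complex.norm_natCast]
    calc _ ≤ (n : ℝ) * (4 * |t| ^ (2 + δ) * ∫ ω, |X n ω| ^ (2 + δ) ∂P) := by gcongr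
      _ = _ := by ring
  have hz : Tendsto (fun n : ℕ => 4 * |t| ^ (2 + δ) * (n * ∫ ω, |X n ω| ^ (2 + δ) ∂P)) atTop
      (𝓝 0) := by
    simpa using hX.rpow.const_mul (4 * |t| ^ (2 + δ))
  have hmain : Tendsto (fun n : ℕ => ((n * ∫ ω, X n ω ∂P : ℝ) : ℂ) * (t * Complex.I) -
        ((n * ∫ ω, X n ω ^ 2 ∂P : ℝ) : ℂ) * (t ^ 2 / 2)) atTop (𝓝 (-(t : ℂ) ^ 2 / 2)) := by
    have h1 := ((Complex.continuous_ofReal.tendsto 0).comp hX.mean).mul_const (t * Complex.I)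
    have h2 := ((Complex.continuous_ofReal.tendsto 1).comp hX.sq).mul_const ((t : ℂ) ^ 2 / 2)
    have h3 := h1.sub h2
    simp only [Complex.ofReal_zero, zero_mul, Complex.ofReal_one, one_mul, zero_sub] at h3
    rw [neg_div]
    exact h3
  have := hmain.add (squeeze_zero_norm hrem hz)
  simpa using this

/-- First-order expansion in `X²` with exponent `1 + δ/2`, so that the remainder again involves
`|X|^(2+δ)` and no fourth moment is needed. -/
theorem LyapunovArray.tendsto_charFun_sq {X : ℕ → Ω → ℝ} {δ : ℝ} (hX : LyapunovArray P X δ)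
    (t : ℝ) : Tendsto (fun n : ℕ => (n : ℂ) *
      (∫ ω, Complex.exp (↑(t * X n ω ^ 2) * Complex.I) ∂P - 1)) atTop (𝓝 (t * Complex.I)) := by
  have hrem : ∀ n : ℕ, ‖(n : ℂ) * (∫ ω, Complex.exp (↑(t * X n ω ^ 2) * Complex.I) ∂P - 1) -
      ((n * ∫ ω, X n ω ^ 2 ∂P : ℝ) : ℂ) * (t * Complex.I)‖ ≤
      4 * |t| ^ (1 + δ / 2) * (n * ∫ ω, |X n ω| ^ (2 + δ) ∂P) := fun n => by
    have i1 := integrable_exp_I (((hX.aemeasurable n).pow_const 2).const_mul t)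
    have i2 : Integrable (fun ω => ((t * X n ω ^ 2 : ℝ) : ℂ) * Complex.I) P :=
      ((hX.integrable_sq n).const_mul t).ofReal.mul_const _
    have e1 : (∫ ω, Complex.exp (↑(t * X n ω ^ 2) * Complex.I) ∂P - 1) -
        ((∫ ω, X n ω ^ 2 ∂P : ℝ) : ℂ) * (t * Complex.I) =
        ∫ ω, (Complex.exp (↑(t * X n ω ^ 2) * Complex.I) - 1 -
          ↑(t * X n ω ^ 2) * Complex.I) ∂P := by
      have j1 : Integrable (fun ω => Complex.exp (↑(t * X n ω ^ 2) * Complex.I) - 1) P :=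
        i1.sub (integrable_const _)
      rw [integral_sub j1 i2, integral_sub i1 (integrable_const _)]
      have e2 : ∫ ω, ((t * X n ω ^ 2 : ℝ) : ℂ) * Complex.I ∂P =
          ((∫ ω, X n ω ^ 2 ∂P : ℝ) : ℂ) * (t * Complex.I) := by
        rw [integral_mul_const, integral_complex_ofReal, integral_const_mul]
        push_cast
        ring
      rw [e2]
      simp
    have e4 : ‖∫ ω, (Complex.exp (↑(t * X n ω ^ 2) * Complex.I) - 1 -
          ↑(t * X n ω ^ 2) * Complex.I) ∂P‖ ≤
        ∫ ω, 4 * |t| ^ (1 + δ / 2) * |X n ω| ^ (2 + δ) ∂P := by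
      refine norm_integral_le_of_norm_le ((hX.integrable_rpow n).const_mul _)
        (Eventually.of_forall fun ω => ?_)
      have h1 := hX.pos
      have h2 := hX.le_one
      refine (norm_exp_I_sub_one_sub_le (δ := δ / 2) (by linarith) (by linarith) _).trans
        (le_of_eq ?_)
      rw [abs_mul, Real.mul_rpow (abs_nonneg _) (abs_nonneg _), abs_pow, ← Real.rpow_two,
        ← Real.rpow_mul (abs_nonneg _), mul_add, mul_one, mul_div_cancel₀ δ two_ne_zero]
      ring
    rw [integral_const_mul] at e4
    have e5 : (n : ℂ) * (∫ ω, Complex.exp (↑(t * X n ω ^ 2) * Complex.I) ∂P - 1) -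
      ((n * ∫ ω, X n ω ^ 2 ∂P : ℝ) : ℂ) * (t * Complex.I) =
        n * ∫ ω, (Complex.exp (↑(t * X n ω ^ 2) * Complex.I) - 1 -
          ↑(t * X n ω ^ 2) * Complex.I) ∂P := by
      rw [← e1]
      push_cast
      ring
    rw [e5, norm_mul, Complex.norm_natCast]
    calc _ ≤ (n : ℝ) * (4 * |t| ^ (1 + δ / 2) * ∫ ω, |X n ω| ^ (2 + δ) ∂P) := by gcongr
      _ = _ := by ring
  have hz : Tendsto (fun n : ℕ => 4 * |t| ^ (1 + δ / 2) * (n * ∫ ω, |X n ω| ^ (2 + δ) ∂P)) atTop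
      (𝓝 0) := by
    simpa using hX.rpow.const_mul (4 * |t| ^ (1 + δ / 2))
  have hmain := ((Complex.continuous_ofReal.tendsto 1).comp hX.sq).mul_const (t * Complex.I)
  rw [Complex.ofReal_one, one_mul] at hmain
  have := hmain.add (squeeze_zero_norm hrem hz)
  simpa using this

/-- Central limit theorem for a triangular array with i.i.d. rows. -/
theorem LyapunovArray.clt (hindep : iIndepFun V P') (hident : ∀ i, IdentDistrib (V i) V₀ P' P)
    {g : ℕ → E → ℝ} (hg : ∀ n, Measurable (g n)) {δ : ℝ}
    (h : LyapunovArray P (fun n ω => g n (V₀ ω)) δ) :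
    TendstoInDistribution (fun n ω => ∑ i ∈ Finset.range n, g n (V i ω)) atTop (id : ℝ → ℝ)
      (fun _ => P') (gaussianReal 0 1) :=
  tendsto_sum_of_tendsto_charFun hindep hident hg
    (fun t => by simp [charFun_gaussianReal, neg_div]) h.tendsto_charFun

/-- The sums of the squares of a triangular array converge in law to a constant. -/
theorem LyapunovArray.tendsto_sum_sq (hindep : iIndepFun V P')
    (hident : ∀ i, IdentDistrib (V i) V₀ P' P)
    {g : ℕ → E → ℝ} (hg : ∀ n, Measurable (g n)) {δ : ℝ}
    (h : LyapunovArray P (fun n ω => g n (V₀ ω)) δ) :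
    TendstoInDistribution (fun n ω => ∑ i ∈ Finset.range n, g n (V i ω) ^ 2) atTop (id : ℝ → ℝ)
      (fun _ => P') (Measure.dirac 1) :=
  tendsto_sum_of_tendsto_charFun hindep hident (g := fun n e => g n e ^ 2)
    (fun n => (hg n).pow_const 2) (fun t => by simp [charFun_dirac]) h.tendsto_charFun_sq

end Arrays

/-! ### Convergence in probability to a constant -/

section InMeasure

open scoped ENNReal

variable {Ω' E F : Type*} [MeasurableSpace Ω'] {μ : Measure Ω'}

theorem tendstoInMeasure_prodMk_const [PseudoEMetricSpace E] [PseudoEMetricSpace F]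
    {X : ℕ → Ω' → E} {Y : ℕ → Ω' → F} {a : E} {b : F}
    (hX : TendstoInMeasure μ X atTop fun _ => a) (hY : TendstoInMeasure μ Y atTop fun _ => b) :
    TendstoInMeasure μ (fun n ω => (X n ω, Y n ω)) atTop fun _ => (a, b) := by
  intro ε hε
  have h := (hX ε hε).add (hY ε hε)
  rw [add_zero] at h
  refine tendsto_of_tendsto_of_tendsto_of_le_of_le tendsto_const_nhds h (fun _ => zero_le)
    fun n => ?_
  refine (measure_mono ?_).trans (measure_union_le _ _)
  intro ω hω
  simpa [Prod.edist_eq] using hω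

theorem tendstoInMeasure_comp_const [PseudoEMetricSpace E] [PseudoEMetricSpace F]
    {X : ℕ → Ω' → E} {a : E} (hX : TendstoInMeasure μ X atTop fun _ => a) {g : E → F}
    (hg : ContinuousAt g a) : TendstoInMeasure μ (fun n ω => g (X n ω)) atTop fun _ => g a := by
  intro ε hε
  obtain ⟨η, hη, h⟩ := EMetric.tendsto_nhds_nhds.1 hg ε hε
  refine tendsto_of_tendsto_of_tendsto_of_le_of_le tendsto_const_nhds (hX η hη)
    (fun _ => zero_le) fun n => measure_mono fun ω hω => ?_
  by_contra hc
  exact absurd (h (not_le.1 hc)) (not_lt.2 hω)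

/-- The exceptional sets `S n` let deterministic inequalities be used that hold only when the
density estimate is not too small. -/
theorem tendstoInMeasure_of_edist_le [PseudoEMetricSpace E] [PseudoEMetricSpace F]
    {X : ℕ → Ω' → E} {Y : ℕ → Ω' → F} {a : E} {b : F}
    (hX : TendstoInMeasure μ X atTop fun _ => a) {S : ℕ → Set Ω'}
    (hS : Tendsto (fun n => μ (S n)) atTop (𝓝 0))
    (h : ∀ᶠ n in atTop, ∀ ω, ω ∉ S n → edist (Y n ω) b ≤ edist (X n ω) a) :
    TendstoInMeasure μ Y atTop fun _ => b := by
  intro ε hε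
  have h' := (hX ε hε).add hS
  rw [add_zero] at h'
  refine tendsto_of_tendsto_of_tendsto_of_le_of_le' tendsto_const_nhds h'
    (Eventually.of_forall fun _ => zero_le) ?_
  filter_upwards [h] with n hn
  refine (measure_mono ?_).trans (measure_union_le _ _)
  intro ω hω
  by_cases hs : ω ∈ S n
  · exact Or.inr hs
  · exact Or.inl (hω.trans (hn ω hs))

/-- Portmanteau for the closed set of points at distance at least `ε` from `c`, which the Dirac mass
does not charge. -/
theorem tendstoInMeasure_of_tendstoInDistribution_dirac [IsProbabilityMeasure μ]
    {X : ℕ → Ω' → ℝ} {c : ℝ}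
    (h : TendstoInDistribution X atTop (id : ℝ → ℝ) (fun _ => μ) (Measure.dirac c)) :
    TendstoInMeasure μ X atTop fun _ => c := by
  intro ε hε
  have hcl : IsClosed {x : ℝ | ε ≤ edist x c} :=
    isClosed_le continuous_const (continuous_id.edist continuous_const)
  have h1 := ProbabilityMeasure.limsup_measure_closed_le_of_tendsto h.tendsto hcl
  simp only [ProbabilityMeasure.coe_mk, Measure.map_id] at h1
  rw [Measure.dirac_apply' _ hcl.measurableSet, Set.indicator_of_notMem (by simpa using hε.ne')] at h1
  have h2 : ∀ n, (μ.map (X n)) {x : ℝ | ε ≤ edist x c} = μ {ω | ε ≤ edist (X n ω) c} := fun n =>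
    Measure.map_apply_of_aemeasurable (h.forall_aemeasurable n) hcl.measurableSet
  simp only [h2] at h1
  exact tendsto_of_le_liminf_of_limsup_le zero_le h1

/-- Boundedness in `L¹` makes `Q n` tight by Markov's inequality, and a tight sequence times one
tending to zero in probability tends to zero. -/
theorem tendstoInMeasure_mul_of_lintegral_le {X Q : ℕ → Ω' → ℝ} {C : ℝ≥0∞} (hC : C ≠ ∞)
    (hX : TendstoInMeasure μ X atTop fun _ => (0 : ℝ)) (hQm : ∀ n, AEMeasurable (Q n) μ)
    (hQ : ∀ᶠ n in atTop, ∫⁻ ω, ‖Q n ω‖ₑ ∂μ ≤ C) :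
    TendstoInMeasure μ (fun n ω => X n ω * Q n ω) atTop fun _ => (0 : ℝ) := by
  refine tendstoInMeasure_of_ne_top fun ε hε hεt => ?_
  refine ENNReal.tendsto_nhds_zero.2 fun η hη => ?_
  rcases eq_or_ne η ∞ with rfl | hηt
  · simp
  obtain ⟨K, hK0, hKt, hK⟩ : ∃ K : ℝ≥0∞, K ≠ 0 ∧ K ≠ ∞ ∧ C / K ≤ η / 2 := by
    -- `2C/η` is the level required by Markov's inequality; adding one keeps it nonzero when `C =
    -- 0`.
    refine ⟨2 * C / η + 1, by simp, ?_, ?_⟩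
    · exact ENNReal.add_ne_top.2 ⟨ENNReal.div_ne_top (ENNReal.mul_ne_top (by simp) hC) hη.ne',
        by simp⟩
    · refine ENNReal.div_le_of_le_mul ?_
      calc C = η / 2 * (2 * C / η) := by
            rw [div_eq_mul_inv, div_eq_mul_inv]
            calc C = (η * η⁻¹) * (2⁻¹ * 2) * C := by
                  rw [ENNReal.mul_inv_cancel hη.ne' hηt, ENNReal.inv_mul_cancel (by simp) (by simp)]
                  simp
              _ = _ := by ring
        _ ≤ _ := by gcongr; exact le_self_add
  have h1 := (ENNReal.tendsto_nhds_zero.1 (hX (ε / K) (ENNReal.div_pos hε.ne' hKt))) (η / 2)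
    (ENNReal.half_pos hη.ne')
  filter_upwards [h1, hQ] with n hn hQn
  have h2 : μ {ω | K ≤ ‖Q n ω‖ₑ} ≤ η / 2 :=
    (meas_ge_le_lintegral_div (hQm n).enorm hK0 hKt).trans
      ((ENNReal.div_le_div_right hQn K).trans hK)
  calc μ {ω | ε ≤ edist (X n ω * Q n ω) 0}
      ≤ μ ({ω | ε / K ≤ edist (X n ω) 0} ∪ {ω | K ≤ ‖Q n ω‖ₑ}) := by
        refine measure_mono fun ω hω => ?_
        by_contra hc
        simp only [Set.mem_union, Set.mem_ofPred_eq, not_or, not_le, edist_zero_right] at hc hω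
        rw [enorm_mul] at hω
        have : ‖X n ω‖ₑ * ‖Q n ω‖ₑ < ε / K * K := ENNReal.mul_lt_mul hc.1 hc.2
        rw [ENNReal.div_mul_cancel hK0 hKt] at this
        exact absurd hω (not_le.2 this)
    _ ≤ η / 2 + η / 2 := (measure_union_le _ _).trans (add_le_add hn h2)
    _ = η := ENNReal.add_halves η

variable {Ω S : Type*} [MeasurableSpace Ω] [MeasurableSpace S]
  {P : Measure Ω} [IsProbabilityMeasure P] [IsProbabilityMeasure μ]
  {V : ℕ → Ω' → S} {V₀ : Ω → S}

/-- Weak law of large numbers for a triangular array with i.i.d. rows. -/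
theorem tendstoInMeasure_average (hindep : iIndepFun V μ)
    (hident : ∀ i, IdentDistrib (V i) V₀ μ P) {g : ℕ → S → ℝ} (hg : ∀ n, Measurable (g n))
    (hL2 : ∀ n, MemLp (fun ω => g n (V₀ ω)) 2 P) {c : ℝ}
    (hmean : Tendsto (fun n => ∫ ω, g n (V₀ ω) ∂P) atTop (𝓝 c))
    (hsq : Tendsto (fun n : ℕ => (∫ ω, g n (V₀ ω) ^ 2 ∂P) / n) atTop (𝓝 0)) :
    TendstoInMeasure μ (fun (n : ℕ) ω => (n : ℝ)⁻¹ * ∑ i ∈ Finset.range n, g n (V i ω)) atTop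
      fun _ => c := by
  have hid : ∀ n i, IdentDistrib (fun ω => g n (V i ω)) (fun ω => g n (V₀ ω)) μ P :=
    fun n i => (hident i).comp (hg n)
  have hLi : ∀ n i, MemLp (fun ω => g n (V i ω)) 2 μ := fun n i => (hid n i).memLp_iff.2 (hL2 n)
  have hi : ∀ n, iIndepFun (fun i ω => g n (V i ω)) μ := fun n => hindep.comp (fun _ => g n)
    fun _ => hg n
  set A : ℕ → Ω' → ℝ := fun (n : ℕ) ω => (n : ℝ)⁻¹ * ∑ i ∈ Finset.range n, g n (V i ω) with hA
  have hAL : ∀ n, MemLp (A n) 2 μ := fun n =>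
    (memLp_finsetSum _ fun i _ => hLi n i).const_mul _
  have hAm : ∀ᶠ n in atTop, ∫ ω, A n ω ∂μ = ∫ ω, g n (V₀ ω) ∂P := by
    filter_upwards [eventually_ge_atTop 1] with n hn
    rw [hA, integral_const_mul, integral_finsetSum _ fun i _ => (hLi n i).integrable one_le_two]
    rw [Finset.sum_congr rfl fun i _ => (hid n i).integral_eq]
    have : (n : ℝ) ≠ 0 := by positivity
    simp [this]
  have hAv : ∀ᶠ n in atTop, variance (A n) μ ≤ (∫ ω, g n (V₀ ω) ^ 2 ∂P) / n := by
    filter_upwards [eventually_ge_atTop 1] with n hn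
    have h1 : variance (fun ω => ∑ i ∈ Finset.range n, g n (V i ω)) μ =
        ∑ i ∈ Finset.range n, variance (fun ω => g n (V i ω)) μ := by
      have := IndepFun.variance_sum (s := Finset.range n) (fun i _ => hLi n i)
        (fun i _ j _ hij => (hi n).indepFun hij)
      rw [← this]
      congr 1
      ext ω
      simp
    have h2 : ∀ i, variance (fun ω => g n (V i ω)) μ ≤ ∫ ω, g n (V₀ ω) ^ 2 ∂P := fun i => by
      rw [(hid n i).variance_eq]
      exact variance_le_expectation_sq (hL2 n).aestronglyMeasurable
    have hn' : (0 : ℝ) < n := by positivity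
    rw [hA, variance_const_mul, h1]
    calc _ ≤ ((n : ℝ)⁻¹) ^ 2 * ∑ i ∈ Finset.range n, ∫ ω, g n (V₀ ω) ^ 2 ∂P := by
          gcongr
          exact h2 _
      _ = _ := by
          simp
          field_simp
  -- Chebyshev's inequality with the variance bound `E g_n² / n`.
  have hD : TendstoInMeasure μ (fun n ω => A n ω - ∫ ω', A n ω' ∂μ) atTop fun _ => (0 : ℝ) := by
    refine tendstoInMeasure_of_ne_top fun ε hε hεt => ?_
    have hε' : 0 < ε.toReal := ENNReal.toReal_pos hε.ne' hεt
    have hz : Tendsto (fun n : ℕ => ENNReal.ofReal ((∫ ω, g n (V₀ ω) ^ 2 ∂P) / n / ε.toReal ^ 2))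
        atTop (𝓝 0) := by
      have := ENNReal.tendsto_ofReal (hsq.div_const (ε.toReal ^ 2))
      simpa using this
    refine tendsto_of_tendsto_of_tendsto_of_le_of_le' tendsto_const_nhds hz
      (Eventually.of_forall fun _ => zero_le) ?_
    filter_upwards [hAv] with n hn
    have := meas_ge_le_variance_div_sq (hAL n) hε'
    calc μ {ω | ε ≤ edist (A n ω - ∫ ω', A n ω' ∂μ) 0}
        = μ {ω | ε.toReal ≤ |A n ω - ∫ ω', A n ω' ∂μ|} := by
          congr 1
          ext ω
          simp only [Set.mem_ofPred_eq, edist_zero_right]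
          rw [← ENNReal.toReal_le_toReal hεt (by simp)]
          simp
      _ ≤ _ := this
      _ ≤ _ := by gcongr
  have hm' : TendstoInMeasure μ (fun n (_ : Ω') => ∫ ω', A n ω' ∂μ) atTop fun _ => c := by
    have h1 : Tendsto (fun n => ∫ ω', A n ω' ∂μ) atTop (𝓝 c) :=
      hmean.congr' (hAm.mono fun n hn => hn.symm)
    exact tendstoInMeasure_of_tendsto_ae (fun n => aestronglyMeasurable_const)
      (Eventually.of_forall fun _ => h1)
  have := tendstoInMeasure_comp_const (tendstoInMeasure_prodMk_const hD hm')
    (g := fun p : ℝ × ℝ => p.1 + p.2) (by fun_prop)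
  simpa using this

end InMeasure

/-! ### Ratio estimators -/

/-- The average of the first `n` terms of a sequence. -/
noncomputable def avg (n : ℕ) (g : ℕ → ℝ) : ℝ := (n : ℝ)⁻¹ * ∑ i ∈ Finset.range n, g i

/-- The average of `y` with the weights `w`. -/
noncomputable def ratioMean (n : ℕ) (w y : ℕ → ℝ) : ℝ := (avg n w)⁻¹ * avg n fun i => w i * y i

/-- The estimated asymptotic variance of `ratioMean`. -/
noncomputable def ratioVar (n : ℕ) (w y : ℕ → ℝ) : ℝ :=
  ((avg n w) ^ 2)⁻¹ * (avg n (fun i => (w i * (y i - ratioMean n w y)) ^ 2) -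
    (avg n fun i => w i * (y i - ratioMean n w y)) ^ 2)

section Ratio

variable {n : ℕ} {w y : ℕ → ℝ}

theorem avg_add (g h : ℕ → ℝ) : avg n (fun i => g i + h i) = avg n g + avg n h := by
  simp [avg, Finset.sum_add_distrib, mul_add]

theorem avg_mul (c : ℝ) (g : ℕ → ℝ) : avg n (fun i => c * g i) = c * avg n g := by
  simp only [avg, ← Finset.mul_sum]
  ring

theorem avg_mono {g h : ℕ → ℝ} (H : ∀ i, g i ≤ h i) : avg n g ≤ avg n h := by
  unfold avg
  gcongr
  exact H _

theorem avg_mul_sub (b : ℝ) :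
    avg n (fun i => w i * (y i - b)) = avg n (fun i => w i * y i) - b * avg n w := by
  have : (fun i => w i * (y i - b)) = fun i => w i * y i + (-b) * w i := by
    ext i
    ring
  rw [this, avg_add, avg_mul]
  ring

theorem ratioMean_sub (hF : avg n w ≠ 0) (a : ℝ) :
    ratioMean n w y - a = avg n (fun i => w i * (y i - a)) / avg n w := by
  rw [avg_mul_sub, ratioMean]
  field_simp

/-- The ratio mean is the weighted mean, so its weighted residuals cancel and the subtracted square
in the variance estimator drops out. -/
theorem avg_mul_sub_ratioMean (hF : avg n w ≠ 0) :
    avg n (fun i => w i * (y i - ratioMean n w y)) = 0 := by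
  rw [avg_mul_sub, ratioMean]
  field_simp
  ring

theorem avg_sq_sub_ratioMean (a : ℝ) :
    avg n (fun i => (w i * (y i - ratioMean n w y)) ^ 2) =
      avg n (fun i => (w i * (y i - a)) ^ 2) -
        2 * (ratioMean n w y - a) * avg n (fun i => w i * (w i * (y i - a))) +
        (ratioMean n w y - a) ^ 2 * avg n (fun i => w i ^ 2) := by
  have : (fun i => (w i * (y i - ratioMean n w y)) ^ 2) = fun i =>
      ((w i * (y i - a)) ^ 2 + (-(2 * (ratioMean n w y - a))) * (w i * (w i * (y i - a)))) +
        (ratioMean n w y - a) ^ 2 * w i ^ 2 := by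
    ext i
    ring
  rw [this, avg_add, avg_add, avg_mul, avg_mul]
  ring

theorem abs_avg_mul_le (g h : ℕ → ℝ) :
    |avg n (fun i => g i * h i)| ≤ avg n (fun i => g i ^ 2) + avg n fun i => h i ^ 2 := by
  rw [← avg_add, abs_le]
  constructor
  · have : -avg n (fun i => g i ^ 2 + h i ^ 2) = avg n fun i => (-1) * (g i ^ 2 + h i ^ 2) := by
      rw [avg_mul]
      ring
    rw [this]
    exact avg_mono fun i => by nlinarith [sq_nonneg (g i + h i)]
  · exact avg_mono fun i => by nlinarith [sq_nonneg (g i - h i)]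

/-- The normalized estimated variance is close to one. -/
theorem abs_avg_sq_div_sub_one_le {f a s : ℝ} (hf : 0 < f) (hF : f / 2 ≤ avg n w) (hs : 0 < s) :
    |avg n (fun i => (w i * (y i - ratioMean n w y)) ^ 2) / s ^ 2 - 1| ≤
      |avg n (fun i => (w i * (y i - a)) ^ 2) / s ^ 2 - 1| +
        4 / f * (|avg n (fun i => w i * (y i - a))| *
          |avg n (fun i => (w i * (y i - a)) ^ 2) / s ^ 2| +
          |avg n (fun i => w i * (y i - a)) * (avg n (fun i => w i ^ 2) / s ^ 2)|) +
        4 / f ^ 2 * (|avg n (fun i => w i * (y i - a))| *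
          |avg n (fun i => w i * (y i - a)) * (avg n (fun i => w i ^ 2) / s ^ 2)|) := by
  have hF0 : 0 < avg n w := by linarith
  -- The error of the ratio mean is the weighted average `A` of `y - a` over an average weight of at
  -- least `f / 2`. In the final bound `Q / s²` occurs only multiplied by `A`: boundedness of its
  -- expectation is then enough, with no limit for it.
  have hΔ : |ratioMean n w y - a| ≤ 2 / f * |avg n (fun i => w i * (y i - a))| := by
    rw [ratioMean_sub hF0.ne', abs_div, abs_of_pos hF0, div_le_iff₀ hF0]
    calc |avg n (fun i => w i * (y i - a))|
        = 2 / f * |avg n (fun i => w i * (y i - a))| * (f / 2) := by field_simp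
      _ ≤ _ := by gcongr
  rw [avg_sq_sub_ratioMean a]
  have hS := abs_avg_mul_le (n := n) w (fun i => w i * (y i - a))
  set A := avg n (fun i => w i * (y i - a))
  set D := ratioMean n w y - a
  set S := avg n (fun i => w i * (w i * (y i - a)))
  set Q := avg n (fun i => w i ^ 2)
  set R := avg n (fun i => (w i * (y i - a)) ^ 2)
  have hQ : 0 ≤ Q := by
    have := avg_mono (n := n) (g := fun _ => 0) (h := fun i => w i ^ 2) fun i => sq_nonneg _
    simpa [avg, Q] using this
  have hs2 : 0 < s ^ 2 := by positivity
  have hS' : |S / s ^ 2| ≤ Q / s ^ 2 + |R / s ^ 2| := by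
    rw [abs_div, abs_of_pos hs2]
    calc |S| / s ^ 2 ≤ (Q + R) / s ^ 2 := by gcongr
      _ = Q / s ^ 2 + R / s ^ 2 := add_div _ _ _
      _ ≤ _ := by gcongr; exact le_abs_self _
  have hQs : 0 ≤ Q / s ^ 2 := by positivity
  have e : (R - 2 * D * S + D ^ 2 * Q) / s ^ 2 - 1 =
      (R / s ^ 2 - 1) - 2 * D * (S / s ^ 2) + D ^ 2 * (Q / s ^ 2) := by
    field_simp
    ring
  rw [e]
  generalize Q / s ^ 2 = q at *
  generalize R / s ^ 2 = r at *
  generalize S / s ^ 2 = t at *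
  have h1 : |2 * D * t| ≤ 2 * (2 / f * |A|) * (q + |r|) := by
    rw [abs_mul, abs_mul, abs_two]
    gcongr
  have h2 : |D ^ 2 * q| ≤ (2 / f * |A|) ^ 2 * q := by
    rw [abs_mul, abs_pow, abs_of_nonneg hQs]
    gcongr
  have h3 : |A * q| = |A| * q := by rw [abs_mul, abs_of_nonneg hQs]
  rw [h3]
  calc _ ≤ |r - 1| + |2 * D * t| + |D ^ 2 * q| :=
        (abs_add_le _ _).trans (by gcongr; exact abs_sub _ _)
    _ ≤ |r - 1| + 2 * (2 / f * |A|) * (q + |r|) + (2 / f * |A|) ^ 2 * q := by gcongr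
    _ = _ := by ring

/-- The average weight divides both the error and the estimated standard deviation, hence cancels;
`s` is then introduced as a deterministic normalization. -/
theorem ratio_stat_eq (hF : 0 < avg n w) {s : ℝ} (hs : 0 < s) (a : ℝ) :
    √(n : ℝ) * ((ratioMean n w y - a) / √(ratioVar n w y)) =
      (√(n : ℝ) * avg n (fun i => w i * (y i - a)) / s) *
        (√(avg n (fun i => (w i * (y i - ratioMean n w y)) ^ 2) / s ^ 2))⁻¹ := by
  rw [ratioVar, avg_mul_sub_ratioMean hF.ne', ratioMean_sub hF.ne']
  rw [Real.sqrt_div' _ (by positivity), Real.sqrt_sq hs.le, Real.sqrt_mul (by positivity),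
    Real.sqrt_inv, Real.sqrt_sq hF.le]
  simp only [ne_eq, OfNat.ofNat_ne_zero, not_false_eq_true, zero_pow, sub_zero]
  -- If all weighted residuals vanish, both sides are zero by the convention for division by zero.
  rcases eq_or_ne (√(avg n (fun i => (w i * (y i - ratioMean n w y)) ^ 2))) 0 with h | h
  · simp [h]
  · field_simp

end Ratio

/-! ### Asymptotic normality of ratio estimators -/

section RatioCLT

open scoped ENNReal

variable {Ω Ω' S : Type*} [MeasurableSpace Ω] [MeasurableSpace Ω'] [MeasurableSpace S]
  {P : Measure Ω} [IsProbabilityMeasure P] {P' : Measure Ω'} [IsProbabilityMeasure P']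

/-- Moment conditions on weights `w n`, under which the weighted averages of i.i.d. copies of `Y`,
with weights obtained from copies of `Z`, are asymptotically normal around `a`. -/
structure RatioArray (P : Measure Ω) (Y : Ω → ℝ) (Z : Ω → S) (w : ℕ → S → ℝ) (a f δ c C : ℝ)
    (M : ℕ → ℝ) : Prop where
  f_pos : 0 < f
  δ_pos : 0 < δ
  δ_le_one : δ ≤ 1
  c_pos : 0 < c
  measurable : ∀ n, Measurable (w n)
  aemeasurable_fst : AEMeasurable Y P
  aemeasurable_snd : AEMeasurable Z P
  integrable_rpow : Integrable (fun ω => |Y ω - a| ^ (2 + δ)) P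
  abs_le : ∀ n z, |w n z| ≤ M n
  mean : Tendsto (fun n => ∫ ω, w n (Z ω) ∂P) atTop (𝓝 f)
  sq_pos : ∀ n, 1 ≤ n → 0 < ∫ ω, w n (Z ω) ^ 2 ∂P
  sq_div : Tendsto (fun n : ℕ => (∫ ω, w n (Z ω) ^ 2 ∂P) / n) atTop (𝓝 0)
  bias : Tendsto (fun n : ℕ => √(n : ℝ) * (∫ ω, w n (Z ω) * (Y ω - a) ∂P) /
    √(∫ ω, w n (Z ω) ^ 2 ∂P)) atTop (𝓝 0)
  sq_lower : ∀ n, c * ∫ ω, w n (Z ω) ^ 2 ∂P ≤ ∫ ω, (w n (Z ω) * (Y ω - a)) ^ 2 ∂P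
  sq_upper : ∀ n, ∫ ω, (w n (Z ω) * (Y ω - a)) ^ 2 ∂P ≤ C * ∫ ω, w n (Z ω) ^ 2 ∂P
  rpow_upper : ∀ n, ∫ ω, |w n (Z ω) * (Y ω - a)| ^ (2 + δ) ∂P ≤
    C * (M n ^ δ * ∫ ω, w n (Z ω) ^ 2 ∂P)
  bound_div : Tendsto (fun n : ℕ => M n ^ 2 / (n * ∫ ω, w n (Z ω) ^ 2 ∂P)) atTop (𝓝 0)

namespace RatioArray

variable {Y : Ω → ℝ} {Z : Ω → S} {w : ℕ → S → ℝ} {a f δ c C : ℝ} {M : ℕ → ℝ}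
  (h : RatioArray P Y Z w a f δ c C M)
include h

omit [IsProbabilityMeasure P] in
theorem aemeasurable_weight (n : ℕ) : AEMeasurable (fun ω => w n (Z ω)) P :=
  (h.measurable n).comp_aemeasurable h.aemeasurable_snd

omit [IsProbabilityMeasure P] in
theorem aemeasurable_mul (n : ℕ) : AEMeasurable (fun ω => w n (Z ω) * (Y ω - a)) P :=
  (h.aemeasurable_weight n).mul (h.aemeasurable_fst.sub_const a)

theorem memLp_weight (n : ℕ) : MemLp (fun ω => w n (Z ω)) 2 P :=
  MemLp.of_bound (h.aemeasurable_weight n).aestronglyMeasurable (M n)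
    (Eventually.of_forall fun _ => h.abs_le n _)

omit [IsProbabilityMeasure P] in
theorem integrable_rpow_mul (n : ℕ) :
    Integrable (fun ω => |w n (Z ω) * (Y ω - a)| ^ (2 + δ)) P := by
  have hm : AEMeasurable (fun ω => |w n (Z ω) * (Y ω - a)| ^ (2 + δ)) P :=
    (measurable_id.abs.pow_const (2 + δ)).comp_aemeasurable (h.aemeasurable_mul n)
  refine (h.integrable_rpow.const_mul (M n ^ (2 + δ))).mono' hm.aestronglyMeasurable
    (Eventually.of_forall fun ω => ?_)
  have h2 := h.δ_pos
  have h0 : 0 ≤ M n := (abs_nonneg _).trans (h.abs_le n (Z ω))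
  rw [Real.norm_of_nonneg (by positivity), abs_mul, Real.mul_rpow (abs_nonneg _) (abs_nonneg _)]
  gcongr
  exact h.abs_le n _

theorem memLp_mul (n : ℕ) : MemLp (fun ω => w n (Z ω) * (Y ω - a)) 2 P := by
  have h2 := h.δ_pos
  refine (memLp_two_iff_integrable_sq (h.aemeasurable_mul n).aestronglyMeasurable).2 ?_
  refine ((integrable_const (1 : ℝ)).add (h.integrable_rpow_mul n)).mono'
    ((h.aemeasurable_mul n).pow_const 2).aestronglyMeasurable (Eventually.of_forall fun ω => ?_)
  rw [Real.norm_of_nonneg (sq_nonneg _), ← sq_abs, Pi.add_apply]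
  set x := |w n (Z ω) * (Y ω - a)|
  have hx : 0 ≤ x := abs_nonneg _
  rcases le_or_gt x 1 with hx1 | hx1
  · have : 0 ≤ x ^ (2 + δ) := by positivity
    nlinarith
  · have := Real.rpow_le_rpow_of_exponent_le hx1.le (show (2 : ℝ) ≤ 2 + δ by linarith)
    rw [Real.rpow_two] at this
    linarith

omit [IsProbabilityMeasure P] in
theorem sq_mul_pos {n : ℕ} (hn : 1 ≤ n) : 0 < ∫ ω, (w n (Z ω) * (Y ω - a)) ^ 2 ∂P :=
  lt_of_lt_of_le (mul_pos h.c_pos (h.sq_pos n hn)) (h.sq_lower n)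

/-- Since `s_n² ≥ c v_n`, the bias condition controls the mean. The Lyapunov sum is at most `n C M^δ
v / (n c v)^(1+δ/2)`, a constant times `(M² / (n v))^(δ/2)`. -/
theorem lyapunovArray : LyapunovArray P (fun n ω => w n (Z ω) * (Y ω - a) /
    (√(n : ℝ) * √(∫ ω, (w n (Z ω) * (Y ω - a)) ^ 2 ∂P))) δ where
  pos := h.δ_pos
  le_one := h.δ_le_one
  aemeasurable n := (h.aemeasurable_mul n).div_const _
  integrable_rpow n := by
    have := (h.integrable_rpow_mul n).div_const
      (|√(n : ℝ) * √(∫ ω, (w n (Z ω) * (Y ω - a)) ^ 2 ∂P)| ^ (2 + δ))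
    refine this.congr (Eventually.of_forall fun ω => ?_)
    simp only [abs_div _ (√(n : ℝ) * _)]
    rw [Real.div_rpow (abs_nonneg _) (abs_nonneg _)]
  integrable_sq n := by
    simp only [div_pow]
    exact (h.memLp_mul n).integrable_sq.div_const _
  integrable n := ((h.memLp_mul n).integrable one_le_two).div_const _
  mean := by
    have hz := (h.bias.abs.const_mul (√c)⁻¹)
    rw [abs_zero, mul_zero] at hz
    refine squeeze_zero_norm' ?_ hz
    filter_upwards [eventually_ge_atTop 1] with n hn
    rw [integral_div]
    have h1 := h.sq_lower n
    have h2 := h.sq_pos n hn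
    have h3 := h.sq_mul_pos hn
    set s := ∫ ω, (w n (Z ω) * (Y ω - a)) ^ 2 ∂P
    set v := ∫ ω, w n (Z ω) ^ 2 ∂P
    set b := ∫ ω, w n (Z ω) * (Y ω - a) ∂P
    have hc := h.c_pos
    have hn0 : (0 : ℝ) < n := by positivity
    have e : (n : ℝ) * (b / (√(n : ℝ) * √s)) = √(n : ℝ) * b / √s := by
      have : (n : ℝ) = √(n : ℝ) * √(n : ℝ) := (Real.mul_self_sqrt hn0.le).symm
      have h4 : √(n : ℝ) ≠ 0 := (Real.sqrt_pos.2 hn0).ne'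
      nth_rewrite 1 [this]
      field_simp
    rw [e, Real.norm_eq_abs, abs_div, abs_div, abs_of_nonneg (Real.sqrt_nonneg s),
      abs_of_nonneg (Real.sqrt_nonneg v)]
    have h5 : √c * √v ≤ √s := by
      rw [← Real.sqrt_mul hc.le]
      exact Real.sqrt_le_sqrt h1
    have h6 : 0 < √c * √v := by positivity
    calc _ ≤ |√(n : ℝ) * b| / (√c * √v) := by gcongr
      _ = _ := by field_simp
  sq := by
    refine tendsto_const_nhds.congr' ?_
    filter_upwards [eventually_ge_atTop 1] with n hn
    have h3 := h.sq_mul_pos hn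
    have hn0 : (0 : ℝ) < n := by positivity
    simp only [div_pow _ (√(n : ℝ) * _)]
    rw [integral_div, mul_pow, Real.sq_sqrt hn0.le, Real.sq_sqrt h3.le]
    set s := ∫ ω, (w n (Z ω) * (Y ω - a)) ^ 2 ∂P
    field_simp
  rpow := by
    have hc := h.c_pos
    have hδ := h.δ_pos
    have hz : Tendsto (fun n : ℕ => C / c * (c⁻¹ * (M n ^ 2 / (n * ∫ ω, w n (Z ω) ^ 2 ∂P))) ^
        (δ / 2)) atTop (𝓝 0) := by
      have h1 := (h.bound_div.const_mul c⁻¹).rpow_const (p := δ / 2) (Or.inr (by positivity))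
      rw [mul_zero, Real.zero_rpow (by positivity)] at h1
      simpa using h1.const_mul (C / c)
    refine squeeze_zero' ?_ ?_ hz
    · filter_upwards with n
      positivity
    · filter_upwards [eventually_ge_atTop 1] with n hn
      have hn0 : (0 : ℝ) < n := by positivity
      have e : ∀ ω, |w n (Z ω) * (Y ω - a) /
          (√(n : ℝ) * √(∫ ω, (w n (Z ω) * (Y ω - a)) ^ 2 ∂P))| ^ (2 + δ) =
          |w n (Z ω) * (Y ω - a)| ^ (2 + δ) /
            (n * ∫ ω, (w n (Z ω) * (Y ω - a)) ^ 2 ∂P) ^ (1 + δ / 2) := fun ω => by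
        have h3 := h.sq_mul_pos hn
        rw [abs_div _ (√(n : ℝ) * _), Real.div_rpow (abs_nonneg _) (abs_nonneg _)]
        congr 1
        rw [← Real.sqrt_mul hn0.le, abs_of_nonneg (Real.sqrt_nonneg _), Real.sqrt_eq_rpow,
          ← Real.rpow_mul (by positivity)]
        congr 1
        ring
      simp only [e]
      rw [integral_div]
      have h1 := h.sq_lower n
      have h2 := h.sq_pos n hn
      have h3 := h.sq_mul_pos hn
      have h4 := h.rpow_upper n
      have hM : 0 ≤ M n := by
        by_contra hM
        -- A point of the probability space is needed for `M n` to bound an actual absolute value.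
        obtain ⟨ω⟩ : Nonempty Ω := P.nonempty_of_neZero
        exact hM ((abs_nonneg _).trans (h.abs_le n (Z ω)))
      set s := ∫ ω, (w n (Z ω) * (Y ω - a)) ^ 2 ∂P
      set v := ∫ ω, w n (Z ω) ^ 2 ∂P
      have hC : 0 ≤ C * (M n ^ δ * v) := le_trans (by positivity) h4
      calc (n : ℝ) * ((∫ ω, |w n (Z ω) * (Y ω - a)| ^ (2 + δ) ∂P) / (n * s) ^ (1 + δ / 2))
          ≤ n * (C * (M n ^ δ * v) / (n * (c * v)) ^ (1 + δ / 2)) := by gcongr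
        _ = C / c * (M n ^ δ / (n * (c * v)) ^ (δ / 2)) := by
            rw [Real.rpow_add (by positivity), Real.rpow_one]
            field_simp
        _ = C / c * ((M n ^ 2) ^ (δ / 2) / (n * (c * v)) ^ (δ / 2)) := by
            rw [← Real.rpow_two (M n), ← Real.rpow_mul hM, mul_div_cancel₀ δ two_ne_zero]
        _ = _ := by
            rw [← Real.div_rpow (by positivity) (by positivity)]
            congr 2
            field_simp

variable {Yo : ℕ → Ω' → ℝ} {Zo : ℕ → Ω' → S}
  (hindep : iIndepFun (fun i ω => (Yo i ω, Zo i ω)) P')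
  (hident : ∀ i, IdentDistrib (fun ω => (Yo i ω, Zo i ω)) (fun ω => (Y ω, Z ω)) P' P)
include hindep hident

omit [IsProbabilityMeasure P] [IsProbabilityMeasure P'] h hindep in
theorem aemeasurable_obs (i : ℕ) : AEMeasurable (Yo i) P' ∧ AEMeasurable (Zo i) P' :=
  ⟨measurable_fst.comp_aemeasurable (hident i).aemeasurable_fst,
    measurable_snd.comp_aemeasurable (hident i).aemeasurable_fst⟩

theorem tendsto_weight : TendstoInMeasure P' (fun n ω => avg n fun i => w n (Zo i ω)) atTop
    fun _ => f :=
  tendstoInMeasure_average hindep hident (g := fun n p => w n p.2)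
    (fun n => (h.measurable n).comp measurable_snd) h.memLp_weight h.mean h.sq_div

omit [IsProbabilityMeasure P] hindep hident in
-- The mean is the normalized bias times `√(v_n / n)`, and both factors tend to zero.
theorem tendsto_mean_mul : Tendsto (fun n => ∫ ω, w n (Z ω) * (Y ω - a) ∂P) atTop (𝓝 0) := by
  have h1 := h.bias.mul h.sq_div.sqrt
  rw [zero_mul] at h1
  refine h1.congr' ?_
  filter_upwards [eventually_ge_atTop 1] with n hn
  have h2 := h.sq_pos n hn
  have hn0 : (0 : ℝ) < n := by positivity
  rw [Real.sqrt_div h2.le]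
  have h3 : √(n : ℝ) ≠ 0 := (Real.sqrt_pos.2 hn0).ne'
  have h4 : √(∫ ω, w n (Z ω) ^ 2 ∂P) ≠ 0 := (Real.sqrt_pos.2 h2).ne'
  field_simp

theorem tendsto_mul : TendstoInMeasure P'
    (fun n ω => avg n fun i => w n (Zo i ω) * (Yo i ω - a)) atTop fun _ => (0 : ℝ) := by
  refine tendstoInMeasure_average hindep hident (g := fun n p => w n p.2 * (p.1 - a))
    (fun n => ((h.measurable n).comp measurable_snd).mul (measurable_fst.sub_const a))
    h.memLp_mul h.tendsto_mean_mul ?_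
  have h1 := h.sq_div.const_mul C
  rw [mul_zero] at h1
  refine squeeze_zero (fun n => by positivity) (fun n => ?_) h1
  calc _ ≤ (C * ∫ ω, w n (Z ω) ^ 2 ∂P) / n := by
        gcongr
        exact h.sq_upper n
    _ = _ := mul_div_assoc _ _ _

/-- With only `2 + δ` moments Chebyshev's inequality is not available for the squares; their
convergence comes from the characteristic function limit. -/
theorem tendsto_sq_mul : TendstoInMeasure P'
    (fun n ω => avg n (fun i => (w n (Zo i ω) * (Yo i ω - a)) ^ 2) /
      √(∫ ω, (w n (Z ω) * (Y ω - a)) ^ 2 ∂P) ^ 2) atTop fun _ => (1 : ℝ) := by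
  have h1 := tendstoInMeasure_of_tendstoInDistribution_dirac
    (LyapunovArray.tendsto_sum_sq hindep hident (g := fun n p => w n p.2 * (p.1 - a) /
      (√(n : ℝ) * √(∫ ω, (w n (Z ω) * (Y ω - a)) ^ 2 ∂P)))
      (fun n => (((h.measurable n).comp measurable_snd).mul
        (measurable_fst.sub_const a)).div_const _) h.lyapunovArray)
  refine tendstoInMeasure_of_edist_le h1 (S := fun _ => ∅) (by simp) ?_
  filter_upwards with n ω _
  refine le_of_eq ?_
  congr 1
  simp only [avg, div_pow, ← Finset.sum_div]
  rw [mul_pow √(n : ℝ), Real.sq_sqrt (Nat.cast_nonneg n)]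
  field_simp

/-- The second factor has expectation `v_n / s_n² ≤ 1 / c`, while the first tends to zero in
probability. -/
theorem tendsto_mul_mul_sq : TendstoInMeasure P'
    (fun n ω => (avg n fun i => w n (Zo i ω) * (Yo i ω - a)) *
      (avg n (fun i => w n (Zo i ω) ^ 2) / √(∫ ω, (w n (Z ω) * (Y ω - a)) ^ 2 ∂P) ^ 2)) atTop
    fun _ => (0 : ℝ) := by
  have hc := h.c_pos
  have hZ := fun i => (aemeasurable_obs hident i).2
  have hW : ∀ n i, AEMeasurable (fun ω => w n (Zo i ω)) P' := fun n i =>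
    (h.measurable n).comp_aemeasurable (hZ i)
  have hint : ∀ n i, Integrable (fun ω => w n (Zo i ω) ^ 2) P' := fun n i => by
    refine Integrable.of_bound ((hW n i).pow_const 2).aestronglyMeasurable (M n ^ 2)
      (Eventually.of_forall fun ω => ?_)
    rw [norm_pow, Real.norm_eq_abs]
    gcongr
    exact h.abs_le n _
  have hQm : ∀ n, AEMeasurable (fun ω => avg n (fun i => w n (Zo i ω) ^ 2) /
      √(∫ ω, (w n (Z ω) * (Y ω - a)) ^ 2 ∂P) ^ 2) P' := fun n =>
    ((Finset.aemeasurable_fun_sum _ fun i _ => (hW n i).pow_const 2).const_mul _).div_const _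
  refine tendstoInMeasure_mul_of_lintegral_le (C := ENNReal.ofReal c⁻¹) (by simp)
    (h.tendsto_mul hindep hident) hQm ?_
  filter_upwards [eventually_ge_atTop 1] with n hn
  have hn0 : (0 : ℝ) < n := by positivity
  have h2 := h.sq_pos n hn
  have h3 := h.sq_mul_pos hn
  have hpos : ∀ ω, 0 ≤ avg n (fun i => w n (Zo i ω) ^ 2) /
      √(∫ ω, (w n (Z ω) * (Y ω - a)) ^ 2 ∂P) ^ 2 := fun ω => by
    unfold avg
    positivity
  have hI : Integrable (fun ω => avg n (fun i => w n (Zo i ω) ^ 2) /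
      √(∫ ω, (w n (Z ω) * (Y ω - a)) ^ 2 ∂P) ^ 2) P' :=
    ((integrable_finsetSum _ fun i _ => hint n i).const_mul _).div_const _
  simp only [Real.enorm_of_nonneg (hpos _)]
  rw [← ofReal_integral_eq_lintegral_ofReal hI (Eventually.of_forall hpos)]
  refine ENNReal.ofReal_le_ofReal ?_
  have e : ∀ i, ∫ ω, w n (Zo i ω) ^ 2 ∂P' = ∫ ω, w n (Z ω) ^ 2 ∂P := fun i =>
    ((hident i).comp (u := fun p : ℝ × S => w n p.2 ^ 2)
      (((h.measurable n).comp measurable_snd).pow_const 2)).integral_eq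
  unfold avg
  rw [integral_div, integral_const_mul, integral_finsetSum _ fun i _ => hint n i,
    Finset.sum_congr rfl fun i _ => e i, Real.sq_sqrt h3.le]
  simp only [Finset.sum_const, Finset.card_range, nsmul_eq_mul]
  rw [inv_mul_cancel_left₀ hn0.ne', div_le_iff₀ h3]
  calc _ = c⁻¹ * (c * ∫ ω, w n (Z ω) ^ 2 ∂P) := by field_simp
    _ ≤ _ := by
      gcongr
      exact h.sq_lower n

theorem tendsto_small_weight :
    Tendsto (fun n : ℕ => P' {ω | avg n (fun i => w n (Zo i ω)) < f / 2}) atTop (𝓝 0) := by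
  have hf := h.f_pos
  refine tendsto_of_tendsto_of_tendsto_of_le_of_le tendsto_const_nhds
    (h.tendsto_weight hindep hident (ENNReal.ofReal (f / 2)) (by simpa using hf))
    (fun _ => zero_le) fun n => measure_mono fun ω hω => ?_
  simp only [Set.mem_ofPred_eq] at hω ⊢
  rw [edist_dist, Real.dist_eq]
  refine ENNReal.ofReal_le_ofReal ?_
  rw [abs_sub_comm]
  exact le_trans (by linarith) (le_abs_self _)

/-- Continuous mapping applied to the right side of `abs_avg_sq_div_sub_one_le`, off the event that
the average weight is below `f / 2`. -/
theorem tendsto_var : TendstoInMeasure P' (fun n ω => avg n (fun i => (w n (Zo i ω) * (Yo i ω -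
      ratioMean n (fun i => w n (Zo i ω)) fun i => Yo i ω)) ^ 2) /
      √(∫ ω, (w n (Z ω) * (Y ω - a)) ^ 2 ∂P) ^ 2) atTop fun _ => (1 : ℝ) := by
  have h1 := tendstoInMeasure_comp_const (tendstoInMeasure_prodMk_const
    (h.tendsto_sq_mul hindep hident) (tendstoInMeasure_prodMk_const (h.tendsto_mul hindep hident)
      (h.tendsto_mul_mul_sq hindep hident))) (g := fun p : ℝ × ℝ × ℝ =>
        |p.1 - 1| + 4 / f * (|p.2.1| * |p.1| + |p.2.2|) + 4 / f ^ 2 * (|p.2.1| * |p.2.2|))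
      (by fun_prop)
  refine tendstoInMeasure_of_edist_le h1 (h.tendsto_small_weight hindep hident) ?_
  filter_upwards [eventually_ge_atTop 1] with n hn ω hω
  have hs : 0 < √(∫ ω, (w n (Z ω) * (Y ω - a)) ^ 2 ∂P) := Real.sqrt_pos.2 (h.sq_mul_pos hn)
  simp only [not_lt] at hω
  have := abs_avg_sq_div_sub_one_le (y := fun i => Yo i ω) (a := a) h.f_pos hω hs
  rw [edist_dist, edist_dist, Real.dist_eq, Real.dist_eq]
  refine ENNReal.ofReal_le_ofReal (this.trans (le_of_eq ?_))
  have hf := h.f_pos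
  simp only [sub_self, abs_zero, zero_mul, mul_zero, add_zero, sub_zero]
  exact (abs_of_nonneg (by positivity)).symm

/-- If the average weight is positive and the estimated deviation is zero, the normalized residual
variance is at most zero, hence at distance at least one from its limit. -/
theorem tendsto_ratioVar_eq_zero : Tendsto (fun n : ℕ => P' {ω | √(ratioVar n
    (fun i => w n (Zo i ω)) fun i => Yo i ω) = 0}) atTop (𝓝 0) := by
  have hf := h.f_pos
  have h1 := (h.tendsto_var hindep hident 1 one_pos).add (h.tendsto_small_weight hindep hident)
  rw [add_zero] at h1
  refine tendsto_of_tendsto_of_tendsto_of_le_of_le tendsto_const_nhds h1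
    (fun _ => zero_le) fun n => ?_
  refine (measure_mono fun ω hω => ?_).trans (measure_union_le _ _)
  by_contra hc
  simp only [Set.mem_union, Set.mem_ofPred_eq, not_or, not_le, not_lt] at hc hω
  obtain ⟨hc1, hc2⟩ := hc
  have hF : 0 < avg n fun i => w n (Zo i ω) := by linarith
  rw [ratioVar, avg_mul_sub_ratioMean hF.ne', zero_pow two_ne_zero, sub_zero,
    Real.sqrt_eq_zero', mul_nonpos_iff_pos_imp_nonpos] at hω
  have h2 := hω.1 (by positivity)
  rw [edist_dist, Real.dist_eq, ← ENNReal.ofReal_one, ENNReal.ofReal_lt_ofReal_iff one_pos] at hc1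
  have h3 := (abs_lt.1 hc1).1
  have h4 := div_nonpos_of_nonpos_of_nonneg h2
    (sq_nonneg √(∫ ω, (w n (Z ω) * (Y ω - a)) ^ 2 ∂P))
  linarith

/-- Slutsky's theorem for the product form of `ratio_stat_eq`. That form may fail only where the
average weight is below `f / 2`, an event of vanishing probability. -/
theorem clt : TendstoInDistribution
    (fun (n : ℕ) ω => √(n : ℝ) *
      ((ratioMean n (fun i => w n (Zo i ω)) (fun i => Yo i ω) - a) /
        √(ratioVar n (fun i => w n (Zo i ω)) fun i => Yo i ω)))
    atTop (id : ℝ → ℝ) (fun _ => P') (gaussianReal 0 1) := by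
  have hf := h.f_pos
  have hYm := fun i => (aemeasurable_obs hident i).1
  have hW : ∀ n i, AEMeasurable (fun ω => w n (Zo i ω)) P' := fun n i =>
    (h.measurable n).comp_aemeasurable (aemeasurable_obs hident i).2
  have havg : ∀ n (g : ℕ → Ω' → ℝ), (∀ i, AEMeasurable (g i) P') →
      AEMeasurable (fun ω => avg n fun i => g i ω) P' := fun n g hg =>
    (Finset.aemeasurable_fun_sum _ fun i _ => hg i).const_mul _
  have hmean : ∀ n, AEMeasurable
      (fun ω => ratioMean n (fun i => w n (Zo i ω)) fun i => Yo i ω) P' := fun n =>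
    (havg n _ (hW n)).inv.mul (havg n _ fun i => (hW n i).mul (hYm i))
  have hres : ∀ n i, AEMeasurable (fun ω => w n (Zo i ω) * (Yo i ω -
      ratioMean n (fun i => w n (Zo i ω)) fun i => Yo i ω)) P' := fun n i =>
    (hW n i).mul ((hYm i).sub (hmean n))
  have hvar : ∀ n, AEMeasurable
      (fun ω => ratioVar n (fun i => w n (Zo i ω)) fun i => Yo i ω) P' := fun n =>
    ((havg n _ (hW n)).pow_const 2).inv.mul ((havg n _ fun i => (hres n i).pow_const 2).sub
      ((havg n _ (hres n)).pow_const 2))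
  have hG := LyapunovArray.clt hindep hident (g := fun n p => w n p.2 * (p.1 - a) /
      (√(n : ℝ) * √(∫ ω, (w n (Z ω) * (Y ω - a)) ^ 2 ∂P)))
      (fun n => (((h.measurable n).comp measurable_snd).mul
        (measurable_fst.sub_const a)).div_const _) h.lyapunovArray
  have hH := tendstoInMeasure_comp_const (h.tendsto_var hindep hident)
    (g := fun x => (√x)⁻¹) (Real.continuous_sqrt.continuousAt.inv₀ (by simp))
  have hHm : ∀ n, AEMeasurable (fun ω => (√(avg n (fun i => (w n (Zo i ω) * (Yo i ω -
      ratioMean n (fun i => w n (Zo i ω)) fun i => Yo i ω)) ^ 2) /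
      √(∫ ω, (w n (Z ω) * (Y ω - a)) ^ 2 ∂P) ^ 2))⁻¹) P' := fun n =>
    ((havg n _ fun i => (hres n i).pow_const 2).div_const _).sqrt.inv
  have hGH := hG.continuous_comp_prodMk_of_tendstoInMeasure_const
    (g := fun p : ℝ × ℝ => p.1 * p.2) (by fun_prop) hH hHm
  simp only [Real.sqrt_one, inv_one, mul_one, id] at hGH
  refine tendstoInDistribution_of_tendstoInMeasure_sub _ _ hGH ?_
    fun n => (((hmean n).sub_const a).div (hvar n).sqrt).const_mul _
  have h0 : TendstoInMeasure P' (fun (_ : ℕ) (_ : Ω') => (0 : ℝ)) atTop fun _ => (0 : ℝ) :=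
    tendstoInMeasure_of_tendsto_ae (fun n => aestronglyMeasurable_const)
      (Eventually.of_forall fun _ => tendsto_const_nhds)
  refine tendstoInMeasure_of_edist_le h0 (h.tendsto_small_weight hindep hident) ?_
  filter_upwards [eventually_ge_atTop 1] with n hn ω hω
  have hs : 0 < √(∫ ω, (w n (Z ω) * (Y ω - a)) ^ 2 ∂P) := Real.sqrt_pos.2 (h.sq_mul_pos hn)
  simp only [not_lt] at hω
  have hF : 0 < avg n fun i => w n (Zo i ω) := by linarith
  simp only [Pi.sub_apply]
  rw [ratio_stat_eq hF hs a]
  refine le_of_eq ?_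
  congr 1
  rw [← Finset.sum_div, avg, sub_eq_zero]
  congr 1
  have hn0 : (0 : ℝ) < n := by positivity
  have h3 : √(n : ℝ) ≠ 0 := (Real.sqrt_pos.2 hn0).ne'
  nth_rewrite 2 [← Real.mul_self_sqrt hn0.le]
  field_simp

end RatioArray

end RatioCLT

/-! ### Normal quantiles and coverage of confidence intervals -/

section Coverage

open scoped ENNReal

/-- A jump of the distribution function is the mass of a point. -/
theorem continuous_cdf (μ : Measure ℝ) [IsProbabilityMeasure μ] [NullSingletonClass μ] :
    Continuous (cdf μ) := by
  refine continuous_iff_continuousAt.2 fun a =>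
    (monotone_cdf μ).continuousAt_iff_leftLim_eq_rightLim.2 ?_
  rw [(cdf μ).rightLim_eq]
  refine le_antisymm ((monotone_cdf μ).leftLim_le le_rfl) ?_
  have h := (cdf μ).measure_singleton a
  rw [measure_cdf, measure_singleton, eq_comm, ENNReal.ofReal_eq_zero] at h
  linarith

/-- The level `p` is attained by the intermediate value theorem, and the infimum belongs to the
closed superlevel set. -/
theorem cdf_csInf_eq (μ : Measure ℝ) [IsProbabilityMeasure μ] [NullSingletonClass μ] {p : ℝ} (hp0 : 0 < p)
    (hp1 : p < 1) : cdf μ (sInf {t | p ≤ cdf μ t}) = p := by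
  have hc := continuous_cdf μ
  obtain ⟨t₁, ht₁⟩ := ((tendsto_cdf_atBot μ).eventually (gt_mem_nhds hp0)).exists
  obtain ⟨t₂, ht₂⟩ := ((tendsto_cdf_atTop μ).eventually (lt_mem_nhds hp1)).exists
  obtain ⟨t, ht⟩ := mem_range_of_exists_le_of_exists_ge hc ⟨t₁, ht₁.le⟩ ⟨t₂, ht₂.le⟩
  have hb : BddBelow {t | p ≤ cdf μ t} := ⟨t₁, fun s hs => by
    by_contra hlt
    exact absurd (lt_of_le_of_lt ((monotone_cdf μ) (not_le.1 hlt).le) ht₁) (not_lt.2 hs)⟩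
  have hcl : IsClosed {t | p ≤ cdf μ t} := isClosed_le continuous_const hc
  refine le_antisymm ?_ (hcl.csInf_mem ⟨t, ht.ge⟩ hb)
  exact (monotone_cdf μ (csInf_le hb (show p ≤ cdf μ t from ht.ge))).trans ht.le

instance : NullSingletonClass (gaussianReal 0 1) := nullSingletonClass_gaussianReal one_ne_zero

theorem cdf_gaussianReal_neg (c : ℝ) :
    cdf (gaussianReal 0 1) (-c) = 1 - cdf (gaussianReal 0 1) c := by
  have h1 : (gaussianReal 0 1).map (fun x => -x) = gaussianReal 0 1 := by
    rw [gaussianReal_map_neg, neg_zero]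
  rw [cdf_eq_real, cdf_eq_real, ← probReal_compl_eq_one_sub measurableSet_Iic]
  nth_rewrite 1 [← h1]
  rw [map_measureReal_apply measurable_neg measurableSet_Iic, Set.compl_Iic]
  have : (fun x : ℝ => -x) ⁻¹' Set.Iic (-c) = Set.Ici c := by
    ext x
    simp
  rw [this]
  exact measureReal_congr Ioi_ae_eq_Ici.symm

theorem gaussianReal_Ioo_normalUpperQuantile {α : ℝ} (h0 : 0 < α) (h1 : α < 1) :
    (gaussianReal 0 1).real (Set.Ioo (-normalUpperQuantile (α / 2))
      (normalUpperQuantile (α / 2))) = 1 - α := by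
  set z := normalUpperQuantile (α / 2) with hz
  have hcz : cdf (gaussianReal 0 1) z = 1 - α / 2 := cdf_csInf_eq _ (by linarith) (by linarith)
  have hcn := cdf_gaussianReal_neg z
  have hzpos : -z ≤ z := by
    by_contra hlt
    have := monotone_cdf (gaussianReal 0 1) (not_le.1 hlt).le
    rw [hcn, hcz] at this
    linarith
  have e : (gaussianReal 0 1).real (Set.Ioo (-z) z) =
      (gaussianReal 0 1).real (Set.Iic z \ Set.Iic (-z)) := by
    have e' : Set.Iic z \ Set.Iic (-z) = Set.Ioc (-z) z := by
      ext x
      simp [and_comm]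
    rw [e']
    exact measureReal_congr Ioo_ae_eq_Ioc
  rw [e, measureReal_sdiff (Set.Iic_subset_Iic.2 hzpos) measurableSet_Iic, ← cdf_eq_real,
    ← cdf_eq_real, hcn, hcz]
  ring

variable {Ω' : Type*} [MeasurableSpace Ω'] {P' : Measure Ω'} [IsProbabilityMeasure P']

theorem mem_Ioo_iff_of_pos {n s m a z : ℝ} (hn : 0 < n) (hs : 0 < s) :
    a ∈ Set.Ioo (m - z * (s / √n)) (m + z * (s / √n)) ↔
      √n * ((m - a) / s) ∈ Set.Ioo (-z) z := by
  have hn' : 0 < √n := Real.sqrt_pos.2 hn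
  have e : √n * ((m - a) / s) = (m - a) / (s / √n) := by field_simp
  have hp : 0 < s / √n := by positivity
  rw [e, Set.mem_Ioo, Set.mem_Ioo, lt_div_iff₀ hp, div_lt_iff₀ hp]
  constructor <;> rintro ⟨h1, h2⟩ <;> constructor <;> linarith

/-- When `sh > 0`, the interval contains `a` exactly when the studentized statistic lies in `(-z,
z)`, whose boundary is null for the limit law. When `sh = 0` the interval is empty while the
statistic is zero by convention, so that event must be negligible. -/
theorem tendsto_coverage {mh sh : ℕ → Ω' → ℝ} {a : ℝ} (hs : ∀ n ω, 0 ≤ sh n ω)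
    (hclt : TendstoInDistribution (fun (n : ℕ) ω => √(n : ℝ) * ((mh n ω - a) / sh n ω)) atTop
      (id : ℝ → ℝ) (fun _ => P') (gaussianReal 0 1))
    (h0 : Tendsto (fun n => P' {ω | sh n ω = 0}) atTop (𝓝 0)) {α : ℝ} (hα0 : 0 < α)
    (hα1 : α < 1) :
    Tendsto (fun n : ℕ => P'.real {ω | a ∈ Set.Ioo
      (mh n ω - normalUpperQuantile (α / 2) * (sh n ω / √(n : ℝ)))
      (mh n ω + normalUpperQuantile (α / 2) * (sh n ω / √(n : ℝ)))}) atTop (𝓝 (1 - α)) := by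
  set z := normalUpperQuantile (α / 2) with hz
  have hfr : (gaussianReal 0 1) (frontier (Set.Ioo (-z) z)) = 0 := by
    refine measure_mono_null ?_ (Set.Finite.measure_zero (Set.toFinite {-z, z}) _)
    rcases lt_or_ge (-z) z with h | h
    · rw [frontier_Ioo h]
    · simp [Set.Ioo_eq_empty (not_lt.2 h)]
  have h1 := ProbabilityMeasure.tendsto_measure_of_null_frontier_of_tendsto' hclt.tendsto
    (E := Set.Ioo (-z) z) (by simpa using hfr)
  simp only [ProbabilityMeasure.coe_mk, Measure.map_id] at h1
  have h2 := (ENNReal.tendsto_toReal (measure_ne_top _ _)).comp h1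
  have h3 : ((gaussianReal 0 1) (Set.Ioo (-z) z)).toReal = 1 - α :=
    gaussianReal_Ioo_normalUpperQuantile hα0 hα1
  rw [h3] at h2
  have h4 := (ENNReal.tendsto_toReal ENNReal.zero_ne_top).comp h0
  have h5 : Tendsto (fun n : ℕ => P'.real {ω | a ∈ Set.Ioo
      (mh n ω - z * (sh n ω / √(n : ℝ))) (mh n ω + z * (sh n ω / √(n : ℝ)))} -
      P'.real {ω | √(n : ℝ) * ((mh n ω - a) / sh n ω) ∈ Set.Ioo (-z) z}) atTop (𝓝 0) := by
    refine squeeze_zero_norm' ?_ h4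
    filter_upwards [eventually_ge_atTop 1] with n hn
    have hn0 : (0 : ℝ) < n := by positivity
    have key : ∀ ω, ω ∉ {ω | sh n ω = 0} → (a ∈ Set.Ioo (mh n ω - z * (sh n ω / √(n : ℝ)))
        (mh n ω + z * (sh n ω / √(n : ℝ))) ↔
        √(n : ℝ) * ((mh n ω - a) / sh n ω) ∈ Set.Ioo (-z) z) := fun ω hω =>
      mem_Ioo_iff_of_pos hn0 (lt_of_le_of_ne (hs n ω) (Ne.symm hω))
    rw [Real.norm_eq_abs, abs_le]
    simp only [Function.comp_apply]
    change -P'.real {ω | sh n ω = 0} ≤ _ ∧ _ ≤ P'.real {ω | sh n ω = 0}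
    have aux : ∀ p q : Ω' → Prop, (∀ ω, ω ∉ {ω | sh n ω = 0} → p ω → q ω) →
        P'.real {ω | p ω} ≤ P'.real {ω | q ω} + P'.real {ω | sh n ω = 0} := fun p q hpq => by
      refine (measureReal_mono fun ω hω => ?_).trans (measureReal_union_le _ _)
      by_cases h : ω ∈ {ω | sh n ω = 0}
      · exact Or.inr h
      · exact Or.inl (hpq ω h hω)
    have l1 := aux _ _ fun ω hω => (key ω hω).1
    have l2 := aux _ _ fun ω hω => (key ω hω).2
    constructor <;> linarith
  have h6 := h5.add h2
  rw [zero_add] at h6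
  refine h6.congr fun n => ?_
  have e : ((P'.map fun ω => √(n : ℝ) * ((mh n ω - a) / sh n ω)) (Set.Ioo (-z) z)).toReal =
      P'.real {ω | √(n : ℝ) * ((mh n ω - a) / sh n ω) ∈ Set.Ioo (-z) z} := by
    rw [Measure.map_apply_of_aemeasurable (hclt.forall_aemeasurable n) measurableSet_Ioo]
    rfl
  simp only [Function.comp_apply, e]
  ring

end Coverage

/-! ### Conditional moments and independence -/

section Conditional

variable {Ω α β : Type*} [MeasurableSpace Ω] [MeasurableSpace α] [MeasurableSpace β]
  {P : Measure Ω} [IsProbabilityMeasure P] {X : Ω → α} {U : Ω → β} {e : Ω → ℝ}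
  {Φ : β → α → ℝ} {K : ℝ} {H : α × ℝ → ℝ}

theorem measurable_integral_left (hU : Measurable U) (hΦ : Measurable (Function.uncurry Φ)) :
    Measurable fun x => ∫ u, Φ u x ∂(P.map U) := by
  have : IsProbabilityMeasure (P.map U) := Measure.isProbabilityMeasure_map hU.aemeasurable
  exact (hΦ.stronglyMeasurable.integral_prod_left' (μ := P.map U)).measurable

omit [MeasurableSpace α] in
theorem abs_integral_left_le (hU : Measurable U) (hK : ∀ u x, |Φ u x| ≤ K) (x : α) :
    |∫ u, Φ u x ∂(P.map U)| ≤ K := by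
  have : IsProbabilityMeasure (P.map U) := Measure.isProbabilityMeasure_map hU.aemeasurable
  have := norm_integral_le_of_norm_le_const (μ := P.map U)
    (Eventually.of_forall fun u => (Real.norm_eq_abs _).trans_le (hK u x))
  simpa using this

theorem integral_mul_condExp (hX : Measurable X) {φ : α → ℝ} (hφ : Measurable φ)
    (hK : ∀ x, |φ x| ≤ K) {h : Ω → ℝ} (hh : Integrable h P) :
    ∫ ω, φ (X ω) * h ω ∂P =
      ∫ ω, φ (X ω) * (P[h | MeasurableSpace.comap X inferInstance]) ω ∂P := by
  have hsm : StronglyMeasurable[MeasurableSpace.comap X inferInstance] fun ω => φ (X ω) :=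
    (hφ.comp (comap_measurable X)).stronglyMeasurable
  have hi : Integrable ((fun ω => φ (X ω)) * h) P :=
    hh.bdd_mul (c := K) (hφ.comp hX).aestronglyMeasurable
      (Eventually.of_forall fun ω => (Real.norm_eq_abs _).trans_le (hK _))
  rw [← integral_condExp (f := fun ω => φ (X ω) * h ω) hX.comap_le]
  exact integral_congr_ae (condExp_mul_of_stronglyMeasurable_left hsm hi hh)

/-- Independence and Fubini integrate `U` out first; what remains of `Φ` is a bounded function of
`X`, against which `H` may be replaced by its conditional expectation. -/
theorem integral_mul_eq_integral_mul_condExp (hX : Measurable X) (hU : Measurable U)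
    (he : Measurable e) (hind : IndepFun U (fun ω => (X ω, e ω)) P)
    (hΦ : Measurable (Function.uncurry Φ)) (hK : ∀ u x, |Φ u x| ≤ K) (hH : Measurable H)
    (hHi : Integrable (fun ω => H (X ω, e ω)) P) :
    ∫ ω, Φ (U ω) (X ω) * H (X ω, e ω) ∂P = ∫ ω, (∫ u, Φ u (X ω) ∂(P.map U)) *
      (P[fun ω => H (X ω, e ω) | MeasurableSpace.comap X inferInstance]) ω ∂P := by
  have : IsProbabilityMeasure (P.map U) := Measure.isProbabilityMeasure_map hU.aemeasurable
  have hXe : Measurable fun ω => (X ω, e ω) := hX.prodMk he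
  have : IsProbabilityMeasure (P.map fun ω => (X ω, e ω)) :=
    Measure.isProbabilityMeasure_map hXe.aemeasurable
  rw [← integral_mul_condExp hX (measurable_integral_left hU hΦ) (abs_integral_left_le hU hK) hHi]
  have hm : Measurable fun p : β × α × ℝ => Φ p.1 p.2.1 * H p.2 :=
    (hΦ.comp (measurable_fst.prodMk (measurable_fst.comp measurable_snd))).mul
      (hH.comp measurable_snd)
  have hmap := (indepFun_iff_map_prod_eq_prod_map_map hU.aemeasurable hXe.aemeasurable).1 hind
  have hHm : Integrable H (P.map fun ω => (X ω, e ω)) :=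
    (integrable_map_measure hH.aestronglyMeasurable hXe.aemeasurable).2 hHi
  have hi : Integrable (fun p : β × α × ℝ => Φ p.1 p.2.1 * H p.2)
      ((P.map U).prod (P.map fun ω => (X ω, e ω))) := by
    refine (hHm.comp_snd (P.map U)).bdd_mul (c := K)
      (hΦ.comp (measurable_fst.prodMk (measurable_fst.comp measurable_snd))).aestronglyMeasurable
      (Eventually.of_forall fun p => (Real.norm_eq_abs _).trans_le (hK _ _))
  calc ∫ ω, Φ (U ω) (X ω) * H (X ω, e ω) ∂P
      = ∫ p, Φ p.1 p.2.1 * H p.2 ∂(P.map fun ω => (U ω, X ω, e ω)) :=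
        (integral_map (hU.prodMk hXe).aemeasurable hm.aestronglyMeasurable).symm
    _ = ∫ y, ∫ u, Φ u y.1 * H y ∂(P.map U) ∂(P.map fun ω => (X ω, e ω)) := by
        rw [hmap, integral_prod_symm _ hi]
    _ = ∫ y, (∫ u, Φ u y.1 ∂(P.map U)) * H y ∂(P.map fun ω => (X ω, e ω)) := by
        simp only [integral_mul_const]
    _ = _ := integral_map hXe.aemeasurable
        (((measurable_integral_left hU hΦ).comp measurable_fst).mul hH).aestronglyMeasurable

theorem integral_eq_integral_integral (hX : Measurable X) (hU : Measurable U)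
    (he : Measurable e) (hind : IndepFun U (fun ω => (X ω, e ω)) P)
    (hΦ : Measurable (Function.uncurry Φ)) (hK : ∀ u x, |Φ u x| ≤ K) :
    ∫ ω, Φ (U ω) (X ω) ∂P = ∫ ω, (∫ u, Φ u (X ω) ∂(P.map U)) ∂P := by
  have h := integral_mul_eq_integral_mul_condExp hX hU he hind hΦ hK
    (H := fun _ => 1) measurable_const (integrable_const 1)
  rw [condExp_const hX.comap_le] at h
  simpa using h

theorem integral_mul_le_of_condExp_le (hX : Measurable X) (hU : Measurable U)
    (he : Measurable e) (hind : IndepFun U (fun ω => (X ω, e ω)) P)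
    (hΦ : Measurable (Function.uncurry Φ)) (h0 : ∀ u x, 0 ≤ Φ u x) (hK : ∀ u x, |Φ u x| ≤ K)
    (hH : Measurable H) (hHi : Integrable (fun ω => H (X ω, e ω)) P) {C : ℝ}
    (hC : ∀ᵐ ω ∂P,
      (P[fun ω => H (X ω, e ω) | MeasurableSpace.comap X inferInstance]) ω ≤ C) :
    ∫ ω, Φ (U ω) (X ω) * H (X ω, e ω) ∂P ≤ C * ∫ ω, Φ (U ω) (X ω) ∂P := by
  have hφ := (measurable_integral_left (P := P) hU hΦ).comp hX
  have hφK := abs_integral_left_le (P := P) hU hK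
  rw [integral_mul_eq_integral_mul_condExp hX hU he hind hΦ hK hH hHi,
    integral_eq_integral_integral hX hU he hind hΦ hK, ← integral_const_mul]
  refine integral_mono_ae ?_ ?_ ?_
  · exact integrable_condExp.bdd_mul (c := K) hφ.aestronglyMeasurable
      (Eventually.of_forall fun ω => (Real.norm_eq_abs _).trans_le (hφK _))
  · exact (Integrable.of_bound hφ.aestronglyMeasurable K
      (Eventually.of_forall fun ω => (Real.norm_eq_abs _).trans_le (hφK _))).const_mul C
  · filter_upwards [hC] with ω hω
    have : 0 ≤ ∫ u, Φ u (X ω) ∂(P.map U) := integral_nonneg fun u => h0 u _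
    calc _ ≤ (∫ u, Φ u (X ω) ∂(P.map U)) * C := mul_le_mul_of_nonneg_left hω this
      _ = _ := mul_comm _ _

theorem le_integral_mul_of_le_condExp (hX : Measurable X) (hU : Measurable U)
    (he : Measurable e) (hind : IndepFun U (fun ω => (X ω, e ω)) P)
    (hΦ : Measurable (Function.uncurry Φ)) (h0 : ∀ u x, 0 ≤ Φ u x) (hK : ∀ u x, |Φ u x| ≤ K)
    (hH : Measurable H) (hHi : Integrable (fun ω => H (X ω, e ω)) P) {c : ℝ}
    (hc : ∀ᵐ ω ∂P,
      c ≤ (P[fun ω => H (X ω, e ω) | MeasurableSpace.comap X inferInstance]) ω) :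
    c * ∫ ω, Φ (U ω) (X ω) ∂P ≤ ∫ ω, Φ (U ω) (X ω) * H (X ω, e ω) ∂P := by
  have h := integral_mul_le_of_condExp_le hX hU he hind hΦ h0 hK (H := fun p => -H p) hH.neg
    hHi.neg (C := -c) (by
      have h1 := condExp_neg (μ := P) (fun ω => H (X ω, e ω))
        (MeasurableSpace.comap X inferInstance)
      filter_upwards [hc, h1] with ω hω hω1
      have h2 : (-(fun ω => H (X ω, e ω))) = fun ω => -H (X ω, e ω) := rfl
      rw [← h2, hω1, Pi.neg_apply]
      linarith)
  simp only [mul_neg, integral_neg] at h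
  linarith

end Conditional

/-! ### The deconvolution kernel -/

section Kernel

variable {d : ℕ} {B : HarmFamily d}

theorem continuous_rot : Continuous fun p : SO d × Sph d => rot p.1 p.2 := by
  refine Continuous.subtype_mk ?_ _
  refine (PiLp.continuous_toLp 2 _).comp ?_
  exact (continuous_subtype_val.comp continuous_fst).matrix_mulVec
    ((PiLp.continuous_ofLp 2 _).comp (continuous_subtype_val.comp continuous_snd))

theorem measurable_rot : Measurable fun p : SO d × Sph d => rot p.1 p.2 :=
  continuous_rot.measurable

/-- A rotated harmonic has the same degree, and its coefficients in the basis are the conjugates of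
`rotCoeff`. -/
theorem IsHarmONB.conj_rot (hB : IsHarmONB B) (l : ℕ) (q : Fin (N d l)) (u : SO d) (x : Sph d) :
    conj (B l q (rot u x)) = ∑ r, rotCoeff B l q r u * conj (B l r x) := by
  have h1 : (fun x => B l q (rot u x)) ∈ sphHarm d l :=
    comp_mem_sphHarm (hB.mem l q) (SO.mul_transpose u) fun x i => rfl
  have h2 := congrArg (starRingEnd ℂ) (hB.expand h1 x)
  rw [map_sum] at h2
  rw [h2]
  refine Finset.sum_congr rfl fun r _ => ?_
  rw [map_mul, ← integral_conj]
  congr 1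
  refine integral_congr_ae (Eventually.of_forall fun y => ?_)
  simp

/-- Used for continuity of integrals depending on a rotation. -/
instance : FirstCountableTopology (SO d) :=
  have : FirstCountableTopology (Matrix (Fin (d + 1)) (Fin (d + 1)) ℝ) :=
    inferInstanceAs (FirstCountableTopology (Fin (d + 1) → Fin (d + 1) → ℝ))
  Topology.IsInducing.subtypeVal.firstCountableTopology

theorem IsHarmONB.continuous_rotCoeff (hB : IsHarmONB B) (l : ℕ) (q r : Fin (N d l)) :
    Continuous (rotCoeff B l q r) := by
  have hf : Continuous (Function.uncurry fun (u : SO d) (x : Sph d) =>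
      conj (B l q (rot u x)) * B l r x) :=
    (Complex.continuous_conj.comp ((hB.continuous l q).comp continuous_rot)).mul
      ((hB.continuous l r).comp continuous_snd)
  have := continuous_parametric_integral_of_continuous (μ := surf d) hf
    (isCompact_univ (X := Sph d))
  simp only [setIntegral_univ] at this
  exact this

theorem continuous_kernel (hB : IsHarmONB B) (fU : SO d → ℝ) (T : ℝ) (x : Sph d) :
    Continuous (kernel B fU T x) := by
  refine continuous_finsetSum _ fun l _ => continuous_finsetSum _ fun q _ =>
    (continuous_finsetSum _ fun r _ => ?_).mul continuous_const
  exact continuous_const.mul (Complex.continuous_conj.comp (hB.continuous l r))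

theorem norm_matrix_form_le {n : ℕ} (A : Matrix (Fin n) (Fin n) ℂ) (a b : Fin n → ℂ) :
    ‖∑ q, (∑ r, A q r * a r) * b q‖ ≤ opNorm A * √(∑ r, ‖a r‖ ^ 2) * √(∑ q, ‖b q‖ ^ 2) := by
  refine (norm_sum_mul_le Finset.univ (fun q => ∑ r, A q r * a r) b).trans ?_
  gcongr
  have h := (Matrix.toEuclideanCLM (𝕜 := ℂ) A).le_opNorm (WithLp.toLp 2 a)
  rw [Matrix.toEuclideanCLM_toLp, EuclideanSpace.norm_eq, EuclideanSpace.norm_eq] at h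
  exact h

/-- In degree `l` the form is at most the operator norm, of order `l^β`, times `N(d,l) / area`, of
order `l^(d-1)`; summing `⌊T⌋ + 1` degrees gives the exponent `β + d`. -/
theorem norm_kernel_le (hB : IsHarmONB B) (hd : 1 ≤ d) {fU : SO d → ℝ} {β : ℝ} (hβ : 0 ≤ β)
    {c₁ : ℝ} (hc₁ : 0 < c₁)
    (hS1 : ∀ l : ℕ, 1 ≤ l → opNorm (rotFourier B fU l)⁻¹ ≤ c₁ * (l : ℝ) ^ β) (T : ℝ)
    (x z : Sph d) : ‖kernel B fU T x z‖ ≤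
      2 * (opNorm (rotFourier B fU 0)⁻¹ + c₁) / area d * ((⌊T⌋₊ : ℝ) + 1) ^ (β + d) := by
  have ho : 0 ≤ opNorm (rotFourier B fU 0)⁻¹ := norm_nonneg _
  have ha := area_pos d
  -- Shifting to `l + 1` and adding the degree-zero norm makes one bound valid in every degree.
  have hop : ∀ l : ℕ, opNorm (rotFourier B fU l)⁻¹ ≤
      (opNorm (rotFourier B fU 0)⁻¹ + c₁) * ((l : ℝ) + 1) ^ β := fun l => by
    rcases Nat.eq_zero_or_pos l with rfl | hl
    · simp
      linarith
    · refine (hS1 l hl).trans ?_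
      gcongr
      · linarith
      · linarith
  have hterm : ∀ l ∈ Finset.range (⌊T⌋₊ + 1), ‖∑ q, (∑ r, (rotFourier B fU l)⁻¹ q r *
      conj (B l r z)) * B l q x‖ ≤ (opNorm (rotFourier B fU 0)⁻¹ + c₁) * ((⌊T⌋₊ : ℝ) + 1) ^ β *
        (2 * ((⌊T⌋₊ : ℝ) + 1) ^ (d - 1) / area d) := fun l hl => by
    have hl' : (l : ℝ) ≤ ⌊T⌋₊ := by
      exact_mod_cast Nat.lt_succ_iff.1 (Finset.mem_range.1 hl)
    refine (norm_matrix_form_le _ _ _).trans ?_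
    have e1 : ∑ r, ‖conj (B l r z)‖ ^ 2 = N d l / area d := by
      rw [← hB.sqSum_eq l z]
      simp [sqSum]
    have e2 : ∑ q, ‖B l q x‖ ^ 2 = N d l / area d := hB.sqSum_eq l x
    rw [e1, e2, mul_assoc, Real.mul_self_sqrt (by positivity)]
    have hN : (N d l : ℝ) ≤ 2 * ((l : ℝ) + 1) ^ (d - 1) := by exact_mod_cast N_le hd l
    refine mul_le_mul ((hop l).trans ?_) ?_ (by positivity) (by positivity)
    · gcongr
    · gcongr
      refine hN.trans ?_
      gcongr
  refine (norm_sum_le _ _).trans ((Finset.sum_le_sum hterm).trans (le_of_eq ?_))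
  rw [Finset.sum_const, Finset.card_range, nsmul_eq_mul]
  have hp : (0 : ℝ) < (⌊T⌋₊ : ℝ) + 1 := by positivity
  obtain ⟨e, rfl⟩ := Nat.exists_eq_add_of_le' hd
  rw [Real.rpow_add hp, Real.rpow_natCast]
  push_cast
  ring

variable {Ω : Type*} [MeasurableSpace Ω] {P : Measure Ω} [IsProbabilityMeasure P]
  {X : Ω → Sph d} {U : Ω → SO d} {Z : Ω → Sph d} {fU : SO d → ℝ}

omit [IsProbabilityMeasure P] in
theorem integral_rotCoeff (hU : Measurable U) (hfU0 : ∀ u, 0 ≤ fU u)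
    (hfUm : AEMeasurable fU (haarSO d))
    (hfU : P.map U = (haarSO d).withDensity fun u => ENNReal.ofReal (fU u)) (hB : IsHarmONB B)
    (l : ℕ) (q r : Fin (N d l)) :
    ∫ ω, rotCoeff B l q r (U ω) ∂P = rotFourier B fU l q r := by
  rw [← integral_map (f := rotCoeff B l q r) hU.aemeasurable
    (hB.continuous_rotCoeff l q r).aestronglyMeasurable, hfU,
    integral_withDensity_eq_integral_toReal_smul₀ hfUm.ennreal_ofReal
    (Eventually.of_forall fun _ => ENNReal.ofReal_lt_top)]
  simp [rotFourier, ENNReal.toReal_ofReal (hfU0 _)]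

omit [IsProbabilityMeasure P] in
-- The convolution theorem: expanding the rotated harmonic separates `U` from `(X, ε)`, and
-- independence turns the rotation into multiplication by the matrix `rotFourier`.
theorem integral_conj_mul (hX : Measurable X) (hU : Measurable U) {ε : Ω → ℝ}
    (hind : IndepFun U (fun ω => (X ω, ε ω)) P) (hZ : ∀ ω, Z ω = rot (U ω) (X ω))
    (hfU0 : ∀ u, 0 ≤ fU u) (hfUm : AEMeasurable fU (haarSO d))
    (hfU : P.map U = (haarSO d).withDensity fun u => ENNReal.ofReal (fU u)) (hB : IsHarmONB B)
    {G : Sph d × ℝ → ℝ} (hG : Measurable G) (hGi : Integrable (fun ω => G (X ω, ε ω)) P) (l : ℕ)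
    (q : Fin (N d l)) :
    ∫ ω, conj (B l q (Z ω)) * (G (X ω, ε ω) : ℂ) ∂P =
      ∑ r, rotFourier B fU l q r * ∫ ω, conj (B l r (X ω)) * (G (X ω, ε ω) : ℂ) ∂P := by
  have hDm : ∀ r, Measurable (rotCoeff B l q r) := fun r => (hB.continuous_rotCoeff l q r).measurable
  have hBm : ∀ r, Measurable fun x => conj (B l r x) := fun r =>
    (Complex.continuous_conj.comp (hB.continuous l r)).measurable
  have hBi : ∀ r, Integrable (fun ω => conj (B l r (X ω)) * (G (X ω, ε ω) : ℂ)) P := fun r => by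
    obtain ⟨K, hK⟩ := (isCompact_univ (X := Sph d)).exists_bound_of_continuousOn
      (Complex.continuous_conj.comp (hB.continuous l r)).continuousOn
    exact hGi.ofReal.bdd_mul (c := K) ((hBm r).comp hX).aestronglyMeasurable
      (Eventually.of_forall fun ω => hK _ trivial)
  have hi : ∀ r, Integrable (fun ω => rotCoeff B l q r (U ω) *
      (conj (B l r (X ω)) * (G (X ω, ε ω) : ℂ))) P := fun r => by
    obtain ⟨K, hK⟩ := (isCompact_univ (X := SO d)).exists_bound_of_continuousOn
      (hB.continuous_rotCoeff l q r).continuousOn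
    exact (hBi r).bdd_mul (c := K) ((hDm r).comp hU).aestronglyMeasurable
      (Eventually.of_forall fun ω => hK _ trivial)
  simp only [hZ, hB.conj_rot, Finset.sum_mul, mul_assoc]
  rw [integral_finsetSum _ fun r _ => hi r]
  refine Finset.sum_congr rfl fun r _ => ?_
  have hi2 : IndepFun (fun ω => rotCoeff B l q r (U ω))
      (fun ω => conj (B l r (X ω)) * (G (X ω, ε ω) : ℂ)) P :=
    hind.comp (φ := rotCoeff B l q r) (ψ := fun p => conj (B l r p.1) * (G p : ℂ)) (hDm r)
      (((hBm r).comp measurable_fst).mul (Complex.measurable_ofReal.comp hG))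
  rw [hi2.integral_fun_mul_eq_mul_integral ((hDm r).comp hU).aestronglyMeasurable
    (hBi r).aestronglyMeasurable, integral_rotCoeff hU hfU0 hfUm hfU hB]

omit [IsProbabilityMeasure P] in
/-- The deconvolution kernel removes the effect of the random rotation. -/
theorem integral_kernel_mul (hX : Measurable X) (hU : Measurable U) {ε : Ω → ℝ}
    (hind : IndepFun U (fun ω => (X ω, ε ω)) P) (hZ : ∀ ω, Z ω = rot (U ω) (X ω))
    (hfU0 : ∀ u, 0 ≤ fU u) (hfUm : AEMeasurable fU (haarSO d))
    (hfU : P.map U = (haarSO d).withDensity fun u => ENNReal.ofReal (fU u)) (hB : IsHarmONB B)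
    (hinv : ∀ l, IsUnit (rotFourier B fU l))
    {G : Sph d × ℝ → ℝ} (hG : Measurable G) (hGi : Integrable (fun ω => G (X ω, ε ω)) P)
    {g : Sph d → ℝ}
    (hg : ∀ l q, ∫ ω, conj (B l q (X ω)) * (G (X ω, ε ω) : ℂ) ∂P = fourierCoeff B g l q)
    (T : ℝ) (x : Sph d) :
    ∫ ω, kernel B fU T x (Z ω) * (G (X ω, ε ω) : ℂ) ∂P =
      ∑ l ∈ Finset.range (⌊T⌋₊ + 1), fourierLaplaceTerm B g l x := by
  have hZm : Measurable Z := by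
    have : Z = fun ω => rot (U ω) (X ω) := funext hZ
    rw [this]
    exact measurable_rot.comp (hU.prodMk hX)
  have hBi : ∀ l r, Integrable (fun ω => conj (B l r (Z ω)) * (G (X ω, ε ω) : ℂ)) P :=
      fun l r => by
    obtain ⟨K, hK⟩ := (isCompact_univ (X := Sph d)).exists_bound_of_continuousOn
      (Complex.continuous_conj.comp (hB.continuous l r)).continuousOn
    exact hGi.ofReal.bdd_mul (c := K)
      ((Complex.continuous_conj.comp (hB.continuous l r)).measurable.comp hZm).aestronglyMeasurable
      (Eventually.of_forall fun ω => hK _ trivial)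
  have hi1 : ∀ l q r, Integrable (fun ω => (rotFourier B fU l)⁻¹ q r * B l q x *
      (conj (B l r (Z ω)) * (G (X ω, ε ω) : ℂ))) P := fun l q r => (hBi l r).const_mul _
  have e : ∀ ω, kernel B fU T x (Z ω) * (G (X ω, ε ω) : ℂ) = ∑ l ∈ Finset.range (⌊T⌋₊ + 1), ∑ q,
      ∑ r, (rotFourier B fU l)⁻¹ q r * B l q x * (conj (B l r (Z ω)) * (G (X ω, ε ω) : ℂ)) :=
      fun ω => by
    simp only [kernel, Finset.sum_mul]
    refine Finset.sum_congr rfl fun l _ => Finset.sum_congr rfl fun q _ =>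
      Finset.sum_congr rfl fun r _ => ?_
    ring
  simp only [e]
  rw [integral_finsetSum _ fun l _ => integrable_finsetSum _ fun q _ =>
    integrable_finsetSum _ fun r _ => hi1 l q r]
  refine Finset.sum_congr rfl fun l _ => ?_
  rw [integral_finsetSum _ fun q _ => integrable_finsetSum _ fun r _ => hi1 l q r]
  refine Finset.sum_congr rfl fun q _ => ?_
  rw [integral_finsetSum _ fun r _ => hi1 l q r]
  -- Deconvolution: the inverse matrix in the kernel cancels the one produced by the rotation.
  have h1 : (rotFourier B fU l)⁻¹.mulVec ((rotFourier B fU l).mulVec fun s =>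
      fourierCoeff B g l s) = fun s => fourierCoeff B g l s := by
    rw [Matrix.mulVec_mulVec, Matrix.nonsing_inv_mul _
      ((Matrix.isUnit_iff_isUnit_det _).1 (hinv l)), Matrix.one_mulVec]
  have h2 := congrFun h1 q
  rw [← h2]
  simp only [integral_const_mul, integral_conj_mul hX hU hind hZ hfU0 hfUm hfU hB hG hGi, hg,
    Matrix.mulVec, dotProduct, Finset.sum_mul]
  exact Finset.sum_congr rfl fun r _ => by ring

end Kernel

/-! ### The errors-in-variables model -/

section Model

variable {d : ℕ} {B : HarmFamily d} {Ω : Type*} [MeasurableSpace Ω] {P : Measure Ω}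

/-- A random point `X` of the sphere with density `fX`, a random rotation `U` with density `fU`,
and an error `ε` with conditional mean zero, such that `U` is independent of `(X, ε)`. -/
structure DeconvModel (P : Measure Ω) (X : Ω → Sph d) (U : Ω → SO d) (ε : Ω → ℝ) (fX : Sph d → ℝ)
    (fU : SO d → ℝ) : Prop where
  measurable_fst : Measurable X
  measurable_rot : Measurable U
  measurable_error : Measurable ε
  indep : IndepFun U (fun ω => (X ω, ε ω)) P
  integrable_error : Integrable ε P
  condExp_error : P[ε | MeasurableSpace.comap X inferInstance] =ᵐ[P] 0
  continuous_density : Continuous fX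
  density_nonneg : ∀ x, 0 ≤ fX x
  map_fst : P.map X = (surf d).withDensity fun x => ENNReal.ofReal (fX x)
  rotDensity_nonneg : ∀ u, 0 ≤ fU u
  aemeasurable_rotDensity : AEMeasurable fU (haarSO d)
  map_rot : P.map U = (haarSO d).withDensity fun u => ENNReal.ofReal (fU u)

theorem exists_bound_of_continuous {E F : Type*} [TopologicalSpace E] [CompactSpace E]
    [SeminormedAddCommGroup F] {g : E → F} (hg : Continuous g) : ∃ K, ∀ x, ‖g x‖ ≤ K := by
  obtain ⟨K, hK⟩ := (isCompact_univ (X := E)).exists_bound_of_continuousOn hg.continuousOn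
  exact ⟨K, fun x => hK x trivial⟩

namespace DeconvModel

variable {X : Ω → Sph d} {U : Ω → SO d} {ε : Ω → ℝ} {fX : Sph d → ℝ} {fU : SO d → ℝ}
  (h : DeconvModel P X U ε fX fU)
include h

theorem measurable_obs : Measurable fun ω => rot (U ω) (X ω) :=
  SphereDeconv.measurable_rot.comp (h.measurable_rot.prodMk h.measurable_fst)

theorem integral_conj_mul_comp (hB : IsHarmONB B) {p : Sph d → ℝ} (hp : Continuous p) (l : ℕ)
    (q : Fin (N d l)) : ∫ ω, conj (B l q (X ω)) * (p (X ω) : ℂ) ∂P =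
      fourierCoeff B (fun x => p x * fX x) l q := by
  have hc : Continuous fun x => conj (B l q x) * (p x : ℂ) :=
    (Complex.continuous_conj.comp (hB.continuous l q)).mul (Complex.continuous_ofReal.comp hp)
  rw [← integral_map (f := fun x => conj (B l q x) * (p x : ℂ)) h.measurable_fst.aemeasurable
    hc.aestronglyMeasurable, h.map_fst, integral_withDensity_eq_integral_toReal_smul₀
    h.continuous_density.measurable.ennreal_ofReal.aemeasurable
    (Eventually.of_forall fun _ => ENNReal.ofReal_lt_top)]
  refine integral_congr_ae (Eventually.of_forall fun x => ?_)
  simp only [ENNReal.toReal_ofReal (h.density_nonneg x), Complex.real_smul]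
  push_cast
  ring

variable [IsProbabilityMeasure P]

theorem integral_mul_error {g : Sph d → ℝ} (hg : Continuous g) :
    ∫ ω, g (X ω) * ε ω ∂P = 0 := by
  obtain ⟨K, hK⟩ := exists_bound_of_continuous hg
  rw [integral_mul_condExp h.measurable_fst hg.measurable hK h.integrable_error]
  refine integral_eq_zero_of_ae ?_
  filter_upwards [h.condExp_error] with ω hω
  simp [hω]

theorem integral_complex_mul_error {g : Sph d → ℂ} (hg : Continuous g) :
    ∫ ω, g (X ω) * (ε ω : ℂ) ∂P = 0 := by
  obtain ⟨K, hK⟩ := exists_bound_of_continuous hg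
  have hi : Integrable (fun ω => g (X ω) * (ε ω : ℂ)) P :=
    h.integrable_error.ofReal.bdd_mul (c := K)
      (hg.measurable.comp h.measurable_fst).aestronglyMeasurable
      (Eventually.of_forall fun ω => hK _)
  refine Complex.ext ?_ ?_
  · have := Complex.reCLM.integral_comp_comm hi
    simp only [Complex.reCLM_apply] at this
    rw [← this, Complex.zero_re, ← h.integral_mul_error (Complex.continuous_re.comp hg)]
    simp
  · have := Complex.imCLM.integral_comp_comm hi
    simp only [Complex.imCLM_apply] at this
    rw [← this, Complex.zero_im, ← h.integral_mul_error (Complex.continuous_im.comp hg)]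
    simp

theorem integral_kernel (hB : IsHarmONB B) (hinv : ∀ l, IsUnit (rotFourier B fU l)) (T : ℝ)
    (x : Sph d) : ∫ ω, kernel B fU T x (rot (U ω) (X ω)) ∂P =
      ∑ l ∈ Finset.range (⌊T⌋₊ + 1), fourierLaplaceTerm B fX l x := by
  have := integral_kernel_mul h.measurable_fst h.measurable_rot h.indep (fun _ => rfl)
    h.rotDensity_nonneg h.aemeasurable_rotDensity h.map_rot hB hinv (G := fun _ => 1)
    measurable_const (integrable_const 1) (g := fX) (fun l q => by
      simpa using h.integral_conj_mul_comp hB continuous_const (p := fun _ => 1) l q) T x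
  simpa using this

theorem integrable_comp {g : Sph d → ℝ} (hg : Continuous g) : Integrable (fun ω => g (X ω)) P := by
  obtain ⟨K, hK⟩ := exists_bound_of_continuous hg
  exact Integrable.of_bound (hg.measurable.comp h.measurable_fst).aestronglyMeasurable K
    (Eventually.of_forall fun ω => hK _)

/-- Deconvolution with `G = m(X) + ε`; the error contributes nothing to the coefficients because its
conditional mean given `X` is zero. -/
theorem integral_kernel_mul_response (hB : IsHarmONB B)
    (hinv : ∀ l, IsUnit (rotFourier B fU l)) {m : Sph d → ℝ} (hm : Continuous m) (T : ℝ)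
    (x : Sph d) :
    ∫ ω, kernel B fU T x (rot (U ω) (X ω)) * ((m (X ω) + ε ω : ℝ) : ℂ) ∂P =
      ∑ l ∈ Finset.range (⌊T⌋₊ + 1), fourierLaplaceTerm B (fun x => m x * fX x) l x := by
  refine integral_kernel_mul h.measurable_fst h.measurable_rot h.indep (fun _ => rfl)
    h.rotDensity_nonneg h.aemeasurable_rotDensity h.map_rot hB hinv (G := fun p => m p.1 + p.2)
    ((hm.measurable.comp _root_.measurable_fst).add _root_.measurable_snd)
    ((h.integrable_comp hm).add h.integrable_error) (fun l q => ?_) T x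
  have hc : Continuous fun x => conj (B l q x) := Complex.continuous_conj.comp (hB.continuous l q)
  obtain ⟨K, hK⟩ := exists_bound_of_continuous hc
  have hK' := Eventually.of_forall (f := ae P) fun ω => hK (X ω)
  have hcm := (hc.measurable.comp h.measurable_fst).aestronglyMeasurable (μ := P)
  have i1 : Integrable (fun ω => conj (B l q (X ω)) * (m (X ω) : ℂ)) P :=
    (h.integrable_comp hm).ofReal.bdd_mul (c := K) hcm hK'
  have i2 : Integrable (fun ω => conj (B l q (X ω)) * (ε ω : ℂ)) P :=
    h.integrable_error.ofReal.bdd_mul (c := K) hcm hK'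
  simp only [Complex.ofReal_add, mul_add]
  rw [integral_add i1 i2, h.integral_conj_mul_comp hB hm, h.integral_complex_mul_error hc, add_zero]

end DeconvModel

theorem rpow_le_one_add_rpow {t p q : ℝ} (ht : 0 ≤ t) (hp : 0 ≤ p) (hpq : p ≤ q) :
    t ^ p ≤ 1 + t ^ q := by
  have h0 : 0 ≤ t ^ q := by positivity
  rcases le_or_gt t 1 with h1 | h1
  · have := Real.rpow_le_one ht h1 hp
    linarith
  · have := Real.rpow_le_rpow_of_exponent_le h1.le hpq
    linarith

theorem abs_sub_rpow_le {q : ℝ} (hq : 0 ≤ q) (y a : ℝ) :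
    |y - a| ^ q ≤ 2 ^ q * (|y| ^ q + |a| ^ q) := by
  have h1 : |y - a| ≤ 2 * max |y| |a| :=
    (abs_sub _ _).trans (by linarith [le_max_left |y| |a|, le_max_right |y| |a|])
  have h2 : (max |y| |a|) ^ q ≤ |y| ^ q + |a| ^ q := by
    have : 0 ≤ |y| ^ q := by positivity
    have : 0 ≤ |a| ^ q := by positivity
    rcases max_choice |y| |a| with h | h <;> rw [h] <;> linarith
  calc |y - a| ^ q ≤ (2 * max |y| |a|) ^ q := by gcongr
    _ = 2 ^ q * (max |y| |a|) ^ q := Real.mul_rpow (by norm_num) (by positivity)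
    _ ≤ _ := by gcongr

namespace DeconvModel

variable [IsProbabilityMeasure P]
  {X : Ω → Sph d} {U : Ω → SO d} {ε : Ω → ℝ} {fX : Sph d → ℝ} {fU : SO d → ℝ}
  (h : DeconvModel P X U ε fX fU) {w : Sph d → ℝ} (hw : Continuous w) {m : Sph d → ℝ}
  (hm : Continuous m)
include h hw hm

/-- Weighted moments of the response are controlled by its conditional moments. -/
theorem integral_sq_mul_rpow_le {p q C : ℝ} (hp : 0 ≤ p) (hpq : p ≤ q)
    (hi : Integrable (fun ω => |m (X ω) + ε ω| ^ q) P)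
    (hC : ∀ᵐ ω ∂P, (P[fun ω => |m (X ω) + ε ω| ^ q |
      MeasurableSpace.comap X inferInstance]) ω ≤ C) (a : ℝ) :
    ∫ ω, w (rot (U ω) (X ω)) ^ 2 * |m (X ω) + ε ω - a| ^ p ∂P ≤
      (1 + 2 ^ q * (C + |a| ^ q)) * ∫ ω, w (rot (U ω) (X ω)) ^ 2 ∂P := by
  have hw2 : Continuous fun p : SO d × Sph d => w (rot p.1 p.2) ^ 2 :=
    (hw.comp continuous_rot).pow 2
  obtain ⟨K, hK⟩ := exists_bound_of_continuous hw2
  have hΦ : Measurable (Function.uncurry fun (u : SO d) (x : Sph d) => w (rot u x) ^ 2) :=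
    hw2.measurable
  have hH : Measurable fun p : Sph d × ℝ => |m p.1 + p.2| ^ q :=
    (((hm.measurable.comp _root_.measurable_fst).add _root_.measurable_snd).abs).pow_const q
  have h1 := integral_mul_le_of_condExp_le h.measurable_fst h.measurable_rot h.measurable_error
    h.indep hΦ (fun u x => sq_nonneg _) (fun u x => hK (u, x)) hH hi hC
  have hwm : AEStronglyMeasurable (fun ω => w (rot (U ω) (X ω)) ^ 2) P :=
    ((hw.measurable.comp h.measurable_obs).pow_const 2).aestronglyMeasurable
  have i0 : Integrable (fun ω => w (rot (U ω) (X ω)) ^ 2) P :=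
    Integrable.of_bound hwm K (Eventually.of_forall fun ω => hK (U ω, X ω))
  have i1 : Integrable (fun ω => w (rot (U ω) (X ω)) ^ 2 * |m (X ω) + ε ω| ^ q) P :=
    hi.bdd_mul (c := K) hwm (Eventually.of_forall fun ω => hK (U ω, X ω))
  have hq : 0 ≤ q := hp.trans hpq
  calc ∫ ω, w (rot (U ω) (X ω)) ^ 2 * |m (X ω) + ε ω - a| ^ p ∂P
      ≤ ∫ ω, ((1 + 2 ^ q * |a| ^ q) * w (rot (U ω) (X ω)) ^ 2 +
          2 ^ q * (w (rot (U ω) (X ω)) ^ 2 * |m (X ω) + ε ω| ^ q)) ∂P := by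
        refine integral_mono_of_nonneg (Eventually.of_forall fun ω => by positivity)
          ((i0.const_mul _).add (i1.const_mul _)) (Eventually.of_forall fun ω => ?_)
        -- `|y - a|^p ≤ 1 + |y - a|^q ≤ 1 + 2^q (|y|^q + |a|^q)`, whence the constant in the
        -- statement.
        have e1 := (rpow_le_one_add_rpow (abs_nonneg (m (X ω) + ε ω - a)) hp hpq).trans
          (add_le_add_right (abs_sub_rpow_le hq (m (X ω) + ε ω) a) 1)
        exact (mul_le_mul_of_nonneg_left e1 (sq_nonneg _)).trans (le_of_eq (by ring))
    _ = (1 + 2 ^ q * |a| ^ q) * ∫ ω, w (rot (U ω) (X ω)) ^ 2 ∂P +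
          2 ^ q * ∫ ω, w (rot (U ω) (X ω)) ^ 2 * |m (X ω) + ε ω| ^ q ∂P := by
        rw [integral_add (i0.const_mul _) (i1.const_mul _), integral_const_mul,
          integral_const_mul]
    _ ≤ (1 + 2 ^ q * |a| ^ q) * ∫ ω, w (rot (U ω) (X ω)) ^ 2 ∂P +
          2 ^ q * (C * ∫ ω, w (rot (U ω) (X ω)) ^ 2 ∂P) := by gcongr
    _ = _ := by ring

/-- Expanding `((m - a) + ε)²`, the cross term has mean zero and the term `(m - a)²` is nonnegative,
so the conditional variance of the error alone gives the bound. -/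
theorem le_integral_sq_mul_sq (hi : Integrable (fun ω => ε ω ^ 2) P) {c : ℝ}
    (hc : ∀ᵐ ω ∂P, c ≤ (P[fun ω => ε ω ^ 2 | MeasurableSpace.comap X inferInstance]) ω) (a : ℝ) :
    c * ∫ ω, w (rot (U ω) (X ω)) ^ 2 ∂P ≤
      ∫ ω, (w (rot (U ω) (X ω)) * (m (X ω) + ε ω - a)) ^ 2 ∂P := by
  have hw2 : Continuous fun p : SO d × Sph d => w (rot p.1 p.2) ^ 2 :=
    (hw.comp continuous_rot).pow 2
  have hw3 : Continuous fun p : SO d × Sph d => w (rot p.1 p.2) ^ 2 * (m p.2 - a) :=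
    hw2.mul ((hm.comp continuous_snd).sub continuous_const)
  have hw4 : Continuous fun p : SO d × Sph d => w (rot p.1 p.2) ^ 2 * (m p.2 - a) ^ 2 :=
    hw2.mul (((hm.comp continuous_snd).sub continuous_const).pow 2)
  obtain ⟨K, hK⟩ := exists_bound_of_continuous hw2
  obtain ⟨K', hK'⟩ := exists_bound_of_continuous hw3
  obtain ⟨K'', hK''⟩ := exists_bound_of_continuous hw4
  have hUX := h.measurable_rot.prodMk h.measurable_fst
  have h1 := le_integral_mul_of_le_condExp h.measurable_fst h.measurable_rot h.measurable_error
    h.indep (Φ := fun u x => w (rot u x) ^ 2) hw2.measurable (fun u x => sq_nonneg _)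
    (fun u x => hK (u, x)) (H := fun p => p.2 ^ 2) (_root_.measurable_snd.pow_const 2) hi hc
  have h2 : ∫ ω, w (rot (U ω) (X ω)) ^ 2 * (m (X ω) - a) * ε ω ∂P = 0 := by
    have := integral_mul_eq_integral_mul_condExp h.measurable_fst h.measurable_rot
      h.measurable_error h.indep (Φ := fun u x => w (rot u x) ^ 2 * (m x - a)) hw3.measurable
      (fun u x => hK' (u, x)) (H := fun p => p.2) _root_.measurable_snd h.integrable_error
    rw [this]
    refine integral_eq_zero_of_ae ?_
    filter_upwards [h.condExp_error] with ω hω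
    simp [hω]
  have i1 : Integrable (fun ω => w (rot (U ω) (X ω)) ^ 2 * (m (X ω) - a) ^ 2) P :=
    Integrable.of_bound (hw4.measurable.comp hUX).aestronglyMeasurable K''
      (Eventually.of_forall fun ω => hK'' (U ω, X ω))
  have i2 : Integrable (fun ω => w (rot (U ω) (X ω)) ^ 2 * (m (X ω) - a) * ε ω) P :=
    h.integrable_error.bdd_mul (c := K') (hw3.measurable.comp hUX).aestronglyMeasurable
      (Eventually.of_forall fun ω => hK' (U ω, X ω))
  have i3 : Integrable (fun ω => w (rot (U ω) (X ω)) ^ 2 * ε ω ^ 2) P :=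
    hi.bdd_mul (c := K) (hw2.measurable.comp hUX).aestronglyMeasurable
      (Eventually.of_forall fun ω => hK (U ω, X ω))
  have e : ∫ ω, (w (rot (U ω) (X ω)) * (m (X ω) + ε ω - a)) ^ 2 ∂P =
      ∫ ω, w (rot (U ω) (X ω)) ^ 2 * (m (X ω) - a) ^ 2 ∂P +
        2 * ∫ ω, w (rot (U ω) (X ω)) ^ 2 * (m (X ω) - a) * ε ω ∂P +
        ∫ ω, w (rot (U ω) (X ω)) ^ 2 * ε ω ^ 2 ∂P := by
    have j : Integrable (fun ω => w (rot (U ω) (X ω)) ^ 2 * (m (X ω) - a) ^ 2 +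
      2 * (w (rot (U ω) (X ω)) ^ 2 * (m (X ω) - a) * ε ω)) P := i1.add (i2.const_mul 2)
    rw [← integral_const_mul, ← integral_add i1 (i2.const_mul 2), ← integral_add j i3]
    refine integral_congr_ae (Eventually.of_forall fun ω => ?_)
    simp only
    ring
  have h3 : 0 ≤ ∫ ω, w (rot (U ω) (X ω)) ^ 2 * (m (X ω) - a) ^ 2 ∂P :=
    integral_nonneg fun ω => by positivity
  rw [e, h2]
  linarith

end DeconvModel

end Model

/-! ### Rates of the truncation level -/

section Rates

theorem tendsto_const_mul_rpow_div {K e : ℝ} (he : e < 1) :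
    Tendsto (fun n : ℕ => K * ((n : ℝ) ^ e / n)) atTop (𝓝 0) := by
  have h1 := (tendsto_rpow_neg_atTop (show 0 < 1 - e by linarith)).comp
    (tendsto_natCast_atTop_atTop (R := ℝ))
  have h2 := h1.const_mul K
  rw [mul_zero] at h2
  refine h2.congr' ?_
  filter_upwards [eventually_ge_atTop 1] with n hn
  have hn0 : (0 : ℝ) < n := by positivity
  rw [Function.comp_apply, show -(1 - e) = e - 1 by ring, Real.rpow_sub_one hn0.ne']

variable {T : ℕ → ℝ} {γ c C : ℝ} (hc : 0 < c)
  (hT : ∀ n : ℕ, 1 ≤ n → c * (n : ℝ) ^ γ ≤ T n ∧ T n ≤ C * (n : ℝ) ^ γ)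
include hc hT

theorem rate_pos {n : ℕ} (hn : 1 ≤ n) : 0 < T n := by
  have hn0 : (0 : ℝ) < n := by positivity
  exact lt_of_lt_of_le (by positivity) (hT n hn).1

theorem tendsto_rate (hγ : 0 < γ) : Tendsto T atTop atTop := by
  have h1 := ((tendsto_rpow_atTop hγ).comp (tendsto_natCast_atTop_atTop (R := ℝ))).const_mul_atTop
    hc
  refine tendsto_atTop_mono' _ ?_ h1
  filter_upwards [eventually_ge_atTop 1] with n hn using (hT n hn).1

/-- For `n ≥ 1` the added one is at most `n^γ`, so it only changes the constant to `C + 1`. -/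
theorem floor_rate_rpow_le (hγ : 0 < γ) {s : ℝ} (hs : 0 ≤ s) {n : ℕ} (hn : 1 ≤ n) :
    ((⌊T n⌋₊ : ℝ) + 1) ^ s ≤ (C + 1) ^ s * (n : ℝ) ^ (γ * s) := by
  have hn0 : (0 : ℝ) < n := by positivity
  have hT0 := rate_pos hc hT hn
  have h1 : (1 : ℝ) ≤ (n : ℝ) ^ γ := Real.one_le_rpow (by exact_mod_cast hn) hγ.le
  have h2 := (hT n hn).2
  have hC : 0 < C := by
    by_contra hC
    nlinarith
  have h3 : (⌊T n⌋₊ : ℝ) + 1 ≤ (C + 1) * (n : ℝ) ^ γ := by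
    have := Nat.floor_le hT0.le
    nlinarith
  rw [Real.rpow_mul hn0.le, ← Real.mul_rpow (by positivity) (by positivity)]
  gcongr

theorem le_rate_rpow {s : ℝ} (hs : 0 ≤ s) {n : ℕ} (hn : 1 ≤ n) :
    c ^ s * (n : ℝ) ^ (γ * s) ≤ T n ^ s := by
  have hn0 : (0 : ℝ) < n := by positivity
  rw [Real.rpow_mul hn0.le, ← Real.mul_rpow hc.le (by positivity)]
  gcongr
  exact (hT n hn).1

end Rates

/-! ### Moments of the deconvolution weights and the choice of truncation rate. -/

section Main

variable {d : ℕ} {B : HarmFamily d} {Ω : Type*} [MeasurableSpace Ω] {P : Measure Ω}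
  [IsProbabilityMeasure P] {X : Ω → Sph d} {U : Ω → SO d} {ε : Ω → ℝ} {fX : Sph d → ℝ}
  {fU : SO d → ℝ}

theorem sq_integral_le_of_abs_le {f : Ω → ℝ} {K : ℝ} (hf : ∀ ω, |f ω| ≤ K) :
    ∫ ω, f ω ^ 2 ∂P ≤ K ^ 2 := by
  have h1 := norm_integral_le_of_norm_le_const (μ := P) (f := fun ω => f ω ^ 2) (C := K ^ 2)
    (Eventually.of_forall fun ω => by
      rw [norm_pow, Real.norm_eq_abs]
      gcongr
      exact hf ω)
  simp only [probReal_univ, mul_one] at h1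
  exact (le_abs_self _).trans h1

omit [IsProbabilityMeasure P] in
theorem integral_re_mul {K : Ω → ℂ} {g : Ω → ℝ} (hi : Integrable (fun ω => K ω * (g ω : ℂ)) P) :
    ∫ ω, (K ω).re * g ω ∂P = (∫ ω, K ω * (g ω : ℂ) ∂P).re := by
  have := Complex.reCLM.integral_comp_comm hi
  simp only [Complex.reCLM_apply] at this
  rw [← this]
  simp

theorem DeconvModel.integral_re_kernel (h : DeconvModel P X U ε fX fU) (hB : IsHarmONB B)
    (hinv : ∀ l, IsUnit (rotFourier B fU l)) (T : ℝ) (x : Sph d) :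
    ∫ ω, (kernel B fU T x (rot (U ω) (X ω))).re ∂P =
      (∑ l ∈ Finset.range (⌊T⌋₊ + 1), fourierLaplaceTerm B fX l x).re := by
  obtain ⟨K, hK⟩ := exists_bound_of_continuous (continuous_kernel hB fU T x)
  have hi : Integrable (fun ω => kernel B fU T x (rot (U ω) (X ω))) P :=
    Integrable.of_bound ((continuous_kernel hB fU T x).measurable.comp
      h.measurable_obs).aestronglyMeasurable K (Eventually.of_forall fun ω => hK _)
  have := Complex.reCLM.integral_comp_comm hi
  simp only [Complex.reCLM_apply] at this
  rw [this, h.integral_kernel hB hinv]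

theorem DeconvModel.integral_re_kernel_mul (h : DeconvModel P X U ε fX fU) (hB : IsHarmONB B)
    (hinv : ∀ l, IsUnit (rotFourier B fU l)) {m : Sph d → ℝ} (hm : Continuous m) (T : ℝ)
    (x : Sph d) (a : ℝ) :
    ∫ ω, (kernel B fU T x (rot (U ω) (X ω))).re * (m (X ω) + ε ω - a) ∂P =
      (∑ l ∈ Finset.range (⌊T⌋₊ + 1), fourierLaplaceTerm B (fun x => m x * fX x) l x).re -
      a * (∑ l ∈ Finset.range (⌊T⌋₊ + 1), fourierLaplaceTerm B fX l x).re := by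
  obtain ⟨K, hK⟩ := exists_bound_of_continuous (continuous_kernel hB fU T x)
  have hkm : AEStronglyMeasurable (fun ω => kernel B fU T x (rot (U ω) (X ω))) P :=
    ((continuous_kernel hB fU T x).measurable.comp h.measurable_obs).aestronglyMeasurable
  have i1 : Integrable (fun ω => kernel B fU T x (rot (U ω) (X ω)) *
      ((m (X ω) + ε ω : ℝ) : ℂ)) P :=
    ((h.integrable_comp hm).add h.integrable_error).ofReal.bdd_mul (c := K) hkm
      (Eventually.of_forall fun ω => hK _)
  have i2 : Integrable (fun ω => (kernel B fU T x (rot (U ω) (X ω))).re * (m (X ω) + ε ω)) P := by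
    refine i1.re.congr (Eventually.of_forall fun ω => ?_)
    simp only [RCLike.re_eq_complex_re, Complex.re_mul_ofReal]
  have i3 : Integrable (fun ω => a * (kernel B fU T x (rot (U ω) (X ω))).re) P :=
    (Integrable.of_bound hkm K (Eventually.of_forall fun ω => hK _)).re.const_mul a
  have e : ∫ ω, (kernel B fU T x (rot (U ω) (X ω))).re * (m (X ω) + ε ω - a) ∂P =
      ∫ ω, (kernel B fU T x (rot (U ω) (X ω))).re * (m (X ω) + ε ω) ∂P -
      ∫ ω, a * (kernel B fU T x (rot (U ω) (X ω))).re ∂P := by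
    rw [← integral_sub i2 i3]
    refine integral_congr_ae (Eventually.of_forall fun ω => ?_)
    simp only
    ring
  rw [e, integral_const_mul, h.integral_re_kernel hB hinv, integral_re_mul i1,
    h.integral_kernel_mul_response hB hinv hm]

theorem DeconvModel.integrable_error_sq (h : DeconvModel P X U ε fX fU) {m : Sph d → ℝ}
    (hm : Continuous m) {δ : ℝ} (hδ : 0 < δ)
    (hi : Integrable (fun ω => |m (X ω) + ε ω| ^ (2 + δ)) P) :
    Integrable (fun ω => ε ω ^ 2) P := by
  obtain ⟨K, hK⟩ := exists_bound_of_continuous hm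
  have hmX : AEStronglyMeasurable (fun ω => m (X ω)) P :=
    (hm.measurable.comp h.measurable_fst).aestronglyMeasurable
  have hY : MemLp (fun ω => m (X ω) + ε ω) 2 P := by
    have hYm : AEStronglyMeasurable (fun ω => m (X ω) + ε ω) P :=
      hmX.add h.measurable_error.aestronglyMeasurable
    refine (memLp_two_iff_integrable_sq hYm).2 ?_
    refine ((integrable_const (1 : ℝ)).add hi).mono' (hYm.pow 2) (Eventually.of_forall fun ω => ?_)
    have := rpow_le_one_add_rpow (abs_nonneg (m (X ω) + ε ω)) (p := 2) (q := 2 + δ) (by norm_num)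
      (by linarith)
    rw [Real.norm_of_nonneg (sq_nonneg _), ← sq_abs, ← Real.rpow_two]
    exact this
  have h2 := (hY.sub (MemLp.of_bound hmX K (Eventually.of_forall fun ω => hK _))).integrable_sq
  refine h2.congr (Eventually.of_forall fun ω => ?_)
  simp

/-- All rates are balanced here: truncation error `o(T^(-2k))`, second moment at least of order
`T^(2β+d)`, weights at most of order `T^(β+d)`, and `T` of order `n^γ`. -/
theorem DeconvModel.ratioArray (h : DeconvModel P X U ε fX fU) (hd : 1 ≤ d) (hB : IsHarmONB B)
    (hinv : ∀ l, IsUnit (rotFourier B fU l)) {β : ℝ} (hβ : 0 ≤ β) {c₁ : ℝ} (hc₁ : 0 < c₁)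
    (hS1 : ∀ l : ℕ, 1 ≤ l → opNorm (rotFourier B fU l)⁻¹ ≤ c₁ * (l : ℝ) ^ β)
    {k : ℕ} (hk : d < 4 * k) {m : Sph d → ℝ} (hfX : IsCs (2 * k) fX) (hm : IsCs (2 * k) m)
    {T : ℕ → ℝ} {c C : ℝ} (hc : 0 < c)
    (hT : ∀ n : ℕ, 1 ≤ n → c * (n : ℝ) ^ (1 / (4 * (k : ℝ) + 2 * β + d)) ≤ T n ∧
      T n ≤ C * (n : ℝ) ^ (1 / (4 * (k : ℝ) + 2 * β + d)))
    {δ : ℝ} (hδ : 0 < δ) (hi : Integrable (fun ω => |m (X ω) + ε ω| ^ (2 + δ)) P) {C₀ : ℝ}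
    (hC₀ : ∀ᵐ ω ∂P, (P[fun ω => |m (X ω) + ε ω| ^ (2 + δ) |
      MeasurableSpace.comap X inferInstance]) ω ≤ C₀) {c₀ : ℝ} (hc₀ : 0 < c₀)
    (hεsq : ∀ᵐ ω ∂P,
      c₀ ≤ (P[fun ω => ε ω ^ 2 | MeasurableSpace.comap X inferInstance]) ω)
    {x : Sph d} (hx : 0 < fX x) {c₂ : ℝ} (hc₂ : 0 < c₂)
    (hB1 : ∀ n : ℕ, 1 ≤ n → c₂ * (T n) ^ (2 * β + d) ≤
      ∫ ω, (kernel B fU (T n) x (rot (U ω) (X ω))).re ^ 2 ∂P)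
    (hF1 : FourierLaplaceAbsConv B (sphLaplacian^[k] fX))
    (hF2 : FourierLaplaceAbsConv B (sphLaplacian^[k] fun x => m x * fX x)) :
    ∃ δ' c' C' M, RatioArray P (fun ω => m (X ω) + ε ω) (fun ω => rot (U ω) (X ω))
      (fun n z => (kernel B fU (T n) x z).re) (m x) (fX x) δ' c' C' M := by
  have hk' : (d : ℝ) < 4 * k := by exact_mod_cast hk
  have hd' : (0 : ℝ) < d := by exact_mod_cast hd
  have hmc := hm.continuous
  set γ : ℝ := 1 / (4 * (k : ℝ) + 2 * β + d) with hγdef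
  have hden : 0 < 4 * (k : ℝ) + 2 * β + d := by linarith
  have hγ : 0 < γ := by positivity
  have hTtop := tendsto_rate hc hT hγ
  have hmul : IsCs (2 * k) fun x => m x * fX x := hm.mul hfX
  have hE1 := tendsto_pow_mul_truncation_error hB hd hk hfX hF1 hTtop x
  have hE2 := tendsto_pow_mul_truncation_error hB hd hk hmul hF2 hTtop x
  set e1 : ℕ → ℝ := fun n =>
    ‖∑ l ∈ Finset.range (⌊T n⌋₊ + 1), fourierLaplaceTerm B fX l x - fX x‖ with he1
  set e2 : ℕ → ℝ := fun n => ‖∑ l ∈ Finset.range (⌊T n⌋₊ + 1),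
    fourierLaplaceTerm B (fun x => m x * fX x) l x - ((m x * fX x : ℝ) : ℂ)‖ with he2
  have hw : ∀ n, Continuous fun z => (kernel B fU (T n) x z).re := fun n =>
    Complex.continuous_re.comp (continuous_kernel hB fU (T n) x)
  set A : ℝ := 2 * (opNorm (rotFourier B fU 0)⁻¹ + c₁) / area d with hA
  set M : ℕ → ℝ := fun n => A * ((⌊T n⌋₊ : ℝ) + 1) ^ (β + d) with hM
  have hA0 : 0 ≤ A := by
    have := area_pos d
    have ho : 0 ≤ opNorm (rotFourier B fU 0)⁻¹ := norm_nonneg _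
    positivity
  have hbd : ∀ n z, |(kernel B fU (T n) x z).re| ≤ M n := fun n z =>
    (Complex.abs_re_le_norm _).trans (norm_kernel_le hB hd hβ hc₁ hS1 (T n) x z)
  set v : ℕ → ℝ := fun n => ∫ ω, (kernel B fU (T n) x (rot (U ω) (X ω))).re ^ 2 ∂P with hv
  have hv0 : ∀ n, 1 ≤ n → 0 < v n := fun n hn =>
    lt_of_lt_of_le (mul_pos hc₂ (Real.rpow_pos_of_pos (rate_pos hc hT hn) _)) (hB1 n hn)
  have hvM : ∀ n, v n ≤ M n ^ 2 := fun n => sq_integral_le_of_abs_le fun ω => hbd n _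
  set A' : ℝ := (A * (C + 1) ^ (β + d)) ^ 2 with hA'
  have hMn : ∀ n, 1 ≤ n → M n ^ 2 ≤ A' * (n : ℝ) ^ (γ * (2 * β + 2 * d)) := fun n hn => by
    have h1 := floor_rate_rpow_le hc hT hγ (show 0 ≤ β + d by positivity) hn
    calc M n ^ 2 ≤ (A * ((C + 1) ^ (β + d) * (n : ℝ) ^ (γ * (β + d)))) ^ 2 := by
          simp only [hM]
          gcongr
      _ = A' * ((n : ℝ) ^ (γ * (β + d))) ^ 2 := by
          rw [hA']
          ring
      _ = _ := by
          rw [← Real.rpow_natCast, ← Real.rpow_mul (by positivity)]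
          congr 2
          push_cast
          ring
  set D : ℝ := 1 + 2 ^ (2 + δ) * (C₀ + |m x| ^ (2 + δ)) with hD
  have hmom : ∀ p : ℝ, 0 ≤ p → p ≤ 2 + δ → ∀ n,
      ∫ ω, (kernel B fU (T n) x (rot (U ω) (X ω))).re ^ 2 * |m (X ω) + ε ω - m x| ^ p ∂P ≤
        D * v n := fun p hp hpq n =>
    h.integral_sq_mul_rpow_le (hw n) hmc hp hpq hi hC₀ (m x)
  have hmean : ∀ n, |∫ ω, (kernel B fU (T n) x (rot (U ω) (X ω))).re ∂P - fX x| ≤ e1 n :=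
      fun n => by
    rw [h.integral_re_kernel hB hinv]
    have := Complex.abs_re_le_norm
      (∑ l ∈ Finset.range (⌊T n⌋₊ + 1), fourierLaplaceTerm B fX l x - fX x)
    simpa using this
  have hbias : ∀ n, |∫ ω, (kernel B fU (T n) x (rot (U ω) (X ω))).re *
      (m (X ω) + ε ω - m x) ∂P| ≤ e2 n + |m x| * e1 n := fun n => by
    have h1 := hmean n
    rw [h.integral_re_kernel hB hinv] at h1
    have h2 := Complex.abs_re_le_norm (∑ l ∈ Finset.range (⌊T n⌋₊ + 1),
      fourierLaplaceTerm B (fun x => m x * fX x) l x - ((m x * fX x : ℝ) : ℂ))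
    rw [Complex.sub_re, Complex.ofReal_re] at h2
    rw [h.integral_re_kernel_mul hB hinv hmc]
    set s2 := (∑ l ∈ Finset.range (⌊T n⌋₊ + 1), fourierLaplaceTerm B (fun x => m x * fX x) l x).re
    set s1 := (∑ l ∈ Finset.range (⌊T n⌋₊ + 1), fourierLaplaceTerm B fX l x).re
    calc |s2 - m x * s1| = |(s2 - m x * fX x) - m x * (s1 - fX x)| := by
          congr 1
          ring
      _ ≤ |s2 - m x * fX x| + |m x| * |s1 - fX x| := by
          rw [← abs_mul]
          exact abs_sub _ _
      _ ≤ _ := by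
          gcongr
  -- The expansion of the characteristic function needs an exponent at most one; lowering `δ` only
  -- weakens the moment condition.
  have hδ' : min δ 1 ≤ δ := min_le_left _ _
  have hir : Integrable (fun ω => |m (X ω) + ε ω - m x| ^ (2 + min δ 1)) P := by
    have hm1 : Measurable fun ω => |m (X ω) + ε ω - m x| ^ (2 + min δ 1) :=
      ((((hmc.measurable.comp h.measurable_fst).add h.measurable_error).sub_const
        (m x)).abs).pow_const _
    refine Integrable.mono' (g := fun ω => 1 + 2 ^ (2 + δ) * (|m (X ω) + ε ω| ^ (2 + δ) +
      |m x| ^ (2 + δ))) ?_ hm1.aestronglyMeasurable (Eventually.of_forall fun ω => ?_)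
    · exact (integrable_const (1 : ℝ)).add ((hi.add (integrable_const _)).const_mul _)
    · have hmin : 0 < min δ 1 := lt_min hδ one_pos
      rw [Real.norm_of_nonneg (by positivity)]
      have h1 := rpow_le_one_add_rpow (abs_nonneg (m (X ω) + ε ω - m x))
        (show 0 ≤ 2 + min δ 1 by linarith) (show 2 + min δ 1 ≤ 2 + δ by linarith)
      have h2 := abs_sub_rpow_le (show 0 ≤ 2 + δ by linarith) (m (X ω) + ε ω) (m x)
      linarith
  refine ⟨min δ 1, c₀, D, M, ⟨hx, lt_min hδ one_pos, min_le_right _ _, hc₀,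
    fun n => (hw n).measurable, ?_, h.measurable_obs.aemeasurable, ?_, hbd, ?_, hv0, ?_, ?_,
    fun n => ?_, fun n => ?_, fun n => ?_, ?_⟩⟩
  · exact ((hmc.measurable.comp h.measurable_fst).add h.measurable_error).aemeasurable
  · exact hir
  · have h1 : Tendsto e1 atTop (𝓝 0) := by
      refine squeeze_zero' (Eventually.of_forall fun n => norm_nonneg _) ?_ hE1
      filter_upwards [hTtop.eventually_ge_atTop 1] with n hn
      exact le_mul_of_one_le_left (norm_nonneg _) (one_le_pow₀ hn)
    rw [tendsto_iff_norm_sub_tendsto_zero]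
    exact squeeze_zero (fun _ => norm_nonneg _) hmean h1
  -- Equivalent to `d < 4k`. The second moment is bounded crudely by `M²`, of order at most
  -- `n^(γ(2β+2d))`.
  · have h1 : γ * (2 * β + 2 * d) < 1 := by
      rw [hγdef, one_div, inv_mul_lt_iff₀ hden]
      linarith
    refine squeeze_zero' ?_ ?_ (tendsto_const_mul_rpow_div (K := A') h1)
    · filter_upwards with n
      positivity
    · filter_upwards [eventually_ge_atTop 1] with n hn
      rw [← mul_div_assoc]
      gcongr
      exact (hvM n).trans (hMn n hn)
  -- `T^s` is the product of `T^(2k)`, which normalizes the truncation error, and `T^(β+d/2)`, the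
  -- root of the lower bound on the second moment. Since `γ s = 1/2`, `√n` is at most a constant
  -- times `T^s`.
  · set s : ℝ := 2 * k + (β + d / 2) with hs
    have hs0 : 0 ≤ s := by positivity
    have hγs : γ * s = 1 / 2 := by
      rw [hγdef, hs]
      field_simp
      ring
    have hz : Tendsto (fun n => (c ^ s)⁻¹ * (√c₂)⁻¹ * (T n ^ (2 * k) * e2 n +
        |m x| * (T n ^ (2 * k) * e1 n))) atTop (𝓝 0) := by
      have h1 := (hE2.add (hE1.const_mul |m x|)).const_mul ((c ^ s)⁻¹ * (√c₂)⁻¹)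
      rw [mul_zero, add_zero, mul_zero] at h1
      exact h1
    refine squeeze_zero_norm' ?_ hz
    filter_upwards [eventually_ge_atTop 1] with n hn
    have hn0 : (0 : ℝ) < n := by positivity
    have hT0 := rate_pos hc hT hn
    have h1 := le_rate_rpow hc hT hs0 hn
    rw [hγs, ← Real.sqrt_eq_rpow] at h1
    have hcs : 0 < c ^ s := Real.rpow_pos_of_pos hc s
    have h2 : T n ^ s = T n ^ (2 * k) * √(T n ^ (2 * β + d)) := by
      rw [hs, Real.rpow_add hT0, Real.sqrt_eq_rpow, ← Real.rpow_mul hT0.le]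
      congr 1
      · rw [← Real.rpow_natCast]
        push_cast
        rfl
      · congr 1
        ring
    have h3 : √c₂ * √(T n ^ (2 * β + d)) ≤ √(v n) := by
      rw [← Real.sqrt_mul hc₂.le]
      exact Real.sqrt_le_sqrt (hB1 n hn)
    have h4 : 0 < √(T n ^ (2 * β + d)) := Real.sqrt_pos.2 (Real.rpow_pos_of_pos hT0 _)
    have h5 : 0 < √c₂ := Real.sqrt_pos.2 hc₂
    have h6 := hbias n
    have h7 : √(n : ℝ) ≤ (c ^ s)⁻¹ * (T n ^ (2 * k) * √(T n ^ (2 * β + d))) := by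
      rw [← h2]
      calc √(n : ℝ) = (c ^ s)⁻¹ * (c ^ s * √(n : ℝ)) := by field_simp
        _ ≤ _ := by gcongr
    have h8 : 0 ≤ e2 n + |m x| * e1 n := (abs_nonneg _).trans h6
    rw [Real.norm_eq_abs, abs_div, abs_mul, abs_of_nonneg (Real.sqrt_nonneg (n : ℝ)),
      abs_of_nonneg (Real.sqrt_nonneg (v n))]
    calc _ ≤ (c ^ s)⁻¹ * (T n ^ (2 * k) * √(T n ^ (2 * β + d))) * (e2 n + |m x| * e1 n) /
          (√c₂ * √(T n ^ (2 * β + d))) := by gcongr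
      _ = _ := by
        field_simp
  · exact h.le_integral_sq_mul_sq (hw n) hmc (h.integrable_error_sq hmc hδ hi) hεsq (m x)
  · refine le_trans (le_of_eq ?_) (hmom 2 (by norm_num) (by linarith) n)
    refine integral_congr_ae (Eventually.of_forall fun ω => ?_)
    simp only [Real.rpow_two, sq_abs, mul_pow]
  · have hmin : 0 < min δ 1 := lt_min hδ one_pos
    have h1 := hmom (2 + min δ 1) (by linarith) (by linarith) n
    have hM0 : 0 ≤ M n := by
      simp only [hM]
      positivity
    have hwm : Measurable fun ω => (kernel B fU (T n) x (rot (U ω) (X ω))).re ^ 2 :=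
      ((hw n).measurable.comp h.measurable_obs).pow_const 2
    have hi2 : Integrable (fun ω => (kernel B fU (T n) x (rot (U ω) (X ω))).re ^ 2 *
        |m (X ω) + ε ω - m x| ^ (2 + min δ 1)) P := by
      refine hir.bdd_mul (c := M n ^ 2) hwm.aestronglyMeasurable
        (Eventually.of_forall fun ω => ?_)
      rw [norm_pow, Real.norm_eq_abs]
      gcongr
      exact hbd n _
    calc _ ≤ ∫ ω, M n ^ min δ 1 * ((kernel B fU (T n) x (rot (U ω) (X ω))).re ^ 2 *
          |m (X ω) + ε ω - m x| ^ (2 + min δ 1)) ∂P := by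
          refine integral_mono_of_nonneg (Eventually.of_forall fun ω => by positivity)
            (hi2.const_mul _) (Eventually.of_forall fun ω => ?_)
          simp only [abs_mul]
          rw [Real.mul_rpow (abs_nonneg _) (abs_nonneg _),
            Real.rpow_add_of_nonneg (abs_nonneg (kernel B fU (T n) x _).re) (by norm_num) hmin.le,
            Real.rpow_two, sq_abs, ← mul_assoc, mul_comm (M n ^ min δ 1)]
          gcongr
          exact hbd n _
      _ ≤ M n ^ min δ 1 * (D * v n) := by
          rw [integral_const_mul]
          gcongr
      _ = _ := by ring
  -- `M² / (n v)` is at most of order `n^(γ(2β+2d)) / (n · n^(γ(2β+d))) = n^(γ d) / n`.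
  · have h1 : γ * d < 1 := by
      rw [hγdef, one_div, inv_mul_lt_iff₀ hden]
      linarith
    refine squeeze_zero' ?_ ?_ (tendsto_const_mul_rpow_div
      (K := A' / (c₂ * c ^ (2 * β + d))) h1)
    · filter_upwards [eventually_ge_atTop 1] with n hn
      have := hv0 n hn
      exact div_nonneg (sq_nonneg _) (mul_nonneg (Nat.cast_nonneg n) this.le)
    · filter_upwards [eventually_ge_atTop 1] with n hn
      have hn0 : (0 : ℝ) < n := by positivity
      have h2 := le_rate_rpow hc hT (show 0 ≤ 2 * β + d by positivity) hn
      have h3 : c₂ * (c ^ (2 * β + d) * (n : ℝ) ^ (γ * (2 * β + d))) ≤ v n := by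
        refine le_trans ?_ (hB1 n hn)
        gcongr
      have hcs : 0 < c ^ (2 * β + d) := Real.rpow_pos_of_pos hc _
      calc _ ≤ A' * (n : ℝ) ^ (γ * (2 * β + 2 * d)) /
            (n * (c₂ * (c ^ (2 * β + d) * (n : ℝ) ^ (γ * (2 * β + d))))) := by
            gcongr
            exact hMn n hn
        _ = _ := by
            rw [show γ * (2 * β + 2 * d) = γ * d + γ * (2 * β + d) by ring,
              Real.rpow_add hn0]
            have : 0 < (n : ℝ) ^ (γ * (2 * β + d)) := Real.rpow_pos_of_pos hn0 _
            field_simp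

end Main

end SphereDeconv

open SphereDeconv in
theorem mainTheorem5 {Ω Ω' : Type*} [MeasurableSpace Ω] [MeasurableSpace Ω']
    (P : Measure Ω) [IsProbabilityMeasure P] (P' : Measure Ω') [IsProbabilityMeasure P']
    (d : ℕ) (hd : 1 ≤ d)
    -- an orthonormal basis of spherical harmonics in each degree
    (B : HarmFamily d) (hB : IsHarmONB B)
    -- the population variables: `Y = m(X) + ε`, `Z = U X`
    (X : Ω → Sph d) (U : Ω → SO d) (ε Y : Ω → ℝ) (Z : Ω → Sph d) (m : Sph d → ℝ)
    (hX : Measurable X) (hU : Measurable U) (hε : Measurable ε)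
    (hY : ∀ ω, Y ω = m (X ω) + ε ω) (hZ : ∀ ω, Z ω = rot (U ω) (X ω))
    (hind : IndepFun U (fun ω => (X ω, ε ω)) P)
    (hεint : Integrable ε P)
    (hεmean : P[ε | MeasurableSpace.comap X inferInstance] =ᵐ[P] 0)
    -- the densities of `X` and `U`
    (fX : Sph d → ℝ) (hfX : P.map X = (surf d).withDensity fun x => ENNReal.ofReal (fX x))
    (fU : SO d → ℝ) (hfU0 : ∀ u, 0 ≤ fU u) (hfU2 : MemLp fU 2 (haarSO d))
    (hfU : P.map U = (haarSO d).withDensity fun u => ENNReal.ofReal (fU u))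
    (hinv : ∀ l, IsUnit (rotFourier B fU l))
    -- the observations: i.i.d. copies of `(Y, Z)`
    (Yobs : ℕ → Ω' → ℝ) (Zobs : ℕ → Ω' → Sph d)
    (hindep : iIndepFun (fun i ω => (Yobs i ω, Zobs i ω)) P')
    (hident : ∀ i, IdentDistrib (fun ω => (Yobs i ω, Zobs i ω)) (fun ω => (Y ω, Z ω)) P' P)
    -- ordinary smoothness of order `β` (upper bound)
    (β : ℝ) (hβ : 0 ≤ β)
    (hS1 : ∃ c₁ : ℝ, 0 < c₁ ∧ ∀ l : ℕ, 1 ≤ l → opNorm (rotFourier B fU l)⁻¹ ≤ c₁ * (l : ℝ) ^ β)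
    -- smoothness of `fX` and `m`
    (k : ℕ) (hk : (d : ℝ) / 4 < k) (hA1i : IsCs (2 * k) fX) (hA1ii : IsCs (2 * k) m)
    -- `fX` is bounded away from zero
    (hA2i : ∃ c : ℝ, 0 < c ∧ ∀ x, c ≤ fX x)
    -- `T n ≍ n ^ (1 / (4 k + 2 β + d))`
    (T : ℕ → ℝ)
    (hT : ∃ c C : ℝ, 0 < c ∧ 0 < C ∧ ∀ n : ℕ, 1 ≤ n →
      c * (n : ℝ) ^ (1 / (4 * (k : ℝ) + 2 * β + d)) ≤ T n ∧
      T n ≤ C * (n : ℝ) ^ (1 / (4 * (k : ℝ) + 2 * β + d)))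
    -- conditional moments of `Y` and `ε` given `X`
    (hB4i : ∃ δ : ℝ, 0 < δ ∧ Integrable (fun ω => |Y ω| ^ (2 + δ)) P ∧
      ∃ C : ℝ, ∀ᵐ ω ∂P,
        (P[fun ω => |Y ω| ^ (2 + δ) | MeasurableSpace.comap X inferInstance]) ω ≤ C)
    (hB4ii : ∃ c : ℝ, 0 < c ∧ ∀ᵐ ω ∂P,
      c ≤ (P[fun ω => ε ω ^ 2 | MeasurableSpace.comap X inferInstance]) ω)
    -- lower bound on the second moment of the kernel
    (hB1 : ∀ x : Sph d, ∃ c : ℝ, 0 < c ∧ ∀ n : ℕ, 1 ≤ n →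
      c * (T n) ^ (2 * β + d) ≤ ∫ ω, (kernel B fU (T n) x (Z ω)).re ^ 2 ∂P)
    -- absolute convergence of Fourier-Laplace series
    (hF1 : FourierLaplaceAbsConv B (sphLaplacian^[k] fX))
    (hF2 : FourierLaplaceAbsConv B (sphLaplacian^[k] fun x => m x * fX x)) :
    ∀ x : Sph d,
      TendstoInDistribution
        (fun (n : ℕ) ω => √(n : ℝ) *
          ((mHat B fU (T n) n (fun i => Yobs i ω) (fun i => Zobs i ω) x - m x) /
            sHat B fU (T n) n (fun i => Yobs i ω) (fun i => Zobs i ω) x))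
        atTop (id : ℝ → ℝ) (fun _ => P') (gaussianReal 0 1) ∧
      ∀ α : ℝ, 0 < α → α < 1 →
        Tendsto (fun n : ℕ => P'.real {ω |
          m x ∈ Set.Ioo
            (mHat B fU (T n) n (fun i => Yobs i ω) (fun i => Zobs i ω) x -
              normalUpperQuantile (α / 2) *
                (sHat B fU (T n) n (fun i => Yobs i ω) (fun i => Zobs i ω) x / √(n : ℝ)))
            (mHat B fU (T n) n (fun i => Yobs i ω) (fun i => Zobs i ω) x +
              normalUpperQuantile (α / 2) *
                (sHat B fU (T n) n (fun i => Yobs i ω) (fun i => Zobs i ω) x / √(n : ℝ)))})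
          atTop (𝓝 (1 - α)) := by
  obtain rfl : Z = fun ω => rot (U ω) (X ω) := funext hZ
  obtain rfl : Y = fun ω => m (X ω) + ε ω := funext hY
  obtain ⟨c₁, hc₁, hS1⟩ := hS1
  obtain ⟨cX, hcX, hA2⟩ := hA2i
  obtain ⟨c, C, hc, -, hT⟩ := hT
  obtain ⟨δ, hδ, hi, C₀, hC₀⟩ := hB4i
  obtain ⟨c₀, hc₀, hεsq⟩ := hB4ii
  intro x
  obtain ⟨c₂, hc₂, hB1⟩ := hB1 x
  have hmodel : DeconvModel P X U ε fX fU := ⟨hX, hU, hε, hind, hεint, hεmean, hA1i.continuous,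
    fun x => hcX.le.trans (hA2 x), hfX, hfU0, hfU2.aestronglyMeasurable.aemeasurable, hfU⟩
  have hk' : d < 4 * k := by
    have : (d : ℝ) < 4 * k := by linarith
    exact_mod_cast this
  obtain ⟨δ', c', C', M, h⟩ := hmodel.ratioArray hd hB hinv hβ hc₁ hS1 hk' hA1i hA1ii hc hT hδ hi
    hC₀ hc₀ hεsq (hcX.trans_le (hA2 x)) hc₂ hB1 hF1 hF2
  -- With weights `Re K`, the estimators `mHat` and `sHat` are `ratioMean` and the root of
  -- `ratioVar` by unfolding definitions.
  exact ⟨h.clt hindep hident, fun α hα0 hα1 => tendsto_coverage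
    (mh := fun n ω => mHat B fU (T n) n (fun i => Yobs i ω) (fun i => Zobs i ω) x)
    (sh := fun n ω => sHat B fU (T n) n (fun i => Yobs i ω) (fun i => Zobs i ω) x)
    (fun _ _ => Real.sqrt_nonneg _) (h.clt hindep hident)
    (h.tendsto_ratioVar_eq_zero hindep hident) hα0 hα1⟩
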